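/- Let $d\ge 2$, $n\ge 2$ and $1\le k<d$ be integers. Let $\Sigma\in\mathbb R^{d\times d}$ be a (positive semidefinite) correlation matrix, i.e. with $\Sigma_{jj}=1$ for all $j$, let $X_1,\dots,X_n$ be independent $N(0,\Sigma)$ random vectors in $\mathbb R^d$, let $f_1,\dots,f_d:\mathbb R\to\mathbb R$ be strictly increasing, and let $Y_{ij}=f_j(X_{ij})$ (the Gaussian copula model). Let $$\widehat\tau_{jk'}=\frac{2}{n(n-1)}\sum_{1\le i_1<i_2\le n}\operatorname{sgn}(Y_{i_1j}-Y_{i_2j})\operatorname{sgn}(Y_{i_1k'}-Y_{i_2k'}),$$ $$\widehat\rho_{jk'}=\frac{\sum_{i=1}^n\left(r_{ij}-\frac{n+1}2\right)\left(r_{ik'}-\frac{n+1}2\right)}{\sqrt{\sum_{i=1}^n\left(r_{ij}-\frac{n+1}2\right)^2\,\sum_{i=1}^n\left(r_{ik'}-\frac{n+1}2\right)^2}},$$ where $r_{ij}$ is the rank of $Y_{ij}$ among $Y_{1j},\dots,Y_{nj}$ (almost surely there are no ties), be Kendall's tau and Spearman's rho, and let $$\widehat\Sigma^\tau=\left(\sin\left(\tfrac{\pi}{2}\widehat\tau_{jk'}\right)\right)_{d\times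 d},\qquad \widehat\Sigma^\rho=\left(2\sin\left(\tfrac{\pi}{6}\widehat\rho_{jk'}\right)\right)_{d\times d}$$ be the corresponding estimators of $\Sigma$. Let $\lambda_1\ge\dots\ge\lambda_d$ be the eigenvalues of $\Sigma$, counted with multiplicity, and assume $\lambda_k>\lambda_{k+1}$. Let $P_k$, $\widehat P_k^\tau$ and $\widehat P_k^\rho$ be the orthogonal projections onto the span of $k$ leading eigenvectors of $\Sigma$, $\widehat\Sigma^\tau$ and $\widehat\Sigma^\rho$ respectively, i.e. of the first $k$ vectors of an orthonormal basis of eigenvectors listed in the order of decreasing eigenvalues (if the $k$-th and $(k+1)$-th largest eigenvalues of an estimator coincide, $\widehat P_k^\tau$ or $\widehat P_k^\rho$ may be any measurable choice of such a projection). Write $\|\cdot\|_S$ for the spectral norm. Then $$\max\left(\mathbb E\left\|\widehat P_k^\tau-P_k\right\|_S,\ \mathbb E\left\|\widehat P_k^\rho-P_k\right\|_S\right)\le \frac{C\,\|\Sigma\|_S\left(\sqrt{d/n}+d/n\right)}{\lambda_k-\lambda_{k+1}},$$ where $C>0$ is a numerical constant, independent of $n$, $d$, $k$, $\Sigma$ and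 $f_1,\dots,f_d$. -/

import Mathlib

open MeasureTheory ProbabilityTheory

noncomputable section

/-- A sample `Y 1, …, Y n` from the Gaussian copula model with latent correlation matrix `S`:
the latent vectors `X i` are independent with law `N(0, S)`, where `S` has unit diagonal (so that
every coordinate of `X i` is standard normal), and `Y i j = f j (X i j)` with each `f j`
strictly increasing. -/
structure IsGaussianCopulaSample {Ω : Type*} [MeasurableSpace Ω] (P : Measure Ω) {n d : ℕ}
    (S : Matrix (Fin d) (Fin d) ℝ) (f : Fin d → ℝ → ℝ)
    (X : Fin n → Ω → EuclideanSpace ℝ (Fin d)) (Y : Fin n → Fin d → Ω → ℝ) : Prop where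
  unit_diag : ∀ j, S j j = 1
  strictMono : ∀ j, StrictMono (f j)
  law : ∀ i, HasLaw (X i) (multivariateGaussian 0 S) P
  indep : iIndepFun X P
  obs : ∀ i j ω, Y i j ω = f j (X i ω j)

/-- Kendall's tau of columns `j` and `k` of the `n × d` data matrix `y`. -/
def kendallTau {n d : ℕ} (y : Fin n → Fin d → ℝ) (j k : Fin d) : ℝ :=
  2 / ((n : ℝ) * ((n : ℝ) - 1)) *
    ∑ i₁ : Fin n, ∑ i₂ ∈ Finset.Ioi i₁,
      Real.sign (y i₁ j - y i₂ j) * Real.sign (y i₁ k - y i₂ k)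

/-- The rank of `y i j` among `y 1 j, …, y n j` (`1` for the smallest value). -/
def dataRank {n d : ℕ} (y : Fin n → Fin d → ℝ) (i : Fin n) (j : Fin d) : ℝ :=
  ((Finset.univ.filter fun i' : Fin n => y i' j ≤ y i j).card : ℝ)

/-- Spearman's rho of columns `j` and `k` of the `n × d` data matrix `y`. -/
def spearmanRho {n d : ℕ} (y : Fin n → Fin d → ℝ) (j k : Fin d) : ℝ :=
  (∑ i : Fin n, (dataRank y i j - ((n : ℝ) + 1) / 2) * (dataRank y i k - ((n : ℝ) + 1) / 2)) /
    √((∑ i : Fin n, (dataRank y i j - ((n : ℝ) + 1) / 2) ^ 2) *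
      (∑ i : Fin n, (dataRank y i k - ((n : ℝ) + 1) / 2) ^ 2))

/-- The correlation matrix estimator based on Kendall's tau. -/
def kendallEstimator {n d : ℕ} (y : Fin n → Fin d → ℝ) : Matrix (Fin d) (Fin d) ℝ :=
  Matrix.of fun j k => Real.sin (Real.pi / 2 * kendallTau y j k)

/-- The correlation matrix estimator based on Spearman's rho. -/
def spearmanEstimator {n d : ℕ} (y : Fin n → Fin d → ℝ) : Matrix (Fin d) (Fin d) ℝ :=
  Matrix.of fun j k => 2 * Real.sin (Real.pi / 6 * spearmanRho y j k)

/-- The spectral norm, i.e. the `ℓ₂ → ℓ₂` operator norm, of a matrix. -/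
def spectralNorm₂ {d : ℕ} (A : Matrix (Fin d) (Fin d) ℝ) : ℝ :=
  ‖Matrix.toEuclideanCLM (n := Fin d) (𝕜 := ℝ) A‖

/-- The `(j + 1)`-th largest eigenvalue, counted with multiplicity, of a symmetric matrix. -/
def orderedEigenvalue {d : ℕ} {A : Matrix (Fin d) (Fin d) ℝ} (hA : A.IsHermitian) (j : Fin d) :
    ℝ :=
  hA.eigenvalues₀ (Fin.cast (Fintype.card_fin d).symm j)

/-- `Q` is the orthogonal projection onto the span of `k` leading eigenvectors of `A`: those
belonging to the `k` largest eigenvalues in an orthonormal basis of eigenvectors that is listed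
with decreasing eigenvalues. If the `k`-th and `(k + 1)`-th largest eigenvalues coincide, several
`Q` have this property. -/
def IsLeadingEigenprojection {d : ℕ} (A : Matrix (Fin d) (Fin d) ℝ) (k : ℕ)
    (Q : EuclideanSpace ℝ (Fin d) →L[ℝ] EuclideanSpace ℝ (Fin d)) : Prop :=
  ∃ (v : OrthonormalBasis (Fin d) ℝ (EuclideanSpace ℝ (Fin d))) (l : Fin d → ℝ),
    Antitone l ∧
    (∀ j, Matrix.toEuclideanCLM (n := Fin d) (𝕜 := ℝ) A (v j) = l j • v j) ∧
    Q = (Submodule.span ℝ (v '' {j : Fin d | (j : ℕ) < k})).starProjection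

end

/-!
By the Davis–Kahan theorem (`IsLeadingEigenprojection.gap_mul_norm_sub_le`) the distance of two
leading eigenprojections, times the eigengap, is at most four times the spectral distance of the
matrices. It therefore suffices to bound the expected spectral error of the two estimators by a
multiple of `‖Σ‖ * (√(d / n) + d / n)`. When `d > n / 3` nothing has to be estimated: two projections
are at distance at most `2` and the eigengap is at most `‖Σ‖`.

*Reduction to U-statistics of signs.* Strictly increasing transformations do not change the signs of
differences, so the copula functions disappear. Kendall's tau is a U-statistic of order two whose
kernel is a product of two signs (`kendallTau_eq_embeddingAverage`), and almost surely, in the absence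
of ties, Spearman's rho is within `O(1 / n)` of three times a U-statistic of order three of the same
form (`abs_spearmanRho_sub_le`). Sheppard's formula (`integral_sign_mul_sign_of_isGaussian`) identifies
the means of these kernels as `2 / π * arcsin (c * Σ j k)`, with `c = 1` and `c = 1 / 2` respectively,
and these are exactly the values that the sine transforms invert.

*Perturbation of the sine.* To first order, a perturbation of `arcsin (c * Σ)` is multiplied entrywise
by `cos (arcsin (c * Σ)) = 1 - (1 - √(1 - (c * Σ) ^ 2))`. Since `1 - √(1 - x ^ 2)` is a power series with
nonnegative coefficients, the Schur product theorem makes the second term a positive semidefinite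
matrix with diagonal at most one, hence a contractive Hadamard multiplier. So the linear term costs a
factor `2` in spectral norm, and the quadratic remainder is bounded in Frobenius norm
(`spectralNorm₂_sin_arcsin_add_sub_le`). The fourth moments of the entries make it of order `d / n`
(`exists_majorant_sqrt_sum_pow_four`).

*Concentration of the linear term.* The matrix of U-statistics has the kernel `a aᵀ` or `a bᵀ` with
sign vectors `a`, `b` of Gaussian vectors with correlation matrix `Σ`. The crucial fact is that such a
sign vector is sub-Gaussian with variance proxy `‖Σ‖` (`integral_exp_sum_sign_le`). It is an instance
of the Gaussian Brascamp–Lieb inequality: for `θ = 1 / ‖Σ‖` and positive functions `w j` of one variable,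
`𝔼 ∏ w j (Z j) ^ θ ≤ ∏ (𝔼 w j (Z j)) ^ θ`. The inequality is proved along the heat flow, which increases
the product of powers of the heat evolutions as long as `θ Σ ≤ 1`; here the flow is discretised in time
and the two sides of one step are compared through their second order expansions
(`integral_prod_rpow_step`). It is applied to functions `w j` with `w j ^ θ = exp (t j * sign)`.

A product of two sub-Gaussian variables is sub-exponential
(`integral_exp_mul_sub_le_of_subgaussian`), Hoeffding's decomposition carries exponential moments over
from independent blocks to U-statistics (`integral_exp_embeddingAverage_le`), and a net of `5 ^ d`
points reduces the spectral norm to finitely many bilinear forms (`exists_majorant_spectralNorm₂`).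
This gives the order `‖Σ‖ * √(d / n)` for `d ≤ n / 3`.

The spectral norms of the random matrices are bounded by integrable majorants, so that their
measurability plays no role.
-/

/-! ### Second order expansions of products of powers -/

lemma Real.log_one_add_le_cubic {r : ℝ} (hr : -1 < r) :
    Real.log (1 + r) ≤ r - r ^ 2 / 2 + r ^ 3 / 3 := by
  set g : ℝ → ℝ := fun x => x - x ^ 2 / 2 + x ^ 3 / 3 - Real.log (1 + x) with hg
  have hd : ∀ x, -1 < x → HasDerivAt g (x ^ 3 / (1 + x)) x := by
    intro x hx
    have h1 : (1 + x) ≠ 0 := by linarith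
    have h := (((hasDerivAt_id x).sub (((hasDerivAt_id x).pow 2).div_const 2)).add
      (((hasDerivAt_id x).pow 3).div_const 3)).sub (((hasDerivAt_id x).const_add 1).log h1)
    refine h.congr_deriv ?_
    simp only [id]
    field_simp
    ring
  have hc : ContinuousOn g (Set.Ioi (-1)) := fun x hx =>
    (hd x hx).continuousAt.continuousWithinAt
  have h0 : g 0 = 0 := by simp [hg]
  suffices 0 ≤ g r by simp only [hg] at this; linarith
  rcases le_total 0 r with h | h
  · have : MonotoneOn g (Set.Ici 0) := by
      refine monotoneOn_of_deriv_nonneg (convex_Ici 0)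
        (hc.mono fun x hx => lt_of_lt_of_le (by norm_num) (Set.mem_Ici.1 hx)) ?_ ?_
      · intro x hx
        rw [interior_Ici] at hx
        exact (hd x (by linarith [Set.mem_Ioi.1 hx])).differentiableAt.differentiableWithinAt
      · intro x hx
        rw [interior_Ici, Set.mem_Ioi] at hx
        rw [(hd x (by linarith)).deriv]
        positivity
    rw [← h0]
    exact this Set.self_mem_Ici (Set.mem_Ici.2 h) h
  · have : AntitoneOn g (Set.Ioc (-1) 0) := by
      refine antitoneOn_of_deriv_nonpos (convex_Ioc (-1) 0)
        (hc.mono fun x hx => hx.1) ?_ ?_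
      · intro x hx
        rw [interior_Ioc] at hx
        exact (hd x hx.1).differentiableAt.differentiableWithinAt
      · intro x hx
        rw [interior_Ioc] at hx
        rw [(hd x hx.1).deriv]
        exact div_nonpos_of_nonpos_of_nonneg (by have := hx.2.le; exact Odd.pow_nonpos (by decide) this)
          (by linarith [hx.1])
    rw [← h0]
    exact this ⟨hr, h⟩ (by simp) h

lemma Real.exp_le_quadratic_add (y : ℝ) :
    Real.exp y ≤ 1 + y + y ^ 2 / 2 + |y| ^ 3 * Real.exp |y| := by
  have h := Complex.norm_exp_sub_sum_le_norm_mul_exp (y : ℂ) 3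
  have h2 : Complex.exp y - ∑ m ∈ Finset.range 3, (y : ℂ) ^ m / (m.factorial : ℂ)
      = ((Real.exp y - (1 + y + y ^ 2 / 2) : ℝ) : ℂ) := by
    simp [Finset.sum_range_succ, Nat.factorial]
  rw [h2, Complex.norm_real, Complex.norm_real, Real.norm_eq_abs, Real.norm_eq_abs] at h
  linarith [le_abs_self (Real.exp y - (1 + y + y ^ 2 / 2))]

/-- `w` is bounded between `a` and `b`, `M`-Lipschitz, and has a second order Taylor expansion with
bounded coefficients `w₁`, `w₂` and a uniform cubic remainder. No differentiability is recorded, so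
that the notion is visibly stable under averaging over translations. -/
structure HasTaylor (a b M : ℝ) (w w₁ w₂ : ℝ → ℝ) : Prop where
  meas : Measurable w
  meas₁ : Measurable w₁
  meas₂ : Measurable w₂
  lower : ∀ x, a ≤ w x
  upper : ∀ x, w x ≤ b
  bound₁ : ∀ x, |w₁ x| ≤ M
  bound₂ : ∀ x, |w₂ x| ≤ M
  lip : ∀ x h, |w (x + h) - w x| ≤ M * |h|
  taylor : ∀ x h, |w (x + h) - (w x + w₁ x * h + w₂ x * h ^ 2 / 2)| ≤ M * |h| ^ 3

/-- If `r` has the second order expansion `α * h + β * h ^ 2 / 2`, then the cubic Taylor polynomial of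
`log (1 + r)` has second order coefficient `β - α ^ 2`. The cruder bounds of lower order are valid for
all `h` because `r` is bounded by `B`. -/
lemma cubic_log_expansion {m B α β r h : ℝ} (hB : 0 ≤ B) (hm : 0 ≤ m)
    (hα : |α| ≤ m) (hβ : |β| ≤ m)
    (hr : |r| ≤ m * |h|) (hrB : |r| ≤ B) (hT : |r - α * h - β * h ^ 2 / 2| ≤ m * |h| ^ 3) :
    |(r - r ^ 2 / 2 + r ^ 3 / 3) - (α * h + (β - α ^ 2) * h ^ 2 / 2)|
        ≤ (m + 2 * m ^ 2 + m ^ 3) * |h| ^ 3 ∧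
    |(r - r ^ 2 / 2 + r ^ 3 / 3) - α * h| ≤ (2 * m + m ^ 2 + m ^ 2 * B) * |h| ^ 2 ∧
    |r - r ^ 2 / 2 + r ^ 3 / 3| ≤ (1 + B + B ^ 2) * (m * |h|) ∧
    |r - r ^ 2 / 2 + r ^ 3 / 3| ≤ (1 + B + B ^ 2) * B := by
  have hh := abs_nonneg h
  have hr0 := abs_nonneg r
  have hsq : |r| ^ 2 = r ^ 2 := sq_abs r
  have hhsq : |h| ^ 2 = h ^ 2 := sq_abs h
  have hαh : |α * h| ≤ m * |h| := by rw [abs_mul]; gcongr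
  have hβh : |β * h ^ 2 / 2| ≤ m * |h| ^ 2 := by
    rw [abs_div, abs_mul, abs_pow, abs_two]
    have : |β| * |h| ^ 2 ≤ m * |h| ^ 2 := by gcongr
    have h0 : 0 ≤ |β| * |h| ^ 2 := by positivity
    linarith
  -- the first order remainder is quadratic: by the expansion if `|h| ≤ 1`, trivially otherwise
  have h1 : |r - α * h| ≤ 2 * m * |h| ^ 2 := by
    rcases le_total |h| 1 with hle | hle
    · have e1 : |r - α * h| ≤ |r - α * h - β * h ^ 2 / 2| + |β * h ^ 2 / 2| := by
        have := abs_add_le (r - α * h - β * h ^ 2 / 2) (β * h ^ 2 / 2)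
        simpa using this
      have e2 : m * |h| ^ 3 ≤ m * |h| ^ 2 := by
        gcongr ?_ * ?_
        exact pow_le_pow_of_le_one hh hle (by norm_num)
      linarith
    · have e1 : |r - α * h| ≤ |r| + |α * h| := abs_sub _ _
      have e2 : m * |h| ≤ m * |h| ^ 2 := by
        gcongr
        nlinarith
      linarith
  have h2 : |r ^ 2 - α ^ 2 * h ^ 2| ≤ 4 * m ^ 2 * |h| ^ 3 := by
    have e : r ^ 2 - α ^ 2 * h ^ 2 = (r - α * h) * (r + α * h) := by ring
    have e1 : |r + α * h| ≤ 2 * (m * |h|) := (abs_add_le _ _).trans (by linarith)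
    rw [e, abs_mul]
    calc _ ≤ (2 * m * |h| ^ 2) * (2 * (m * |h|)) := by gcongr
      _ = _ := by ring
  have h3 : |r ^ 3| ≤ m ^ 3 * |h| ^ 3 := by
    rw [abs_pow, ← mul_pow]; gcongr
  have hr2 : r ^ 2 ≤ m ^ 2 * |h| ^ 2 := by rw [← hsq, ← mul_pow]; gcongr
  have hr3 : |r ^ 3| ≤ m ^ 2 * B * |h| ^ 2 := by
    rw [abs_pow]
    calc |r| ^ 3 = |r| ^ 2 * |r| := by ring
      _ ≤ (m * |h|) ^ 2 * B := by gcongr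
      _ = _ := by ring
  have hlast : |r - r ^ 2 / 2 + r ^ 3 / 3| ≤ (1 + B + B ^ 2) * |r| := by
    have e : r - r ^ 2 / 2 + r ^ 3 / 3 = (1 - r / 2 + r ^ 2 / 3) * r := by ring
    rw [e, abs_mul]
    gcongr
    have h5 : r ^ 2 ≤ B ^ 2 := by rw [← hsq]; gcongr
    rw [abs_le] at hrB ⊢
    constructor <;> nlinarith [sq_nonneg r]
  refine ⟨?_, ?_, hlast.trans (by gcongr), hlast.trans (by gcongr)⟩
  · have e : (r - r ^ 2 / 2 + r ^ 3 / 3) - (α * h + (β - α ^ 2) * h ^ 2 / 2)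
        = (r - α * h - β * h ^ 2 / 2) - (r ^ 2 - α ^ 2 * h ^ 2) / 2 + r ^ 3 / 3 := by ring
    rw [e]
    rw [abs_le] at hT h2 h3 ⊢
    have : 0 ≤ m ^ 3 * |h| ^ 3 := by positivity
    constructor <;> nlinarith
  · have e : (r - r ^ 2 / 2 + r ^ 3 / 3) - α * h = (r - α * h) - r ^ 2 / 2 + r ^ 3 / 3 := by ring
    rw [e]
    rw [abs_le] at h1 hr3 ⊢
    have : 0 ≤ m ^ 2 * B * |h| ^ 2 := by positivity
    constructor <;> nlinarith [sq_nonneg r]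

/-- Second order upper expansion of a product of powers of functions with Taylor expansions. -/
lemma prod_rpow_taylor_le (d : ℕ) {a b M θ : ℝ} (ha : 0 < a) (hM : 0 ≤ M) (hθ : 0 < θ)
    (hθ1 : θ ≤ 1) :
    ∃ C : ℝ, 0 ≤ C ∧ ∀ (w w₁ w₂ : Fin d → ℝ → ℝ), (∀ j, HasTaylor a b M (w j) (w₁ j) (w₂ j)) →
      ∀ (x h : Fin d → ℝ) (H : ℝ), (∀ j, |h j| ≤ H) → 0 ≤ H →
      ∏ j, (w j (x j + h j)) ^ θ ≤ (∏ j, (w j (x j)) ^ θ) *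
        (1 + θ * ∑ j, (w₁ j (x j) / w j (x j) * h j +
            (w₂ j (x j) / w j (x j) - (w₁ j (x j) / w j (x j)) ^ 2) * h j ^ 2 / 2) +
          θ ^ 2 / 2 * (∑ j, w₁ j (x j) / w j (x j) * h j) ^ 2 + C * H ^ 3) := by
  by_cases hab : a ≤ b
  swap
  · rcases Nat.eq_zero_or_pos d with rfl | hd
    · exact ⟨0, le_rfl, fun w w₁ w₂ hw x h H hH hH0 => by simp⟩
    · exact ⟨0, le_rfl, fun w w₁ w₂ hw => absurd
        (((hw ⟨0, hd⟩).lower 0).trans ((hw ⟨0, hd⟩).upper 0)) hab⟩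
  set m := M / a with hm
  set B := b / a with hBdef
  have hm0 : 0 ≤ m := by positivity
  have hb : 0 < b := ha.trans_le hab
  have hB0 : 0 ≤ B := by positivity
  have hB1 : 1 ≤ B := (one_le_div ha).2 hab
  set C₁ := m + 2 * m ^ 2 + m ^ 3
  set C₂ := 2 * m + m ^ 2 + m ^ 2 * B
  set C₃ := (1 + B + B ^ 2) * m
  set K := d * ((1 + B + B ^ 2) * B)
  refine ⟨d * C₁ + (d * C₂) * (d * C₃ + d * m) + (d * C₃) ^ 3 * Real.exp K, by positivity, ?_⟩
  intro w w₁ w₂ hw x h H hH hH0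
  have hpos : ∀ j y, 0 < w j y := fun j y => ha.trans_le ((hw j).lower y)
  set α : Fin d → ℝ := fun j => w₁ j (x j) / w j (x j) with hα
  set β : Fin d → ℝ := fun j => w₂ j (x j) / w j (x j) with hβ
  set r : Fin d → ℝ := fun j => (w j (x j + h j) - w j (x j)) / w j (x j) with hr
  set t : Fin d → ℝ := fun j => r j - r j ^ 2 / 2 + r j ^ 3 / 3 with ht
  have hdiv : ∀ j (c D : ℝ), 0 ≤ D → |c| ≤ D → |c / w j (x j)| ≤ D / a := by
    intro j c D hD hc
    rw [abs_div, abs_of_pos (hpos j _)]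
    exact div_le_div₀ hD hc ha ((hw j).lower _)
  have key : ∀ j, _ := fun j => cubic_log_expansion (α := α j) (β := β j) (r := r j) (h := h j) hB0 hm0
    (hdiv j _ M hM ((hw j).bound₁ _)) (hdiv j _ M hM ((hw j).bound₂ _))
    (by
      have := hdiv j _ (M * |h j|) (by positivity) ((hw j).lip (x j) (h j))
      calc _ ≤ _ := this
        _ = _ := by rw [hm]; ring)
    (by
      refine hdiv j _ b hb.le ?_
      have h1 := (hw j).lower (x j); have h2 := (hw j).upper (x j)
      have h3 := (hw j).lower (x j + h j); have h4 := (hw j).upper (x j + h j)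
      rw [abs_le]; constructor <;> linarith)
    (by
      have := hdiv j _ (M * |h j| ^ 3) (by positivity) ((hw j).taylor (x j) (h j))
      calc _ = _ := by
            congr 1
            simp only [hr, hα, hβ]
            have := (hpos j (x j)).ne'
            field_simp
            ring
        _ ≤ _ := this
        _ = _ := by rw [hm]; ring)
  have hfac : ∀ j, (w j (x j + h j)) ^ θ ≤ (w j (x j)) ^ θ * Real.exp (θ * t j) := by
    intro j
    have hw0 := (hpos j (x j)).ne'
    have e : w j (x j + h j) = w j (x j) * (1 + r j) := by
      simp only [hr]; field_simp; ring
    have h1r : 0 < 1 + r j := by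
      have := hpos j (x j + h j)
      rw [e] at this
      exact pos_of_mul_pos_right this (hpos j _).le
    rw [e, Real.mul_rpow (hpos j _).le h1r.le]
    gcongr
    · exact Real.rpow_nonneg (hpos j _).le _
    · rw [Real.rpow_def_of_pos h1r, mul_comm]
      gcongr
      exact Real.log_one_add_le_cubic (by linarith)
  set y := θ * ∑ j, t j with hy
  have hprod : ∏ j, (w j (x j + h j)) ^ θ ≤ (∏ j, (w j (x j)) ^ θ) * Real.exp y := by
    calc _ ≤ ∏ j, ((w j (x j)) ^ θ * Real.exp (θ * t j)) :=
          Finset.prod_le_prod (fun j _ => Real.rpow_nonneg (hpos j _).le _) fun j _ => hfac j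
      _ = _ := by rw [Finset.prod_mul_distrib, ← Real.exp_sum, hy, Finset.mul_sum]
  refine hprod.trans ?_
  have hQ0 : 0 ≤ ∏ j, (w j (x j)) ^ θ :=
    Finset.prod_nonneg fun j _ => Real.rpow_nonneg (hpos j _).le _
  gcongr
  have hsum : ∀ (f : Fin d → ℝ) (D : ℝ), (∀ j, |f j| ≤ D) → |∑ j, f j| ≤ d * D := by
    intro f D hf
    refine (Finset.abs_sum_le_sum_abs _ _).trans ((Finset.sum_le_sum fun j _ => hf j).trans ?_)
    simp
  have habsθ : |θ| = θ := abs_of_pos hθ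
  set u := ∑ j, α j * h j with hu
  have h1 : |∑ j, t j - ∑ j, (α j * h j + (β j - α j ^ 2) * h j ^ 2 / 2)| ≤ d * (C₁ * H ^ 3) := by
    rw [← Finset.sum_sub_distrib]
    refine hsum _ _ fun j => (key j).1.trans ?_
    gcongr; exact hH j
  have h2 : |∑ j, t j - u| ≤ d * (C₂ * H ^ 2) := by
    rw [hu, ← Finset.sum_sub_distrib]
    refine hsum _ _ fun j => (key j).2.1.trans ?_
    gcongr; exact hH j
  have h3 : |∑ j, t j| ≤ d * (C₃ * H) := by
    refine hsum _ _ fun j => (key j).2.2.1.trans ?_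
    calc _ ≤ (1 + B + B ^ 2) * (m * H) := by gcongr; exact hH j
      _ = _ := by ring
  have h4 : |∑ j, t j| ≤ K := hsum _ _ fun j => (key j).2.2.2
  have h5 : |u| ≤ d * (m * H) := by
    refine hsum _ _ fun j => ?_
    rw [abs_mul]
    gcongr
    · exact hdiv j _ M hM ((hw j).bound₁ _)
    · exact hH j
  have hθ' : ∀ D, 0 ≤ D → θ * D ≤ D := fun D hD => mul_le_of_le_one_left hD hθ1
  have hyK : |y| ≤ K := by
    rw [hy, abs_mul, habsθ]; exact (hθ' _ (abs_nonneg _)).trans h4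
  have hyH : |y| ≤ d * C₃ * H := by
    rw [hy, abs_mul, habsθ]; exact (hθ' _ (abs_nonneg _)).trans (h3.trans_eq (by ring))
  have g1 : y ≤ θ * ∑ j, (α j * h j + (β j - α j ^ 2) * h j ^ 2 / 2) + d * C₁ * H ^ 3 := by
    have e1 := le_of_abs_le h1
    have e2 : θ * (d * (C₁ * H ^ 3)) ≤ d * (C₁ * H ^ 3) := hθ' _ (by positivity)
    have e3 := mul_le_mul_of_nonneg_left e1 hθ.le
    rw [mul_sub] at e3
    linarith
  have g2 : y ^ 2 ≤ θ ^ 2 * u ^ 2 + d * C₂ * (d * C₃ + d * m) * H ^ 3 := by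
    have e : (∑ j, t j) ^ 2 - u ^ 2 ≤ d * C₂ * (d * C₃ + d * m) * H ^ 3 := by
      calc (∑ j, t j) ^ 2 - u ^ 2 ≤ |(∑ j, t j - u) * (∑ j, t j + u)| := by
            refine le_trans (le_of_eq ?_) (le_abs_self _); ring
        _ = |∑ j, t j - u| * |∑ j, t j + u| := abs_mul _ _
        _ ≤ (d * (C₂ * H ^ 2)) * (d * (C₃ * H) + d * (m * H)) := by
            gcongr
            exact (abs_add_le _ _).trans (add_le_add h3 h5)
        _ = _ := by ring
    have e2 : θ ^ 2 * ((∑ j, t j) ^ 2 - u ^ 2) ≤ d * C₂ * (d * C₃ + d * m) * H ^ 3 := by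
      have hθ2 : θ ^ 2 ≤ 1 := pow_le_one₀ hθ.le hθ1
      have hD : 0 ≤ d * C₂ * (d * C₃ + d * m) * H ^ 3 := by positivity
      calc _ ≤ θ ^ 2 * (d * C₂ * (d * C₃ + d * m) * H ^ 3) := by gcongr
        _ ≤ _ := mul_le_of_le_one_left hD hθ2
    rw [hy, mul_pow]
    linarith
  have g3 : |y| ^ 3 * Real.exp |y| ≤ (d * C₃) ^ 3 * Real.exp K * H ^ 3 := by
    calc _ ≤ (d * C₃ * H) ^ 3 * Real.exp K := by gcongr
      _ = _ := by ring
  have := Real.exp_le_quadratic_add y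
  have hp : 0 ≤ d * C₂ * (d * C₃ + d * m) * H ^ 3 := by positivity
  linarith

/-! ### Gaussian averages -/

/-- The average of `w` over centred Gaussian translations of standard deviation `σ`, i.e. the heat
semigroup at time `σ ^ 2`. -/
noncomputable def gaussAvg (σ : ℝ) (w : ℝ → ℝ) (x : ℝ) : ℝ := ∫ z, w (x + σ * z) ∂gaussianReal 0 1

lemma integrable_of_bounded_comp {Ω : Type*} [MeasurableSpace Ω] {P : Measure Ω} [IsFiniteMeasure P]
    {f : Ω → ℝ} (hf : AEStronglyMeasurable f P) (C : ℝ) (hC : ∀ x, |f x| ≤ C) : Integrable f P :=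
  Integrable.of_bound hf C (Filter.Eventually.of_forall hC)

lemma gaussAvg_integrable {w : ℝ → ℝ} (hw : Measurable w) {C : ℝ} (hC : ∀ x, |w x| ≤ C) (σ x : ℝ) :
    Integrable (fun z => w (x + σ * z)) (gaussianReal 0 1) :=
  integrable_of_bounded_comp (hw.comp (by fun_prop)).aestronglyMeasurable C fun z => hC _

lemma measurable_gaussAvg {w : ℝ → ℝ} (hw : Measurable w) (σ : ℝ) : Measurable (gaussAvg σ w) := by
  have : StronglyMeasurable (Function.uncurry fun x z : ℝ => w (x + σ * z)) :=
    (hw.comp (by fun_prop)).stronglyMeasurable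
  exact (this.integral_prod_right (ν := gaussianReal 0 1)).measurable

lemma abs_integral_le_of_bounded {Ω : Type*} [MeasurableSpace Ω] {P : Measure Ω}
    [IsProbabilityMeasure P] {f : Ω → ℝ} {C : ℝ} (h : ∀ x, |f x| ≤ C) : |∫ x, f x ∂P| ≤ C := by
  have := norm_integral_le_of_norm_le_const (μ := P) (f := f) (C := C)
    (Filter.Eventually.of_forall h)
  simpa using this

lemma HasTaylor.abs_le {a b M : ℝ} {w w₁ w₂ : ℝ → ℝ} (h : HasTaylor a b M w w₁ w₂) (x : ℝ) :
    |w x| ≤ max |a| |b| := by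
  have h1 := h.lower x
  have h2 := h.upper x
  exact abs_le_max_abs_abs h1 h2

/-- Taylor expansions survive Gaussian averaging with the same constants, so the same bound applies
at every step of the heat flow. -/
lemma HasTaylor.gaussAvg {a b M : ℝ} {w w₁ w₂ : ℝ → ℝ} (h : HasTaylor a b M w w₁ w₂) (σ : ℝ) :
    HasTaylor a b M (gaussAvg σ w) (gaussAvg σ w₁) (gaussAvg σ w₂) := by
  have i0 := gaussAvg_integrable h.meas h.abs_le σ
  have i1 := gaussAvg_integrable h.meas₁ h.bound₁ σ
  have i2 := gaussAvg_integrable h.meas₂ h.bound₂ σ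
  refine ⟨measurable_gaussAvg h.meas σ, measurable_gaussAvg h.meas₁ σ, measurable_gaussAvg h.meas₂ σ,
    fun x => ?_, fun x => ?_, fun x => abs_integral_le_of_bounded fun _ => h.bound₁ _,
    fun x => abs_integral_le_of_bounded fun _ => h.bound₂ _, fun x y => ?_, fun x y => ?_⟩
  · have := integral_mono (integrable_const a) (i0 x) (fun z => h.lower (x + σ * z))
    simpa [_root_.gaussAvg] using this
  · have := integral_mono (i0 x) (integrable_const b) (fun z => h.upper (x + σ * z))
    simpa [_root_.gaussAvg] using this
  · unfold _root_.gaussAvg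
    rw [← integral_sub (i0 _) (i0 _)]
    refine abs_integral_le_of_bounded fun z => ?_
    rw [show x + y + σ * z = x + σ * z + y by ring]
    exact h.lip _ _
  · have j1 : Integrable (fun z => w₁ (x + σ * z) * y) (gaussianReal 0 1) := (i1 x).mul_const _
    have j2 : Integrable (fun z => w₂ (x + σ * z) * y ^ 2 / 2) (gaussianReal 0 1) :=
      ((i2 x).mul_const _).div_const _
    have j01 : Integrable (fun z => w (x + σ * z) + w₁ (x + σ * z) * y) (gaussianReal 0 1) :=
      (i0 x).add j1
    have j012 : Integrable (fun z => w (x + σ * z) + w₁ (x + σ * z) * y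
        + w₂ (x + σ * z) * y ^ 2 / 2) (gaussianReal 0 1) := j01.add j2
    unfold _root_.gaussAvg
    rw [← integral_mul_const, ← integral_mul_const, ← integral_div,
      ← integral_add (i0 _) j1, ← integral_add j01 j2, ← integral_sub (i0 _) j012]
    refine abs_integral_le_of_bounded fun z => ?_
    rw [show x + y + σ * z = x + σ * z + y by ring]
    exact h.taylor _ _

/-- The third absolute moment of the standard normal distribution. -/
noncomputable def gaussThird : ℝ := ∫ z, |z| ^ 3 ∂gaussianReal 0 1

lemma integrable_abs_pow_gaussianReal (k : ℕ) :
    Integrable (fun z : ℝ => |z| ^ k) (gaussianReal 0 1) := by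
  have := (memLp_id_gaussianReal' (μ := 0) (v := 1) k (by simp)).integrable_norm_pow' 
  simpa using this

/-- A short step of the heat flow moves `w` by `σ ^ 2 / 2` times its second order coefficient; the
first order term is killed by the symmetry of the Gaussian distribution. -/
lemma HasTaylor.abs_gaussAvg_sub_le {a b M : ℝ} {w w₁ w₂ : ℝ → ℝ} (h : HasTaylor a b M w w₁ w₂)
    {σ : ℝ} (hσ : 0 ≤ σ) (x : ℝ) :
    |_root_.gaussAvg σ w x - (w x + σ ^ 2 / 2 * w₂ x)| ≤ M * gaussThird * σ ^ 3 := by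
  have i0 := gaussAvg_integrable h.meas h.abs_le σ x
  have hz : ∫ z, z ∂gaussianReal 0 1 = 0 := by simp
  have hz2 : ∫ z, z ^ 2 ∂gaussianReal 0 1 = 1 := by
    have := variance_fun_id_gaussianReal (μ := 0) (v := 1)
    rw [variance_eq_integral (by fun_prop)] at this
    simpa using this
  have j1 : Integrable (fun z : ℝ => z) (gaussianReal 0 1) := by
    have := memLp_id_gaussianReal (μ := 0) (v := 1) 1
    exact memLp_one_iff_integrable.1 (by exact_mod_cast this)
  have j2 : Integrable (fun z : ℝ => z ^ 2) (gaussianReal 0 1) := by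
    simpa using integrable_abs_pow_gaussianReal 2
  have k1 : Integrable (fun z => w₁ x * (σ * z)) (gaussianReal 0 1) := (j1.const_mul σ).const_mul _
  have k2 : Integrable (fun z => w₂ x * (σ * z) ^ 2 / 2) (gaussianReal 0 1) := by
    have := (j2.const_mul (w₂ x * σ ^ 2 / 2))
    refine this.congr (Filter.Eventually.of_forall fun z => ?_)
    simp only; ring
  have k01 : Integrable (fun z => w x + w₁ x * (σ * z)) (gaussianReal 0 1) :=
    (integrable_const _).add k1
  have k012 : Integrable (fun z => w x + w₁ x * (σ * z) + w₂ x * (σ * z) ^ 2 / 2)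
      (gaussianReal 0 1) := k01.add k2
  have e : ∫ z, (w x + w₁ x * (σ * z) + w₂ x * (σ * z) ^ 2 / 2) ∂gaussianReal 0 1
      = w x + σ ^ 2 / 2 * w₂ x := by
    rw [integral_add k01 k2, integral_add (integrable_const _) k1]
    rw [integral_const_mul, integral_const_mul, hz]
    have : (fun z => w₂ x * (σ * z) ^ 2 / 2) = fun z => (σ ^ 2 / 2 * w₂ x) * z ^ 2 := by
      funext z; ring
    rw [this, integral_const_mul, hz2]
    simp
  rw [← e]
  unfold _root_.gaussAvg
  rw [← integral_sub i0 k012]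
  refine (abs_integral_le_integral_abs).trans ?_
  have : M * gaussThird * σ ^ 3 = ∫ z, M * |σ * z| ^ 3 ∂gaussianReal 0 1 := by
    rw [gaussThird, integral_const_mul, mul_assoc, mul_comm _ (σ ^ 3), ← integral_const_mul]
    simp_rw [abs_mul, mul_pow, abs_of_nonneg hσ]
  rw [this]
  refine integral_mono (i0.sub k012).abs ?_ fun z => h.taylor x _
  simp_rw [abs_mul, mul_pow]
  exact ((integrable_abs_pow_gaussianReal 3).const_mul _).const_mul _

/-! ### Moments of a Gaussian vector -/

section GaussianMoments

variable {d : ℕ} {S : Matrix (Fin d) (Fin d) ℝ}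

lemma memLp_eval_multivariateGaussian (j : Fin d) :
    MemLp (fun z : EuclideanSpace ℝ (Fin d) => z j) 2 (multivariateGaussian 0 S) := by
  have := (IsGaussian.memLp_two_id (μ := multivariateGaussian (0 : EuclideanSpace ℝ (Fin d)) S))
  exact this.eval_piLp j

lemma integral_eval_multivariateGaussian (j : Fin d) :
    ∫ z, z j ∂multivariateGaussian (0 : EuclideanSpace ℝ (Fin d)) S = 0 := by
  have h := (EuclideanSpace.proj j : EuclideanSpace ℝ (Fin d) →L[ℝ] ℝ).integral_comp_comm
    (IsGaussian.integrable_id (μ := multivariateGaussian (0 : EuclideanSpace ℝ (Fin d)) S))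
  simpa using h

lemma integral_eval_mul_eval_multivariateGaussian (hS : S.PosSemidef) (i j : Fin d) :
    ∫ z, z i * z j ∂multivariateGaussian (0 : EuclideanSpace ℝ (Fin d)) S = S i j := by
  have h := covariance_eval_multivariateGaussian (μ := 0) hS i j
  rw [covariance_eq_sub (memLp_eval_multivariateGaussian i) (memLp_eval_multivariateGaussian j),
    integral_eval_multivariateGaussian] at h
  simpa using h

lemma integrable_norm_cube_multivariateGaussian :
    Integrable (fun z => ‖z‖ ^ 3) (multivariateGaussian (0 : EuclideanSpace ℝ (Fin d)) S) := by
  have := (IsGaussian.memLp_id (multivariateGaussian (0 : EuclideanSpace ℝ (Fin d)) S) 3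
    (by simp)).integrable_norm_pow'
  simpa using this

lemma integrable_eval_mul_eval (i j : Fin d) :
    Integrable (fun z => z i * z j) (multivariateGaussian (0 : EuclideanSpace ℝ (Fin d)) S) :=
  (memLp_eval_multivariateGaussian i).integrable_mul (memLp_eval_multivariateGaussian j)

/-- The integral of a quadratic polynomial against a centred Gaussian measure. -/
lemma integral_quadratic (hS : S.PosSemidef) (c : ℝ) (p : Fin d → ℝ) (q : Fin d → Fin d → ℝ) :
    Integrable (fun z => c + ∑ j, p j * z j + ∑ i, ∑ j, q i j * (z i * z j))
      (multivariateGaussian (0 : EuclideanSpace ℝ (Fin d)) S) ∧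
    ∫ z, (c + ∑ j, p j * z j + ∑ i, ∑ j, q i j * (z i * z j))
      ∂multivariateGaussian (0 : EuclideanSpace ℝ (Fin d)) S = c + ∑ i, ∑ j, q i j * S i j := by
  have i1 : ∀ j, Integrable (fun z => p j * z j)
      (multivariateGaussian (0 : EuclideanSpace ℝ (Fin d)) S) := fun j =>
    ((memLp_eval_multivariateGaussian j).integrable (by norm_num)).const_mul _
  have i2 : ∀ i j, Integrable (fun z => q i j * (z i * z j))
      (multivariateGaussian (0 : EuclideanSpace ℝ (Fin d)) S) := fun i j =>
    (integrable_eval_mul_eval i j).const_mul _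
  have i1s := integrable_finsetSum Finset.univ fun j _ => i1 j
  have i2s := integrable_finsetSum Finset.univ fun i _ =>
    integrable_finsetSum Finset.univ fun j _ => i2 i j
  have ic : Integrable (fun z => c + ∑ j, p j * z j)
      (multivariateGaussian (0 : EuclideanSpace ℝ (Fin d)) S) := (integrable_const c).add i1s
  refine ⟨ic.add i2s, ?_⟩
  rw [integral_add ic i2s, integral_add (integrable_const c) i1s,
    integral_finsetSum _ fun j _ => i1 j,
    integral_finsetSum _ fun i _ => integrable_finsetSum Finset.univ fun j _ => i2 i j]
  simp_rw [integral_finsetSum _ fun j _ => i2 _ j, integral_const_mul,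
    integral_eval_multivariateGaussian, integral_eval_mul_eval_multivariateGaussian hS]
  simp

end GaussianMoments

/-! ### One step of the discretised heat flow -/

/-- Lower expansion of a product of powers after one step of the heat semigroup. -/
lemma prod_rpow_gaussAvg_ge (d : ℕ) {a b M θ : ℝ} (ha : 0 < a) (hM : 0 ≤ M) (hθ : 0 < θ)
    (hθ1 : θ ≤ 1) :
    ∃ C : ℝ, 0 ≤ C ∧ ∀ (w w₁ w₂ : Fin d → ℝ → ℝ), (∀ j, HasTaylor a b M (w j) (w₁ j) (w₂ j)) →
      ∀ (x : Fin d → ℝ) (σ : ℝ), 0 ≤ σ → σ ≤ 1 →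
      (∏ j, (w j (x j)) ^ θ) * (1 + θ * (σ ^ 2 / 2) * ∑ j, w₂ j (x j) / w j (x j) - C * σ ^ 3) ≤
        ∏ j, (gaussAvg σ (w j) (x j)) ^ θ := by
  have hG : 0 ≤ gaussThird := integral_nonneg fun z => by positivity
  set m := M / a with hm
  set B := |b| / a with hB
  have hm0 : 0 ≤ m := by positivity
  have hB0 : 0 ≤ B := by positivity
  refine ⟨d * (m * gaussThird + B * (m * (1 + gaussThird)) ^ 2), by positivity, ?_⟩
  intro w w₁ w₂ hw x σ hσ hσ1
  have hpos : ∀ j y, 0 < w j y := fun j y => ha.trans_le ((hw j).lower y)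
  have hQ0 : 0 ≤ ∏ j, (w j (x j)) ^ θ :=
    Finset.prod_nonneg fun j _ => Real.rpow_nonneg (hpos j _).le _
  set ρ : Fin d → ℝ := fun j => (gaussAvg σ (w j) (x j) - w j (x j)) / w j (x j) with hρ
  have hg : ∀ j, a ≤ gaussAvg σ (w j) (x j) := fun j => ((hw j).gaussAvg σ).lower _
  have he : ∀ j, gaussAvg σ (w j) (x j) = w j (x j) * (1 + ρ j) := fun j => by
    have := (hpos j (x j)).ne'
    simp only [hρ]; field_simp; ring
  have h1ρ : ∀ j, 0 < 1 + ρ j := fun j => by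
    have := ha.trans_le (hg j)
    rw [he] at this
    exact pos_of_mul_pos_right this (hpos j _).le
  have hdiv : ∀ j (c D : ℝ), 0 ≤ D → |c| ≤ D → |c / w j (x j)| ≤ D / a := by
    intro j c D hD hc
    rw [abs_div, abs_of_pos (hpos j _)]
    exact div_le_div₀ hD hc ha ((hw j).lower _)
  have hσ3 : σ ^ 3 ≤ σ ^ 2 := pow_le_pow_of_le_one hσ hσ1 (by norm_num)
  have hσ4 : σ ^ 4 ≤ σ ^ 3 := pow_le_pow_of_le_one hσ hσ1 (by norm_num)
  have hρ1 : ∀ j, |ρ j - σ ^ 2 / 2 * (w₂ j (x j) / w j (x j))| ≤ m * gaussThird * σ ^ 3 := by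
    intro j
    have := hdiv j _ (M * gaussThird * σ ^ 3) (by positivity) ((hw j).abs_gaussAvg_sub_le hσ (x j))
    calc _ = _ := by
          congr 1
          have := (hpos j (x j)).ne'
          simp only [hρ]; field_simp; ring
      _ ≤ _ := this
      _ = _ := by rw [hm]; ring
  have hρ2 : ∀ j, |ρ j| ≤ m * (1 + gaussThird) * σ ^ 2 := by
    intro j
    have h1 := hρ1 j
    have h2 : |σ ^ 2 / 2 * (w₂ j (x j) / w j (x j))| ≤ m * σ ^ 2 := by
      rw [abs_mul, abs_of_nonneg (by positivity : 0 ≤ σ ^ 2 / 2)]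
      have := hdiv j _ M hM ((hw j).bound₂ (x j))
      have h0 := abs_nonneg (w₂ j (x j) / w j (x j))
      nlinarith [sq_nonneg σ]
    have h3 := abs_add_le (ρ j - σ ^ 2 / 2 * (w₂ j (x j) / w j (x j)))
      (σ ^ 2 / 2 * (w₂ j (x j) / w j (x j)))
    rw [sub_add_cancel] at h3
    have h4 : m * gaussThird * σ ^ 3 ≤ m * gaussThird * σ ^ 2 := by gcongr
    nlinarith
  have hprod : (∏ j, (w j (x j)) ^ θ) * Real.exp (θ * ∑ j, Real.log (1 + ρ j))
      = ∏ j, (gaussAvg σ (w j) (x j)) ^ θ := by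
    rw [Finset.mul_sum, Real.exp_sum, ← Finset.prod_mul_distrib]
    refine Finset.prod_congr rfl fun j _ => ?_
    rw [he, Real.mul_rpow (hpos j _).le (h1ρ j).le, Real.rpow_def_of_pos (h1ρ j), mul_comm θ]
  rw [← hprod]
  refine mul_le_mul_of_nonneg_left ?_ hQ0
  have hlog : ∀ j, σ ^ 2 / 2 * (w₂ j (x j) / w j (x j))
      - (m * gaussThird + B * (m * (1 + gaussThird)) ^ 2) * σ ^ 3 ≤ Real.log (1 + ρ j) := by
    intro j
    have h1 := Real.one_sub_inv_le_log_of_pos (h1ρ j)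
    have hinv : (1 + ρ j)⁻¹ ≤ B := by
      have : (1 + ρ j) = gaussAvg σ (w j) (x j) / w j (x j) := by
        rw [he]; field_simp [(hpos j (x j)).ne']
      rw [this, inv_div, hB]
      exact div_le_div₀ (abs_nonneg _) (((hw j).upper _).trans (le_abs_self _)) ha (hg j)
    have h2 : 1 - (1 + ρ j)⁻¹ = ρ j - ρ j ^ 2 * (1 + ρ j)⁻¹ := by
      have := (h1ρ j).ne'
      field_simp; ring
    have h3 : ρ j ^ 2 * (1 + ρ j)⁻¹ ≤ (m * (1 + gaussThird)) ^ 2 * σ ^ 3 * B := by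
      have : ρ j ^ 2 ≤ (m * (1 + gaussThird)) ^ 2 * σ ^ 3 := by
        calc ρ j ^ 2 = |ρ j| ^ 2 := (sq_abs _).symm
          _ ≤ (m * (1 + gaussThird) * σ ^ 2) ^ 2 := by gcongr; exact hρ2 j
          _ = (m * (1 + gaussThird)) ^ 2 * σ ^ 4 := by ring
          _ ≤ _ := by gcongr
      exact mul_le_mul this hinv (inv_nonneg.2 (h1ρ j).le) (by positivity)
    have h4 := (abs_le.1 (hρ1 j)).1
    linarith
  have hs := Finset.sum_le_sum fun j (_ : j ∈ Finset.univ) => hlog j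
  rw [Finset.sum_sub_distrib, ← Finset.mul_sum] at hs
  simp only [Finset.sum_const, Finset.card_univ, Fintype.card_fin, nsmul_eq_mul] at hs
  have h5 := Real.add_one_le_exp (θ * ∑ j, Real.log (1 + ρ j))
  have h6 := mul_le_mul_of_nonneg_left hs hθ.le
  have h7 : θ * (d * ((m * gaussThird + B * (m * (1 + gaussThird)) ^ 2) * σ ^ 3)) ≤
      d * ((m * gaussThird + B * (m * (1 + gaussThird)) ^ 2) * σ ^ 3) :=
    mul_le_of_le_one_left (by positivity) hθ1
  rw [mul_sub] at h6
  linarith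

section Step

variable {d : ℕ} {S : Matrix (Fin d) (Fin d) ℝ}

lemma abs_prod_rpow_le {a b M θ : ℝ} (ha : 0 < a) (hθ : 0 < θ) {w w₁ w₂ : Fin d → ℝ → ℝ}
    (hw : ∀ j, HasTaylor a b M (w j) (w₁ j) (w₂ j)) (x : Fin d → ℝ) :
    |∏ j, (w j (x j)) ^ θ| ≤ (|b| ^ θ) ^ d := by
  rw [Finset.abs_prod]
  calc _ ≤ ∏ _j : Fin d, |b| ^ θ := by
        refine Finset.prod_le_prod (fun j _ => abs_nonneg _) fun j _ => ?_
        have h0 := ha.trans_le ((hw j).lower (x j))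
        rw [abs_of_nonneg (Real.rpow_nonneg h0.le _)]
        exact Real.rpow_le_rpow h0.le (((hw j).upper _).trans (le_abs_self _)) hθ.le
    _ = _ := by simp

lemma measurable_prod_rpow {a b M θ : ℝ} {w w₁ w₂ : Fin d → ℝ → ℝ}
    (hw : ∀ j, HasTaylor a b M (w j) (w₁ j) (w₂ j)) :
    Measurable fun y : EuclideanSpace ℝ (Fin d) => ∏ j, (w j (y j)) ^ θ :=
  Finset.measurable_prod _ fun j _ => ((hw j).meas.comp (by fun_prop)).pow_const θ

/-- One step of the discretised heat flow. The second order terms match because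
`θ αᵀ S α ≤ αᵀ α` when `S ≤ θ⁻¹`, which absorbs the Itô correction of the power `θ`. -/
lemma integral_prod_rpow_step (hS : S.PosSemidef) (hdiag : ∀ j, S j j = 1) {θ : ℝ} (hθ : 0 < θ)
    (hθ1 : θ ≤ 1) (hθS : ∀ v : Fin d → ℝ, θ * ∑ i, ∑ j, v i * v j * S i j ≤ ∑ i, v i ^ 2)
    {a b M : ℝ} (ha : 0 < a) (hM : 0 ≤ M) :
    ∃ C : ℝ, 0 ≤ C ∧ ∀ (w w₁ w₂ : Fin d → ℝ → ℝ), (∀ j, HasTaylor a b M (w j) (w₁ j) (w₂ j)) →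
      ∀ (x : Fin d → ℝ) (σ : ℝ), 0 ≤ σ → σ ≤ 1 →
      ∫ z, ∏ j, (w j (x j + σ * z j)) ^ θ ∂multivariateGaussian (0 : EuclideanSpace ℝ (Fin d)) S ≤
        ∏ j, (gaussAvg σ (w j) (x j)) ^ θ + C * σ ^ 3 := by
  obtain ⟨C₁, hC₁, h₁⟩ := prod_rpow_taylor_le d (b := b) ha hM hθ hθ1
  obtain ⟨C₂, hC₂, h₂⟩ := prod_rpow_gaussAvg_ge d (b := b) ha hM hθ hθ1
  set μ := multivariateGaussian (0 : EuclideanSpace ℝ (Fin d)) S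
  set T := ∫ z, ‖z‖ ^ 3 ∂μ with hT
  have hT0 : 0 ≤ T := integral_nonneg fun z => by positivity
  refine ⟨(|b| ^ θ) ^ d * (C₁ * T + C₂), by positivity, ?_⟩
  intro w w₁ w₂ hw x σ hσ hσ1
  have hpos : ∀ j y, 0 < w j y := fun j y => ha.trans_le ((hw j).lower y)
  set Q₀ := ∏ j, (w j (x j)) ^ θ with hQ₀
  have hQ0 : 0 ≤ Q₀ := Finset.prod_nonneg fun j _ => Real.rpow_nonneg (hpos j _).le _
  have hQle : Q₀ ≤ (|b| ^ θ) ^ d := (le_abs_self _).trans (abs_prod_rpow_le ha hθ hw x)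
  set α : Fin d → ℝ := fun j => w₁ j (x j) / w j (x j) with hα
  set β : Fin d → ℝ := fun j => w₂ j (x j) / w j (x j) with hβ
  set p : Fin d → ℝ := fun j => θ * α j * σ with hp
  set q : Fin d → Fin d → ℝ := fun i j =>
    (if i = j then θ * (β j - α j ^ 2) * σ ^ 2 / 2 else 0) + θ ^ 2 / 2 * (α i * σ) * (α j * σ) with hq
  have hquad := integral_quadratic hS 1 p q
  change Integrable _ μ ∧ ∫ z, _ ∂μ = _ at hquad
  obtain ⟨hi, hval⟩ := hquad
  have hpt : ∀ z : EuclideanSpace ℝ (Fin d), ∏ j, (w j (x j + σ * z j)) ^ θ ≤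
      Q₀ * ((1 + ∑ j, p j * z j + ∑ i, ∑ j, q i j * (z i * z j)) + C₁ * σ ^ 3 * ‖z‖ ^ 3) := by
    intro z
    refine (h₁ w w₁ w₂ hw x (fun j => σ * z j) (σ * ‖z‖) (fun j => ?_) (by positivity)).trans_eq ?_
    · rw [abs_mul, abs_of_nonneg hσ]
      gcongr
      exact PiLp.norm_apply_le z j
    · congr 1
      have e1 : ∑ i, ∑ j, q i j * (z i * z j) =
          ∑ j, θ * (β j - α j ^ 2) * σ ^ 2 / 2 * (z j * z j)
            + θ ^ 2 / 2 * (∑ j, α j * (σ * z j)) ^ 2 := by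
        simp only [hq, add_mul, Finset.sum_add_distrib, ite_mul, zero_mul, Finset.sum_ite_eq,
          Finset.mem_univ, if_true]
        rw [sq (∑ j, α j * (σ * z j)), Finset.sum_mul_sum, Finset.mul_sum]
        congr 1
        refine Finset.sum_congr rfl fun i _ => ?_
        rw [Finset.mul_sum]
        exact Finset.sum_congr rfl fun j _ => by ring
      rw [e1, Finset.sum_add_distrib, mul_add, Finset.mul_sum, Finset.mul_sum]
      have e2 : ∑ i, θ * (α i * (σ * z i)) = ∑ j, p j * z j :=
        Finset.sum_congr rfl fun j _ => by simp only [hp]; ring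
      have e3 : ∑ i, θ * ((β i - α i ^ 2) * (σ * z i) ^ 2 / 2)
          = ∑ j, θ * (β j - α j ^ 2) * σ ^ 2 / 2 * (z j * z j) :=
        Finset.sum_congr rfl fun j _ => by ring
      rw [e2, e3]
      ring
  have hmeas : Measurable fun z : EuclideanSpace ℝ (Fin d) => ∏ j, (w j (x j + σ * z j)) ^ θ :=
    Finset.measurable_prod _ fun j _ => ((hw j).meas.comp (by fun_prop)).pow_const θ
  have hint : Integrable (fun z : EuclideanSpace ℝ (Fin d) => ∏ j, (w j (x j + σ * z j)) ^ θ) μ :=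
    integrable_of_bounded_comp hmeas.aestronglyMeasurable ((|b| ^ θ) ^ d)
      fun z => abs_prod_rpow_le ha hθ hw fun j => x j + σ * z j
  have hi3 : Integrable (fun z : EuclideanSpace ℝ (Fin d) => C₁ * σ ^ 3 * ‖z‖ ^ 3) μ :=
    integrable_norm_cube_multivariateGaussian.const_mul _
  have hle := integral_mono hint ((hi.add hi3).const_mul Q₀) hpt
  rw [integral_const_mul] at hle
  rw [integral_add' hi hi3, hval, integral_const_mul] at hle
  have hqS : ∑ i, ∑ j, q i j * S i j ≤ θ * (σ ^ 2 / 2) * ∑ j, β j := by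
    have e1 : ∑ i, ∑ j, q i j * S i j =
        ∑ j, θ * (β j - α j ^ 2) * σ ^ 2 / 2
          + θ * (σ ^ 2 / 2) * (θ * ∑ i, ∑ j, α i * α j * S i j) := by
      simp only [hq, add_mul, Finset.sum_add_distrib, ite_mul, zero_mul, Finset.sum_ite_eq,
        Finset.mem_univ, if_true, hdiag, mul_one]
      congr 1
      rw [Finset.mul_sum, Finset.mul_sum]
      refine Finset.sum_congr rfl fun i _ => ?_
      rw [Finset.mul_sum, Finset.mul_sum]
      exact Finset.sum_congr rfl fun j _ => by ring
    have e2 : ∑ j, θ * (β j - α j ^ 2) * σ ^ 2 / 2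
        = θ * (σ ^ 2 / 2) * ∑ j, β j - θ * (σ ^ 2 / 2) * ∑ j, α j ^ 2 := by
      rw [Finset.mul_sum, Finset.mul_sum, ← Finset.sum_sub_distrib]
      exact Finset.sum_congr rfl fun j _ => by ring
    have e3 := mul_le_mul_of_nonneg_left (hθS α) (by positivity : 0 ≤ θ * (σ ^ 2 / 2))
    rw [e1, e2]
    linarith
  have hlow := h₂ w w₁ w₂ hw x σ hσ hσ1
  have hfin : Q₀ * ((1 + ∑ i, ∑ j, q i j * S i j) + C₁ * σ ^ 3 * T) ≤
      Q₀ * (1 + θ * (σ ^ 2 / 2) * ∑ j, β j - C₂ * σ ^ 3) + Q₀ * ((C₁ * T + C₂) * σ ^ 3) := by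
    rw [← mul_add]
    refine mul_le_mul_of_nonneg_left ?_ hQ0
    linarith
  have hlast : Q₀ * ((C₁ * T + C₂) * σ ^ 3) ≤ (|b| ^ θ) ^ d * (C₁ * T + C₂) * σ ^ 3 := by
    rw [mul_assoc]
    gcongr
  linarith

/-- The characteristic function of a rescaled centred Gaussian vector. -/
lemma isGaussian_charFun_smul (hS : S.PosSemidef) (c : ℝ) (t : EuclideanSpace ℝ (Fin d)) :
    charFun ((multivariateGaussian (0 : EuclideanSpace ℝ (Fin d)) S).map (fun z => c • z)) t =
      Complex.exp (-(c ^ 2 * (t.ofLp ⬝ᵥ S.mulVec t.ofLp) / 2 : ℝ)) := by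
  rw [charFun_map_smul, charFun_multivariateGaussian hS]
  congr 1
  simp [Matrix.mulVec_smul]
  ring

/-- Adding independent Gaussian increments of the same shape adds the times. -/
lemma map_add_smul_multivariateGaussian (hS : S.PosSemidef) {c₁ c₂ c : ℝ}
    (h : c ^ 2 = c₁ ^ 2 + c₂ ^ 2) :
    ((multivariateGaussian (0 : EuclideanSpace ℝ (Fin d)) S).prod (multivariateGaussian 0 S)).map
      (fun p => c₁ • p.1 + c₂ • p.2) =
    (multivariateGaussian (0 : EuclideanSpace ℝ (Fin d)) S).map (fun z => c • z) := by
  set μ := multivariateGaussian (0 : EuclideanSpace ℝ (Fin d)) S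
  have hpm : ∀ c : ℝ, IsProbabilityMeasure (μ.map fun z => c • z) := fun c =>
    Measure.isProbabilityMeasure_map (by fun_prop)
  have := hpm c₁
  have := hpm c₂
  have := hpm c
  have e : (μ.prod μ).map (fun p => c₁ • p.1 + c₂ • p.2) =
      (μ.map fun z => c₁ • z) ∗ (μ.map fun z => c₂ • z) := by
    rw [Measure.conv, Measure.map_prod_map _ _ (by fun_prop) (by fun_prop),
      Measure.map_map (by fun_prop) (by fun_prop)]
    rfl
  rw [e]
  apply Measure.ext_of_charFun
  ext t
  rw [charFun_conv, isGaussian_charFun_smul hS, isGaussian_charFun_smul hS,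
    isGaussian_charFun_smul hS, ← Complex.exp_add, h]
  congr 1
  push_cast
  ring

end Step

/-! ### Iteration of the heat flow -/

section Iterate

variable {d : ℕ} {S : Matrix (Fin d) (Fin d) ℝ}

/-- Iteration of the one-step inequality: `N` steps of length `σ` make up the Gaussian vector of scale
`√N * σ`, and their errors add up. -/
lemma integral_prod_rpow_iterate (hS : S.PosSemidef) {θ : ℝ} (hθ : 0 < θ) {a b M C : ℝ} (ha : 0 < a)
    {σ : ℝ}
    (hstep : ∀ (w w₁ w₂ : Fin d → ℝ → ℝ), (∀ j, HasTaylor a b M (w j) (w₁ j) (w₂ j)) →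
      ∀ (x : Fin d → ℝ),
      ∫ z, ∏ j, (w j (x j + σ * z j)) ^ θ ∂multivariateGaussian (0 : EuclideanSpace ℝ (Fin d)) S ≤
        ∏ j, (gaussAvg σ (w j) (x j)) ^ θ + C * σ ^ 3) (N : ℕ) :
    ∀ (w w₁ w₂ : Fin d → ℝ → ℝ), (∀ j, HasTaylor a b M (w j) (w₁ j) (w₂ j)) →
      ∀ (x : Fin d → ℝ),
      ∫ z, ∏ j, (w j (x j + √N * σ * z j)) ^ θ
          ∂multivariateGaussian (0 : EuclideanSpace ℝ (Fin d)) S ≤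
        ∏ j, ((gaussAvg σ)^[N] (w j) (x j)) ^ θ + N * (C * σ ^ 3) := by
  induction N with
  | zero => intro w w₁ w₂ hw x; simp
  | succ N ih =>
    intro w w₁ w₂ hw x
    set μ := multivariateGaussian (0 : EuclideanSpace ℝ (Fin d)) S with hμ
    set F : EuclideanSpace ℝ (Fin d) → ℝ := fun y => ∏ j, (w j (x j + y j)) ^ θ with hF
    have hFm : Measurable F :=
      Finset.measurable_prod _ fun j _ => ((hw j).meas.comp (by fun_prop)).pow_const θ
    have hFb : ∀ y, |F y| ≤ (|b| ^ θ) ^ d := fun y => abs_prod_rpow_le ha hθ hw fun j => x j + y j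
    have hadd := map_add_smul_multivariateGaussian hS (c₁ := √N * σ) (c₂ := σ)
      (c := √((N + 1 : ℕ) : ℝ) * σ) (by
        rw [mul_pow, mul_pow, Real.sq_sqrt (by positivity), Real.sq_sqrt (by positivity)]
        push_cast; ring)
    have e1 : ∫ z, ∏ j, (w j (x j + √((N + 1 : ℕ) : ℝ) * σ * z j)) ^ θ ∂μ
        = ∫ z, F ((√((N + 1 : ℕ) : ℝ) * σ) • z) ∂μ := rfl
    have e2 : ∫ z, F ((√((N + 1 : ℕ) : ℝ) * σ) • z) ∂μ =
        ∫ p, F ((√N * σ) • p.1 + σ • p.2) ∂(μ.prod μ) := by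
      rw [← integral_map (φ := fun z => (√((N + 1 : ℕ) : ℝ) * σ) • z) (by fun_prop)
        hFm.aestronglyMeasurable, ← hadd, integral_map (by fun_prop) hFm.aestronglyMeasurable]
    have hint : Integrable (fun p : EuclideanSpace ℝ (Fin d) × EuclideanSpace ℝ (Fin d) =>
        F ((√N * σ) • p.1 + σ • p.2)) (μ.prod μ) :=
      integrable_of_bounded_comp (hFm.comp (by fun_prop)).aestronglyMeasurable _ fun p => hFb _
    rw [e1, e2, integral_prod _ hint]
    have hw' : ∀ j, HasTaylor a b M (gaussAvg σ (w j)) (gaussAvg σ (w₁ j)) (gaussAvg σ (w₂ j)) :=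
      fun j => (hw j).gaussAvg σ
    have hG : Integrable (fun z : EuclideanSpace ℝ (Fin d) =>
        ∏ j, (gaussAvg σ (w j) (x j + √N * σ * z j)) ^ θ) μ :=
      integrable_of_bounded_comp (Measurable.aestronglyMeasurable <|
        Finset.measurable_prod _ fun j _ => ((hw' j).meas.comp (by fun_prop)).pow_const θ) _
        fun z => abs_prod_rpow_le ha hθ hw' fun j => x j + √N * σ * z j
    have h1 : ∫ z, ∫ z', F ((√N * σ) • z + σ • z') ∂μ ∂μ ≤
        ∫ z, (∏ j, (gaussAvg σ (w j) (x j + √N * σ * z j)) ^ θ + C * σ ^ 3) ∂μ := by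
      refine integral_mono hint.integral_prod_left (hG.add (integrable_const _)) fun z => ?_
      refine le_trans (le_of_eq ?_) (hstep w w₁ w₂ hw fun j => x j + √N * σ * z j)
      refine integral_congr_ae (Filter.Eventually.of_forall fun z' => ?_)
      simp [hF, add_assoc]
    refine h1.trans ?_
    rw [integral_add hG (integrable_const _)]
    have h2 := ih _ _ _ hw' x
    simp only [integral_const, probReal_univ, one_smul, Function.iterate_succ,
      Function.comp] at h2 ⊢
    push_cast
    linarith

end Iterate

/-- Gaussian averages of a function whose graph is symmetric about the point `(0, c)` have the same
symmetry. -/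
lemma gaussAvg_antisymm {w : ℝ → ℝ} {c : ℝ} (hm : Measurable w) {B : ℝ} (hB : ∀ x, |w x| ≤ B)
    (h : ∀ x, w (-x) = 2 * c - w x) (σ x : ℝ) : gaussAvg σ w (-x) = 2 * c - gaussAvg σ w x := by
  have e : gaussAvg σ w (-x) = ∫ z, w (-x + σ * (-z)) ∂gaussianReal 0 1 := by
    have hneg : (gaussianReal 0 1).map (fun z => -z) = gaussianReal 0 1 := by
      rw [gaussianReal_map_neg, neg_zero]
    unfold gaussAvg
    have hm' : Measurable fun z => w (-x + σ * z) := hm.comp (by fun_prop)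
    conv_lhs => rw [← hneg]
    rw [integral_map (by fun_prop) hm'.aestronglyMeasurable]
  rw [e]
  have : ∀ z, w (-x + σ * (-z)) = 2 * c - w (x + σ * z) := fun z => by
    rw [← h]; congr 1; ring
  simp_rw [this]
  rw [integral_sub (integrable_const _) (gaussAvg_integrable hm hB σ x)]
  simp [gaussAvg]

/-- The heat flow keeps the value at `0` of a function whose graph is symmetric about `(0, c)`. -/
lemma iterate_gaussAvg_zero {c σ : ℝ} (N : ℕ) : ∀ (w : ℝ → ℝ), Measurable w →
    (∃ B : ℝ, ∀ x, |w x| ≤ B) → (∀ x, w (-x) = 2 * c - w x) → (gaussAvg σ)^[N] w 0 = c := by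
  induction N with
  | zero =>
    intro w _ _ h
    have := h 0
    rw [neg_zero] at this
    simp only [Function.iterate_zero, id]
    linarith
  | succ N ih =>
    rintro w hm ⟨B, hB⟩ h
    rw [Function.iterate_succ, Function.comp]
    exact ih _ (measurable_gaussAvg hm σ) ⟨B, fun x => abs_integral_le_of_bounded fun _ => hB _⟩
      (gaussAvg_antisymm hm hB h σ)

/-! ### Smooth steps -/

section Taylor

lemma abs_le_mul_of_hasDerivAt {g g' : ℝ → ℝ} (h0 : g 0 = 0) (hg : ∀ t, HasDerivAt g (g' t) t)
    {K h : ℝ} (hK : ∀ t, |t| ≤ |h| → |g' t| ≤ K) : |g h| ≤ K * |h| := by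
  have := (convex_uIcc 0 h).norm_image_sub_le_of_norm_hasDerivWithin_le (f := g) (f' := g') (C := K)
    (fun t _ => (hg t).hasDerivWithinAt) (fun t ht => ?_) Set.left_mem_uIcc Set.right_mem_uIcc
  · simpa [h0] using this
  · refine hK t ?_
    have := Set.abs_sub_left_of_mem_uIcc ht
    simpa using this

lemma abs_taylor_two_le {f f₁ f₂ f₃ : ℝ → ℝ} {M : ℝ} (h1 : ∀ x, HasDerivAt f (f₁ x) x)
    (h2 : ∀ x, HasDerivAt f₁ (f₂ x) x) (h3 : ∀ x, HasDerivAt f₂ (f₃ x) x) (hM : ∀ x, |f₃ x| ≤ M)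
    (x h : ℝ) : |f (x + h) - (f x + f₁ x * h + f₂ x * h ^ 2 / 2)| ≤ M * |h| ^ 3 := by
  have hM0 : 0 ≤ M := (abs_nonneg _).trans (hM 0)
  have shift : ∀ {u u' : ℝ → ℝ}, (∀ x, HasDerivAt u (u' x) x) → ∀ t,
      HasDerivAt (fun t => u (x + t)) (u' (x + t)) t := fun hu t => (hu (x + t)).comp_const_add x t
  have b2 : ∀ t, |f₂ (x + t) - f₂ x| ≤ M * |t| := fun t =>
    abs_le_mul_of_hasDerivAt (g := fun t => f₂ (x + t) - f₂ x) (by simp)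
      (fun t => (shift h3 t).sub_const _) fun t _ => hM _
  have b1 : ∀ t, |f₁ (x + t) - f₁ x - f₂ x * t| ≤ M * |t| * |t| := fun t =>
    abs_le_mul_of_hasDerivAt (g := fun t => f₁ (x + t) - f₁ x - f₂ x * t)
      (g' := fun t => f₂ (x + t) - f₂ x) (by simp)
      (fun t => by
        have := ((shift h2 t).sub_const (f₁ x)).sub ((hasDerivAt_id t).const_mul (f₂ x))
        exact this.congr_deriv (by simp)) fun s hs => (b2 s).trans (by gcongr)
  have b0 : |f (x + h) - f x - f₁ x * h - f₂ x * (h ^ 2 / 2)| ≤ M * |h| * |h| * |h| :=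
    abs_le_mul_of_hasDerivAt (g := fun t => f (x + t) - f x - f₁ x * t - f₂ x * (t ^ 2 / 2))
      (g' := fun t => f₁ (x + t) - f₁ x - f₂ x * t) (by simp)
      (fun t => by
        have := (((shift h1 t).sub_const (f x)).sub ((hasDerivAt_id t).const_mul (f₁ x))).sub
          ((((hasDerivAt_id t).pow 2).div_const 2).const_mul (f₂ x))
        exact this.congr_deriv (by simp)) fun s hs => (b1 s).trans (by gcongr)
  calc _ = _ := by congr 1; ring
    _ ≤ _ := b0
    _ = _ := by ring

/-- An affine image of a rescaled arctangent: a smooth step between `c - s` and `c + s`. -/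
noncomputable def smoothStep (c s k x : ℝ) : ℝ := c + s * (2 / Real.pi * Real.arctan (k * x))

lemma abs_two_div_pi_mul_arctan_le (x : ℝ) : |2 / Real.pi * Real.arctan x| ≤ 1 := by
  have h1 := Real.arctan_lt_pi_div_two x
  have h2 := Real.neg_pi_div_two_lt_arctan x
  have hp := Real.pi_pos
  rw [abs_mul, abs_of_pos (by positivity)]
  have : |Real.arctan x| ≤ Real.pi / 2 := abs_le.2 ⟨by linarith, h1.le⟩
  calc _ ≤ 2 / Real.pi * (Real.pi / 2) := by gcongr
    _ = 1 := by field_simp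

/-- The expansion holds with every sufficiently large constant, so that finitely many smooth steps
have a common one. -/
lemma exists_hasTaylor_smoothStep (c s k : ℝ) {a b : ℝ} (ha : a ≤ c - |s|) (hb : c + |s| ≤ b) :
    ∃ M, 0 ≤ M ∧ ∃ w₁ w₂, ∀ M' ≥ M, HasTaylor a b M' (smoothStep c s k) w₁ w₂ := by
  set A := s * (2 / Real.pi) with hA
  have hD : ∀ x : ℝ, (0 : ℝ) < 1 + (k * x) ^ 2 := fun x => by positivity
  have hden : ∀ x, HasDerivAt (fun x => 1 + (k * x) ^ 2) (2 * k * (k * x)) x := fun x => by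
    have h := (((hasDerivAt_id x).const_mul k).pow 2).const_add 1
    exact h.congr_deriv (by simp; ring)
  have hden2 : ∀ x, HasDerivAt (fun x => (1 + (k * x) ^ 2) ^ 2)
      (2 * (1 + (k * x) ^ 2) * (2 * k * (k * x))) x := fun x =>
    ((hden x).pow 2).congr_deriv (by simp)
  set w₁ : ℝ → ℝ := fun x => A * k * (1 / (1 + (k * x) ^ 2)) with hw1
  set w₂ : ℝ → ℝ := fun x => A * k ^ 2 * (-2 * (k * x) / (1 + (k * x) ^ 2) ^ 2) with hw2
  set w₃ : ℝ → ℝ := fun x => A * k ^ 3 * ((6 * (k * x) ^ 2 - 2) / (1 + (k * x) ^ 2) ^ 3) with hw3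
  have d1 : ∀ x, HasDerivAt (smoothStep c s k) (w₁ x) x := fun x => by
    have h := ((((hasDerivAt_id x).const_mul k).arctan.const_mul (2 / Real.pi)).const_mul s).const_add c
    refine h.congr_deriv ?_
    simp only [hw1, hA, id]; ring
  have d2 : ∀ x, HasDerivAt w₁ (w₂ x) x := fun x => by
    have h := (((hasDerivAt_const x (1 : ℝ)).div (hden x) (hD x).ne').const_mul (A * k))
    refine h.congr_deriv ?_
    have := (hD x).ne'
    simp only [hw2]; field_simp; ring
  have d3 : ∀ x, HasDerivAt w₂ (w₃ x) x := fun x => by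
    have h := ((((hasDerivAt_id x).const_mul k).const_mul (-2)).div (hden2 x) (pow_ne_zero 2 (hD x).ne')).const_mul (A * k ^ 2)
    refine h.congr_deriv ?_
    have := (hD x).ne'
    simp only [hw3, id]; field_simp; ring
  have b1 : ∀ x, |w₁ x| ≤ |A * k| * 1 := fun x => by
    simp only [hw1]
    rw [abs_mul]
    gcongr
    rw [abs_of_pos (by have := hD x; positivity), div_le_one (hD x)]
    nlinarith [sq_nonneg (k * x)]
  have b2 : ∀ x, |w₂ x| ≤ |A * k ^ 2| * 1 := fun x => by
    simp only [hw2]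
    rw [abs_mul]
    gcongr
    rw [abs_div, abs_of_pos (pow_pos (hD x) 2), div_le_one (pow_pos (hD x) 2), abs_le]
    constructor <;> nlinarith [sq_nonneg (k * x - 1), sq_nonneg (k * x + 1), sq_nonneg ((k * x) ^ 2),
      sq_nonneg (k * x)]
  have b3 : ∀ x, |w₃ x| ≤ |A * k ^ 3| * 2 := fun x => by
    simp only [hw3]
    rw [abs_mul]
    gcongr
    rw [abs_div, abs_of_pos (pow_pos (hD x) 3), div_le_iff₀ (pow_pos (hD x) 3), abs_le]
    have h0 := sq_nonneg (k * x)
    have h1 : 0 ≤ ((k * x) ^ 2) ^ 2 := sq_nonneg _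
    have h2 : 0 ≤ ((k * x) ^ 2) ^ 3 := pow_nonneg h0 3
    constructor <;> nlinarith
  set M := |A * k| + |A * k ^ 2| + |A * k ^ 3| * 2 with hM
  refine ⟨M, by positivity, w₁, w₂, fun M' hM' => ?_⟩
  have p1 := abs_nonneg (A * k)
  have p2 := abs_nonneg (A * k ^ 2)
  have p3 := abs_nonneg (A * k ^ 3)
  have hat : ∀ x, |s * (2 / Real.pi * Real.arctan (k * x))| ≤ |s| := fun x => by
    rw [abs_mul]
    exact mul_le_of_le_one_right (abs_nonneg _) (abs_two_div_pi_mul_arctan_le _)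
  refine ⟨?_, ?_, ?_, fun x => ?_, fun x => ?_, fun x => (b1 x).trans (by linarith),
    fun x => (b2 x).trans (by linarith), fun x h => ?_, fun x h => ?_⟩
  · exact measurable_const.add ((Real.measurable_arctan.comp (by fun_prop)).const_mul _ |>.const_mul _)
  · simp only [hw1]; fun_prop
  · simp only [hw2]; fun_prop
  · have := (abs_le.1 (hat x)).1; unfold smoothStep; linarith
  · have := (abs_le.1 (hat x)).2; unfold smoothStep; linarith
  · refine abs_le_mul_of_hasDerivAt (g := fun h => smoothStep c s k (x + h) - smoothStep c s k x)
      (g' := fun h => w₁ (x + h)) (by simp)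
      (fun t => ((d1 (x + t)).comp_const_add x t).sub_const _)
      fun t _ => (b1 _).trans (by linarith)
  · exact abs_taylor_two_le d1 d2 d3 (fun x => (b3 x).trans (by linarith)) x h

lemma tendsto_smoothStep (c s x : ℝ) :
    Filter.Tendsto (fun k : ℕ => smoothStep c s k x) Filter.atTop (nhds (c + s * Real.sign x)) := by
  refine (Filter.Tendsto.const_mul s ?_).const_add c
  have hp := Real.pi_pos
  rcases lt_trichotomy x 0 with h | rfl | h
  · rw [Real.sign_of_neg h]
    have ht : Filter.Tendsto (fun k : ℕ => (k : ℝ) * x) Filter.atTop Filter.atBot :=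
      tendsto_natCast_atTop_atTop.atTop_mul_const_of_neg h
    have := ((Real.tendsto_arctan_atBot.mono_right nhdsWithin_le_nhds).comp ht).const_mul (2 / Real.pi)
    have e : 2 / Real.pi * -(Real.pi / 2) = -1 := by field_simp
    rw [e] at this
    exact this
  · simp
  · rw [Real.sign_of_pos h]
    have ht : Filter.Tendsto (fun k : ℕ => (k : ℝ) * x) Filter.atTop Filter.atTop :=
      tendsto_natCast_atTop_atTop.atTop_mul_const h
    have := ((Real.tendsto_arctan_atTop.mono_right nhdsWithin_le_nhds).comp ht).const_mul (2 / Real.pi)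
    have e : 2 / Real.pi * (Real.pi / 2) = 1 := by field_simp
    rw [e] at this
    exact this

end Taylor

/-! ### Sub-Gaussian sign vectors -/

lemma Real.measurable_sign : Measurable Real.sign := by
  unfold Real.sign
  exact Measurable.ite measurableSet_Iio measurable_const
    (Measurable.ite measurableSet_Ioi measurable_const measurable_const)

lemma Real.abs_sign_le_one (x : ℝ) : |Real.sign x| ≤ 1 := by
  rcases Real.sign_apply_eq x with h | h | h <;> simp [h]

/-- The exponential of a sign as a power `1 / L` of an affine function of the sign, with equality
unless `x = 0`, where the sign vanishes and the right-hand side is at least `1`. -/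
lemma exp_mul_sign_le {L t : ℝ} (hL : 0 < L) (x : ℝ) :
    Real.exp (t * Real.sign x) ≤
      (Real.cosh (L * t) + Real.sinh (L * t) * Real.sign x) ^ (1 / L) := by
  rcases lt_trichotomy x 0 with h | rfl | h
  · rw [Real.sign_of_neg h, mul_neg_one, mul_neg_one, ← sub_eq_add_neg, Real.cosh_sub_sinh,
      ← Real.exp_mul]
    refine le_of_eq ?_
    congr 1
    field_simp
  · rw [Real.sign_zero]
    simp only [mul_zero, Real.exp_zero, add_zero]
    exact Real.one_le_rpow (Real.one_le_cosh _) (by positivity)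
  · rw [Real.sign_of_pos h, mul_one, mul_one, Real.cosh_add_sinh, ← Real.exp_mul]
    refine le_of_eq ?_
    congr 1
    field_simp

lemma Real.cosh_sub_abs_sinh (x : ℝ) : Real.cosh x - |Real.sinh x| = Real.exp (-|x|) := by
  rw [← Real.cosh_abs, Real.abs_sinh, Real.cosh_sub_sinh]

section SignVector

variable {d : ℕ} {S : Matrix (Fin d) (Fin d) ℝ}

/-- The Gaussian Brascamp–Lieb inequality for smooth steps. The hypothesis `hθS` says that `θ S ≤ 1`,
and `c j` is the Gaussian mean of the `j`-th step, by its symmetry about `(0, c j)`. -/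
lemma integral_prod_smoothStep_le (hS : S.PosSemidef) (hdiag : ∀ j, S j j = 1) {θ : ℝ} (hθ : 0 < θ)
    (hθ1 : θ ≤ 1) (hθS : ∀ v : Fin d → ℝ, θ * ∑ i, ∑ j, v i * v j * S i j ≤ ∑ i, v i ^ 2)
    {a b : ℝ} (ha : 0 < a) (c s : Fin d → ℝ) (hac : ∀ j, a ≤ c j - |s j|)
    (hcb : ∀ j, c j + |s j| ≤ b) (k : ℝ) :
    ∫ z, ∏ j, (smoothStep (c j) (s j) k (z j)) ^ θ
      ∂multivariateGaussian (0 : EuclideanSpace ℝ (Fin d)) S ≤ ∏ j, (c j) ^ θ := by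
  choose M hM0 w₁ w₂ hw using fun j => exists_hasTaylor_smoothStep (c j) (s j) k (hac j) (hcb j)
  set M' := ∑ j, M j with hM'
  have hle : ∀ j, M j ≤ M' := fun j =>
    Finset.single_le_sum (f := M) (fun i _ => hM0 i) (Finset.mem_univ j)
  have hw' := fun j => hw j M' (hle j)
  obtain ⟨C, hC, hstep⟩ := integral_prod_rpow_step hS hdiag hθ hθ1 hθS (b := b) ha
    (Finset.sum_nonneg fun j _ => hM0 j : 0 ≤ M')
  -- `N` steps of length `1 / √N` cost `N * C / N ^ (3/2)`
  have hN : ∀ N : ℕ, 0 < N → ∫ z, ∏ j, (smoothStep (c j) (s j) k (z j)) ^ θ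
      ∂multivariateGaussian (0 : EuclideanSpace ℝ (Fin d)) S ≤ ∏ j, (c j) ^ θ + C * (√(N : ℝ))⁻¹ := by
    intro N hN
    have hNr : (0 : ℝ) < N := by exact_mod_cast hN
    have hsq : 0 < √(N : ℝ) := Real.sqrt_pos.2 hNr
    have h1 : (1 : ℝ) ≤ √(N : ℝ) := by
      rw [Real.one_le_sqrt]; exact_mod_cast hN
    have h := integral_prod_rpow_iterate hS hθ ha (σ := (√(N : ℝ))⁻¹)
      (fun w w₁ w₂ hw x => hstep w w₁ w₂ hw x _ (by positivity) (inv_le_one_of_one_le₀ h1)) N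
      _ _ _ hw' (fun _ => 0)
    have e1 : √(N : ℝ) * (√(N : ℝ))⁻¹ = 1 := mul_inv_cancel₀ hsq.ne'
    have e2 : (N : ℝ) * (C * (√(N : ℝ))⁻¹ ^ 3) = C * (√(N : ℝ))⁻¹ := by
      have : (N : ℝ) = √(N : ℝ) ^ 2 := (Real.sq_sqrt hNr.le).symm
      rw [this, Real.sqrt_sq hsq.le]
      field_simp
    have e3 : ∀ j, (gaussAvg (√(N : ℝ))⁻¹)^[N] (smoothStep (c j) (s j) k) 0 = c j := fun j =>
      iterate_gaussAvg_zero N _ (hw' j).meas ⟨_, (hw' j).abs_le⟩ fun x => by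
        simp only [smoothStep, mul_neg, Real.arctan_neg]; ring
    simpa only [e1, e2, e3, zero_add, one_mul] using h
  have hlim : Filter.Tendsto (fun N : ℕ => ∏ j, (c j) ^ θ + C * (√(N : ℝ))⁻¹) Filter.atTop
      (nhds (∏ j, (c j) ^ θ + C * 0)) :=
    ((tendsto_inv_atTop_zero.comp
      (Real.tendsto_sqrt_atTop.comp tendsto_natCast_atTop_atTop)).const_mul C).const_add _
  rw [mul_zero, add_zero] at hlim
  exact ge_of_tendsto hlim (Filter.eventually_atTop.2 ⟨1, fun N h => hN N h⟩)

/-- The sign vector of a Gaussian vector with correlation matrix `S` is sub-Gaussian with variance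
proxy the largest eigenvalue of `S`. -/
theorem integral_exp_sum_sign_le (hS : S.PosSemidef) (hdiag : ∀ j, S j j = 1) {L : ℝ} (hL : 1 ≤ L)
    (hLS : ∀ v : Fin d → ℝ, ∑ i, ∑ j, v i * v j * S i j ≤ L * ∑ i, v i ^ 2) (t : Fin d → ℝ) :
    ∫ z, Real.exp (∑ j, t j * Real.sign (z j))
      ∂multivariateGaussian (0 : EuclideanSpace ℝ (Fin d)) S ≤ Real.exp (L * ∑ j, t j ^ 2 / 2) := by
  set μ := multivariateGaussian (0 : EuclideanSpace ℝ (Fin d)) S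
  have hL0 : 0 < L := by linarith
  set Λ := ∑ j, |L * t j| with hΛ
  have hle : ∀ j, |L * t j| ≤ Λ := fun j =>
    Finset.single_le_sum (f := fun j => |L * t j|) (fun i _ => abs_nonneg _) (Finset.mem_univ j)
  set c : Fin d → ℝ := fun j => Real.cosh (L * t j) with hc
  set s : Fin d → ℝ := fun j => Real.sinh (L * t j) with hs
  have hac : ∀ j, Real.exp (-Λ) ≤ c j - |s j| := fun j => by
    rw [hc, hs, Real.cosh_sub_abs_sinh]
    exact Real.exp_le_exp.2 (neg_le_neg (hle j))
  have hcb : ∀ j, c j + |s j| ≤ Real.exp Λ := fun j => by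
    simp only [hc, hs]
    rw [← Real.cosh_abs, Real.abs_sinh, Real.cosh_add_sinh]
    exact Real.exp_le_exp.2 (hle j)
  have hθ : (0 : ℝ) < 1 / L := by positivity
  have hbound := fun k : ℕ => integral_prod_smoothStep_le hS hdiag hθ
    ((div_le_one hL0).2 hL) (fun v => by
      rw [one_div, inv_mul_le_iff₀ hL0]; exact hLS v) (Real.exp_pos _) c s hac hcb k
  have hTay : ∀ k : ℕ, ∃ M, ∃ w₁ w₂ : Fin d → ℝ → ℝ, ∀ j,
      HasTaylor (Real.exp (-Λ)) (Real.exp Λ) M (smoothStep (c j) (s j) k) (w₁ j) (w₂ j) := by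
    intro k
    choose M hM0 w₁ w₂ hw using fun j => exists_hasTaylor_smoothStep (c j) (s j) k (hac j) (hcb j)
    exact ⟨∑ j, M j, w₁, w₂, fun j => hw j _
      (Finset.single_le_sum (f := M) (fun i _ => hM0 i) (Finset.mem_univ j))⟩
  have hlim : Filter.Tendsto (fun k : ℕ => ∫ z, ∏ j, (smoothStep (c j) (s j) k (z j)) ^ (1 / L) ∂μ)
      Filter.atTop (nhds (∫ z, ∏ j, (c j + s j * Real.sign (z j)) ^ (1 / L) ∂μ)) := by
    refine tendsto_integral_of_dominated_convergence (fun _ => (|Real.exp Λ| ^ (1 / L)) ^ d)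
      (fun k => ?_) (integrable_const _) (fun k => ?_) ?_
    · obtain ⟨M, w₁, w₂, hw⟩ := hTay k
      exact (measurable_prod_rpow hw).aestronglyMeasurable
    · obtain ⟨M, w₁, w₂, hw⟩ := hTay k
      exact Filter.Eventually.of_forall fun z => abs_prod_rpow_le (Real.exp_pos _) hθ hw _
    · exact Filter.Eventually.of_forall fun z => tendsto_finsetProd _ fun j _ =>
        (tendsto_smoothStep _ _ _).rpow_const (Or.inr hθ.le)
  have h1 : ∫ z, ∏ j, (c j + s j * Real.sign (z j)) ^ (1 / L) ∂μ ≤ ∏ j, (c j) ^ (1 / L) :=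
    le_of_tendsto' hlim hbound
  have hsm : ∀ j, Measurable fun z : EuclideanSpace ℝ (Fin d) => Real.sign (z j) := fun j =>
    Real.measurable_sign.comp (by fun_prop)
  have hpos : ∀ j x, 0 ≤ c j + s j * Real.sign x := fun j x => by
    have h1 := hac j
    have h2 : |s j * Real.sign x| ≤ |s j| := by
      rw [abs_mul]; exact mul_le_of_le_one_right (abs_nonneg _) (Real.abs_sign_le_one x)
    have h3 := (abs_le.1 h2).1
    have h4 := Real.exp_pos (-Λ)
    linarith
  have h2 : ∫ z, Real.exp (∑ j, t j * Real.sign (z j)) ∂μ ≤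
      ∫ z, ∏ j, (c j + s j * Real.sign (z j)) ^ (1 / L) ∂μ := by
    refine integral_mono_of_nonneg (Filter.Eventually.of_forall fun z => (Real.exp_pos _).le) ?_
      (Filter.Eventually.of_forall fun z => ?_)
    · refine integrable_of_bounded_comp (Finset.measurable_prod _ fun j _ =>
        (((hsm j).const_mul _).const_add _).pow_const _).aestronglyMeasurable
        (∏ _j : Fin d, (Real.exp Λ) ^ (1 / L)) fun z => ?_
      rw [Finset.abs_prod]
      refine Finset.prod_le_prod (fun j _ => abs_nonneg _) fun j _ => ?_
      rw [abs_of_nonneg (Real.rpow_nonneg (hpos j _) _)]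
      refine Real.rpow_le_rpow (hpos j _) (le_trans ?_ (hcb j)) hθ.le
      have h2 : |s j * Real.sign (z j)| ≤ |s j| := by
        rw [abs_mul]; exact mul_le_of_le_one_right (abs_nonneg _) (Real.abs_sign_le_one _)
      linarith [(abs_le.1 h2).2]
    · simp only
      rw [Real.exp_sum]
      exact Finset.prod_le_prod (fun j _ => (Real.exp_pos _).le) fun j _ => exp_mul_sign_le hL0 _
  refine h2.trans (h1.trans ?_)
  calc ∏ j, (c j) ^ (1 / L) ≤ ∏ j, Real.exp (L * (t j ^ 2 / 2)) := by
        refine Finset.prod_le_prod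
          (fun j _ => Real.rpow_nonneg (zero_le_one.trans (Real.one_le_cosh _)) _) fun j _ => ?_
        calc (c j) ^ (1 / L) ≤ (Real.exp ((L * t j) ^ 2 / 2)) ^ (1 / L) :=
              Real.rpow_le_rpow (zero_le_one.trans (Real.one_le_cosh _))
                (Real.cosh_le_exp_half_sq _) hθ.le
          _ = _ := by
              rw [← Real.exp_mul]
              congr 1
              field_simp
    _ = _ := by rw [← Real.exp_sum, Finset.mul_sum]

end SignVector

/-! ### The Davis–Kahan theorem -/

section DavisKahan

variable {E : Type*} [NormedAddCommGroup E] [InnerProductSpace ℝ E] {d : ℕ}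

open scoped RealInnerProductSpace

lemma OrthonormalBasis.ext_of_inner (v : OrthonormalBasis (Fin d) ℝ E) {x y : E}
    (h : ∀ j, ⟪v j, x⟫ = ⟪v j, y⟫) : x = y := by
  rw [← v.sum_repr' x, ← v.sum_repr' y]
  simp_rw [h]

/-- The operator `A` is diagonal in the orthonormal basis `v`, with eigenvalues `l`. -/
def IsDiagonalIn (A : E →L[ℝ] E) (v : OrthonormalBasis (Fin d) ℝ E) (l : Fin d → ℝ) : Prop :=
  ∀ j, A (v j) = l j • v j

variable {A B : E →L[ℝ] E} {v w : OrthonormalBasis (Fin d) ℝ E} {l m : Fin d → ℝ}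

lemma IsDiagonalIn.inner_apply (h : IsDiagonalIn A v l) (x : E) (j : Fin d) :
    ⟪v j, A x⟫ = l j * ⟪v j, x⟫ := by
  conv_lhs => rw [← v.sum_repr' x]
  rw [map_sum, inner_sum]
  simp only [map_smul, h _, inner_smul_right, v.inner_eq_ite, mul_ite, mul_one, mul_zero,
    Finset.sum_ite_eq, Finset.mem_univ, if_true]
  ring

lemma IsDiagonalIn.inner_self (h : IsDiagonalIn A v l) (x : E) :
    ⟪x, A x⟫ = ∑ j, l j * ⟪v j, x⟫ ^ 2 := by
  rw [← v.sum_inner_mul_inner x (A x)]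
  refine Finset.sum_congr rfl fun j _ => ?_
  rw [h.inner_apply, real_inner_comm]
  ring

/-- Weyl's inequality. The vector `x` lies in the intersection of the span of the `j + 1` leading
eigenvectors of `A` with the span of the `d - j` trailing eigenvectors of `B`. -/
lemma IsDiagonalIn.le_add_norm_sub (hA : IsDiagonalIn A v l) (hB : IsDiagonalIn B w m)
    (hl : Antitone l) (hm : Antitone m) (j : Fin d) : l j ≤ m j + ‖A - B‖ := by
  let T : E →ₗ[ℝ] (Fin d → ℝ) := LinearMap.pi fun i =>
    if i < j then (innerₛₗ ℝ (w i)) else if j < i then (innerₛₗ ℝ (v i)) else 0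
  have hT : ¬ Function.Injective T := by
    have : FiniteDimensional ℝ E := v.toBasis.finiteDimensional_of_finite
    have hfr : Module.finrank ℝ E = Module.finrank ℝ (Fin d → ℝ) := by
      rw [Module.finrank_eq_card_basis v.toBasis]; simp
    rw [LinearMap.injective_iff_surjective_of_finrank_eq_finrank hfr]
    intro hs
    obtain ⟨x, hx⟩ := hs (fun _ => 1)
    have := congrFun hx j
    simp [T] at this
  rw [← LinearMap.ker_eq_bot, Submodule.eq_bot_iff] at hT
  push Not at hT
  obtain ⟨x, hx, hx0⟩ := hT
  rw [LinearMap.mem_ker] at hx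
  have hw : ∀ i, i < j → ⟪w i, x⟫ = 0 := fun i hi => by
    have := congrFun hx i
    simpa [T, hi] using this
  have hv : ∀ i, j < i → ⟪v i, x⟫ = 0 := fun i hi => by
    have := congrFun hx i
    simpa [T, hi, hi.not_gt] using this
  have hAx : l j * ‖x‖ ^ 2 ≤ ⟪x, A x⟫ := by
    rw [hA.inner_self, ← v.sum_sq_inner_right x, Finset.mul_sum]
    refine Finset.sum_le_sum fun i _ => ?_
    rcases le_or_gt i j with hij | hij
    · exact mul_le_mul_of_nonneg_right (hl hij) (sq_nonneg _)
    · simp [hv i hij]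
  have hBx : ⟪x, B x⟫ ≤ m j * ‖x‖ ^ 2 := by
    rw [hB.inner_self, ← w.sum_sq_inner_right x, Finset.mul_sum]
    refine Finset.sum_le_sum fun i _ => ?_
    rcases le_or_gt j i with hij | hij
    · exact mul_le_mul_of_nonneg_right (hm hij) (sq_nonneg _)
    · simp [hw i hij]
  have hdiff : ⟪x, A x⟫ - ⟪x, B x⟫ ≤ ‖A - B‖ * ‖x‖ ^ 2 := by
    rw [← inner_sub_right, ← sub_apply]
    calc _ ≤ ‖x‖ * ‖(A - B) x‖ := real_inner_le_norm _ _
      _ ≤ ‖x‖ * (‖A - B‖ * ‖x‖) := by gcongr; exact (A - B).le_opNorm x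
      _ = _ := by ring
  have hpos : 0 < ‖x‖ ^ 2 := by have := norm_pos_iff.2 hx0; positivity
  have : l j * ‖x‖ ^ 2 ≤ (m j + ‖A - B‖) * ‖x‖ ^ 2 := by linarith
  exact le_of_mul_le_mul_right this hpos

/-- The orthogonal projection onto the span of the first `k` vectors of `v`. -/
noncomputable def leadingProj (v : OrthonormalBasis (Fin d) ℝ E) (k : ℕ) : E →L[ℝ] E :=
  haveI : FiniteDimensional ℝ (Submodule.span ℝ (v '' {j : Fin d | (j : ℕ) < k})) :=
    FiniteDimensional.span_of_finite ℝ (Set.toFinite _)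
  (Submodule.span ℝ (v '' {j : Fin d | (j : ℕ) < k})).starProjection

lemma leadingProj_apply (v : OrthonormalBasis (Fin d) ℝ E) (k : ℕ) (x : E) :
    leadingProj v k x = ∑ j : Fin d, (if (j : ℕ) < k then ⟪v j, x⟫ else 0) • v j := by
  have : FiniteDimensional ℝ (Submodule.span ℝ (v '' {j : Fin d | (j : ℕ) < k})) :=
    FiniteDimensional.span_of_finite ℝ (Set.toFinite _)
  refine Submodule.eq_starProjection_of_mem_orthogonal (Submodule.sum_mem _ fun j _ => ?_) ?_
  · split_ifs with h
    · exact Submodule.smul_mem _ _ (Submodule.subset_span ⟨j, h, rfl⟩)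
    · simp
  · rw [Submodule.mem_orthogonal]
    intro u hu
    induction hu using Submodule.span_induction with
    | mem u hu =>
      obtain ⟨i, hi, rfl⟩ := hu
      have hi' : (i : ℕ) < k := hi
      rw [inner_sub_right, v.orthonormal.inner_right_fintype, if_pos hi', sub_self]
    | zero => simp
    | add a b _ _ ha hb => rw [inner_add_left, ha, hb, add_zero]
    | smul c a _ ha => rw [inner_smul_left, ha, mul_zero]

lemma inner_leadingProj (v : OrthonormalBasis (Fin d) ℝ E) (k : ℕ) (x : E) (i : Fin d) :
    ⟪v i, leadingProj v k x⟫ = if (i : ℕ) < k then ⟪v i, x⟫ else 0 := by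
  rw [leadingProj_apply, v.orthonormal.inner_right_fintype]

lemma norm_leadingProj_le (v : OrthonormalBasis (Fin d) ℝ E) (k : ℕ) : ‖leadingProj v k‖ ≤ 1 := by
  have : FiniteDimensional ℝ (Submodule.span ℝ (v '' {j : Fin d | (j : ℕ) < k})) :=
    FiniteDimensional.span_of_finite ℝ (Set.toFinite _)
  exact Submodule.starProjection_norm_le _

/-- If `A` is at most `a` off the range of its leading projection and `B` is at least `b > a` on
the range of its own, these ranges are close. With `K = (1 - P) Q` and `r` the preimage of `Q x`
under `B` in the range of `Q`, one has `K x = (1 - P) (B - A) r + A K r`. -/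
lemma norm_one_sub_comp_leadingProj_le (hA : IsDiagonalIn A v l) (hB : IsDiagonalIn B w m) {k : ℕ}
    {a b : ℝ} (ha : 0 ≤ a) (hab : a < b) (hla : ∀ j : Fin d, k ≤ j → |l j| ≤ a)
    (hmb : ∀ j : Fin d, (j : ℕ) < k → b ≤ m j) :
    (b - a) * ‖(1 - leadingProj v k) ∘L leadingProj w k‖ ≤ ‖A - B‖ := by
  set P := leadingProj v k with hP
  set Q := leadingProj w k with hQ
  set σ := ‖(1 - P) ∘L Q‖ with hσ
  have hb : 0 < b := ha.trans_lt hab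
  have hP1 : ‖(1 - P : E →L[ℝ] E)‖ ≤ 1 := by
    refine ContinuousLinearMap.opNorm_le_bound _ zero_le_one fun x => ?_
    rw [one_mul, ← sq_le_sq₀ (norm_nonneg _) (norm_nonneg _), ← v.sum_sq_inner_right,
      ← v.sum_sq_inner_right x]
    refine Finset.sum_le_sum fun j _ => ?_
    rw [sub_apply, one_apply_eq_self, inner_sub_right,
      inner_leadingProj]
    split_ifs
    · simp [sq_nonneg]
    · simp
  have hAP : ∀ y, (1 - P) (A y) = A ((1 - P) y) := fun y => by
    refine v.ext_of_inner fun j => ?_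
    simp only [sub_apply,
      one_apply_eq_self, inner_sub_right, hA.inner_apply, hP, inner_leadingProj]
    split_ifs <;> ring
  have hAle : ∀ y, ‖A ((1 - P) y)‖ ≤ a * ‖(1 - P) y‖ := fun y => by
    rw [← sq_le_sq₀ (norm_nonneg _) (by positivity), mul_pow, ← v.sum_sq_inner_right,
      ← v.sum_sq_inner_right ((1 - P) y), Finset.mul_sum]
    refine Finset.sum_le_sum fun j _ => ?_
    rw [hA.inner_apply, mul_pow]
    by_cases hj : (j : ℕ) < k
    · have : ⟪v j, (1 - P) y⟫ = 0 := by
        rw [sub_apply, one_apply_eq_self, inner_sub_right, hP,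
          inner_leadingProj, if_pos hj, sub_self]
      rw [this]; simp
    · refine mul_le_mul_of_nonneg_right ?_ (sq_nonneg _)
      rw [← sq_abs]
      exact pow_le_pow_left₀ (abs_nonneg _) (hla j (not_lt.1 hj)) 2
  have hmain : σ ≤ (‖A - B‖ + a * σ) / b := by
    refine ContinuousLinearMap.opNorm_le_bound _ (by positivity) fun x => ?_
    set r : E := ∑ j : Fin d, (if (j : ℕ) < k then ⟪w j, x⟫ / m j else 0) • w j with hr
    have hrj : ∀ j, ⟪w j, r⟫ = if (j : ℕ) < k then ⟪w j, x⟫ / m j else 0 := fun j => by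
      rw [hr, w.orthonormal.inner_right_fintype]
    have hrn : ‖r‖ ≤ ‖x‖ / b := by
      rw [← sq_le_sq₀ (norm_nonneg _) (by positivity), div_pow, ← w.sum_sq_inner_right,
        ← w.sum_sq_inner_right x, Finset.sum_div]
      refine Finset.sum_le_sum fun j _ => ?_
      rw [hrj]
      split_ifs with hj
      · rw [div_pow]
        gcongr
        exact hmb j hj
      · simp only [ne_eq, OfNat.ofNat_ne_zero, not_false_eq_true, zero_pow]; positivity
    have hQr : Q r = r := by
      refine w.ext_of_inner fun j => ?_
      simp only [hQ, inner_leadingProj, hrj]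
      split_ifs <;> rfl
    have hBr : B r = Q x := by
      refine w.ext_of_inner fun j => ?_
      simp only [hB.inner_apply, hQ, inner_leadingProj, hrj]
      split_ifs with hj
      · have := (hb.trans_le (hmb j hj)).ne'
        field_simp
      · simp
    have e : ((1 - P) ∘L Q) x = A ((1 - P) r) - (1 - P) ((A - B) r) := by
      rw [ContinuousLinearMap.comp_apply, ← hBr, ← hAP, ← map_sub, sub_apply A B]
      congr 1
      abel
    have h1 : ‖(1 - P) r‖ ≤ σ * ‖r‖ := by
      have := ((1 - P) ∘L Q).le_opNorm r
      rwa [ContinuousLinearMap.comp_apply, hQr] at this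
    have h2 : ‖(1 - P) ((A - B) r)‖ ≤ ‖A - B‖ * ‖r‖ := by
      refine ((1 - P).le_opNorm _).trans ?_
      calc _ ≤ 1 * (‖A - B‖ * ‖r‖) := by gcongr; exact (A - B).le_opNorm r
        _ = _ := one_mul _
    rw [e]
    calc _ ≤ ‖A ((1 - P) r)‖ + ‖(1 - P) ((A - B) r)‖ := norm_sub_le _ _
      _ ≤ a * (σ * ‖r‖) + ‖A - B‖ * ‖r‖ := by
          gcongr
          exact (hAle r).trans (by gcongr)
      _ = (‖A - B‖ + a * σ) * ‖r‖ := by ring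
      _ ≤ (‖A - B‖ + a * σ) * (‖x‖ / b) := by gcongr
      _ = _ := by ring
  rw [le_div_iff₀ hb] at hmain
  linarith

lemma norm_leadingProj_sub_le_two (v w : OrthonormalBasis (Fin d) ℝ E) (k : ℕ) :
    ‖leadingProj w k - leadingProj v k‖ ≤ 2 :=
  (norm_sub_le _ _).trans (by
    linarith [norm_leadingProj_le v k, norm_leadingProj_le w k])

/-- The Davis–Kahan theorem for the leading projections of a positive semidefinite `A` and a
symmetric perturbation `B`. -/
theorem norm_leadingProj_sub_mul_gap_le [CompleteSpace E] (hA : IsDiagonalIn A v l)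
    (hB : IsDiagonalIn B w m)
    (hl : Antitone l) (hm : Antitone m) (hl0 : ∀ j, 0 ≤ l j) {k : ℕ} (hk : k < d) (hk1 : 1 ≤ k) :
    (l ⟨k - 1, by omega⟩ - l ⟨k, hk⟩) * ‖leadingProj w k - leadingProj v k‖ ≤ 4 * ‖B - A‖ := by
  set i : Fin d := ⟨k - 1, by omega⟩ with hi
  set j : Fin d := ⟨k, hk⟩ with hj
  set e := ‖A - B‖ with he
  have he' : ‖B - A‖ = e := norm_sub_rev _ _
  rw [he']
  set P := leadingProj v k with hP
  set Q := leadingProj w k with hQ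
  have hij : l j ≤ l i := hl (by simp [hi, hj, Fin.le_def])
  -- a perturbation of more than half the gap is covered by the trivial bound `2` for the distance
  rcases lt_or_ge ((l i - l j) / 2) e with hbig | hsmall
  · have := norm_leadingProj_sub_le_two v w k
    have h0 := norm_nonneg (Q - P)
    nlinarith
  rcases hij.eq_or_lt with heq | hlt
  · rw [heq]; simp [he]
  have he0 : 0 ≤ e := norm_nonneg _
  have hlk : ∀ r : Fin d, (r : ℕ) < k → l i ≤ l r := fun r hr => hl (by
    simp only [hi, Fin.le_def]; omega)
  have hW1 := fun r => hA.le_add_norm_sub hB hl hm r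
  have hW2 := fun r => hB.le_add_norm_sub hA hm hl r
  rw [he'] at hW2
  have h1 := norm_one_sub_comp_leadingProj_le hA hB (k := k) (hl0 j) (b := l i - e) (by linarith)
    (fun r hr => by
      rw [abs_of_nonneg (hl0 r)]; exact hl (by simpa [hj, Fin.le_def] using hr))
    (fun r hr => by linarith [hW1 r, hlk r hr])
  have h2 := norm_one_sub_comp_leadingProj_le hB hA (k := k) (a := l j + e) (b := l i)
    (by linarith [hl0 j]) (by linarith)
    (fun r hr => by
      have hrj : l r ≤ l j := hl (by simpa [hj, Fin.le_def] using hr)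
      rw [abs_le]
      constructor
      · linarith [hW1 r, hl0 r, hl0 j]
      · linarith [hW2 r])
    (fun r hr => hlk r hr)
  rw [he'] at h2
  have hsa : ∀ u : OrthonormalBasis (Fin d) ℝ E, ContinuousLinearMap.adjoint (leadingProj u k)
      = leadingProj u k := fun u => by
    have : FiniteDimensional ℝ (Submodule.span ℝ (u '' {j : Fin d | (j : ℕ) < k})) :=
      FiniteDimensional.span_of_finite ℝ (Set.toFinite _)
    exact (isSelfAdjoint_starProjection _).adjoint_eq
  have hadj : ‖P ∘L (1 - Q)‖ = ‖(1 - Q) ∘L P‖ := by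
    have h1a : ContinuousLinearMap.adjoint (1 : E →L[ℝ] E) = 1 := by
      rw [← ContinuousLinearMap.star_eq_adjoint, star_one]
    rw [← LinearIsometryEquiv.norm_map ContinuousLinearMap.adjoint ((1 - Q) ∘L P),
      ContinuousLinearMap.adjoint_comp, map_sub, hP, hQ, hsa, hsa, h1a]
  have hdec : Q - P = (1 - P) ∘L Q - P ∘L (1 - Q) := by
    ext x; simp
  have hn : ‖Q - P‖ ≤ ‖(1 - P) ∘L Q‖ + ‖(1 - Q) ∘L P‖ := by
    rw [hdec, ← hadj]; exact norm_sub_le _ _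
  have n1 := norm_nonneg ((1 - P) ∘L Q)
  have n2 := norm_nonneg ((1 - Q) ∘L P)
  have g : (l i - l j) / 2 ≤ l i - l j - e := by linarith
  have g1 : (l i - l j) / 2 * ‖(1 - P) ∘L Q‖ ≤ e :=
    le_trans (mul_le_mul_of_nonneg_right g n1) (by linarith)
  have g2 : (l i - l j) / 2 * ‖(1 - Q) ∘L P‖ ≤ e :=
    le_trans (mul_le_mul_of_nonneg_right g n2) (by linarith)
  have := mul_le_mul_of_nonneg_left hn (by linarith : 0 ≤ l i - l j)
  linarith

end DavisKahan

/-! ### Ordered eigenvalues and leading eigenprojections of matrices -/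

section Matrix

variable {d : ℕ} {A : Matrix (Fin d) (Fin d) ℝ}

lemma exists_isDiagonalIn_orderedEigenvalue (hA : A.IsHermitian) :
    ∃ v : OrthonormalBasis (Fin d) ℝ (EuclideanSpace ℝ (Fin d)),
      IsDiagonalIn (Matrix.toEuclideanCLM (n := Fin d) (𝕜 := ℝ) A) v (orderedEigenvalue hA) := by
  refine ⟨((Matrix.isSymmetric_toEuclideanLin_iff.mpr hA).eigenvectorBasis
    finrank_euclideanSpace).reindex (finCongr (Fintype.card_fin d)), fun j => ?_⟩
  have := (Matrix.isSymmetric_toEuclideanLin_iff.mpr hA).apply_eigenvectorBasis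
    finrank_euclideanSpace (Fin.cast (Fintype.card_fin d).symm j)
  rw [OrthonormalBasis.reindex_apply]
  exact this

lemma orderedEigenvalue_antitone (hA : A.IsHermitian) : Antitone (orderedEigenvalue hA) :=
  fun _ _ h => hA.eigenvalues₀_antitone (by simpa using h)

/-- The eigenvalues attached to any decreasingly ordered orthonormal eigenbasis are the ordered
eigenvalues: this is Weyl's inequality for a zero perturbation, in both directions. -/
lemma IsDiagonalIn.eq_orderedEigenvalue (hA : A.IsHermitian)
    {v : OrthonormalBasis (Fin d) ℝ (EuclideanSpace ℝ (Fin d))} {l : Fin d → ℝ}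
    (h : IsDiagonalIn (Matrix.toEuclideanCLM (n := Fin d) (𝕜 := ℝ) A) v l) (hl : Antitone l) :
    l = orderedEigenvalue hA := by
  obtain ⟨w, hw⟩ := exists_isDiagonalIn_orderedEigenvalue hA
  funext j
  have h1 := h.le_add_norm_sub hw hl (orderedEigenvalue_antitone hA) j
  have h2 := hw.le_add_norm_sub h (orderedEigenvalue_antitone hA) hl j
  rw [sub_self, norm_zero, add_zero] at h1 h2
  exact le_antisymm h1 h2

lemma orderedEigenvalue_nonneg (hA : A.PosSemidef) (j : Fin d) :
    0 ≤ orderedEigenvalue hA.isHermitian j := by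
  obtain ⟨v, hv⟩ := exists_isDiagonalIn_orderedEigenvalue hA.isHermitian
  have h1 := hA.dotProduct_mulVec_nonneg (v j).ofLp
  have h2 : inner ℝ (v j) (Matrix.toEuclideanCLM (n := Fin d) (𝕜 := ℝ) A (v j)) =
      orderedEigenvalue hA.isHermitian j := by
    rw [hv j, inner_smul_right, v.inner_eq_one, mul_one]
  rw [← h2, Matrix.inner_toEuclideanCLM]
  simpa using h1

lemma orderedEigenvalue_le_spectralNorm (hA : A.IsHermitian) (j : Fin d) :
    orderedEigenvalue hA j ≤ spectralNorm₂ A := by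
  obtain ⟨v, hv⟩ := exists_isDiagonalIn_orderedEigenvalue hA
  have h := (Matrix.toEuclideanCLM (n := Fin d) (𝕜 := ℝ) A).le_opNorm (v j)
  rw [hv j, norm_smul, v.norm_eq_one, mul_one, mul_one] at h
  exact (le_abs_self _).trans h

lemma IsLeadingEigenprojection.norm_sub_le_two {B : Matrix (Fin d) (Fin d) ℝ} {k : ℕ}
    {P Q : EuclideanSpace ℝ (Fin d) →L[ℝ] EuclideanSpace ℝ (Fin d)}
    (hP : IsLeadingEigenprojection A k P) (hQ : IsLeadingEigenprojection B k Q) :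
    ‖Q - P‖ ≤ 2 := by
  obtain ⟨v, l, hl, hv, rfl⟩ := hP
  obtain ⟨w, m, hm, hw, rfl⟩ := hQ
  exact norm_leadingProj_sub_le_two v w k

/-- The Davis–Kahan theorem for matrices. Whichever eigenbases the projections come from, the gap is
the one between the ordered eigenvalues. -/
lemma IsLeadingEigenprojection.gap_mul_norm_sub_le {B : Matrix (Fin d) (Fin d) ℝ}
    (hA : A.PosSemidef) {k : ℕ} (hk : k < d) (hk1 : 1 ≤ k)
    {P Q : EuclideanSpace ℝ (Fin d) →L[ℝ] EuclideanSpace ℝ (Fin d)}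
    (hP : IsLeadingEigenprojection A k P) (hQ : IsLeadingEigenprojection B k Q) :
    (orderedEigenvalue hA.isHermitian ⟨k - 1, lt_of_le_of_lt (Nat.sub_le k 1) hk⟩ -
      orderedEigenvalue hA.isHermitian ⟨k, hk⟩) * ‖Q - P‖ ≤ 4 * spectralNorm₂ (B - A) := by
  obtain ⟨v, l, hl, hv, rfl⟩ := hP
  obtain ⟨w, m, hm, hw, rfl⟩ := hQ
  have hlA := IsDiagonalIn.eq_orderedEigenvalue hA.isHermitian (v := v) hv hl
  subst hlA
  have := norm_leadingProj_sub_mul_gap_le hv hw hl hm (orderedEigenvalue_nonneg hA) hk hk1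
  rw [← map_sub] at this
  exact this

end Matrix

/-! ### The spectral norm and Hadamard multipliers -/

section SpectralNorm

variable {d : ℕ}

lemma spectralNorm₂_nonneg (A : Matrix (Fin d) (Fin d) ℝ) : 0 ≤ spectralNorm₂ A := norm_nonneg _

lemma spectralNorm₂_add_le (A B : Matrix (Fin d) (Fin d) ℝ) :
    spectralNorm₂ (A + B) ≤ spectralNorm₂ A + spectralNorm₂ B := by
  unfold spectralNorm₂
  rw [map_add]
  exact norm_add_le _ _

lemma spectralNorm₂_sub_le (A B : Matrix (Fin d) (Fin d) ℝ) :
    spectralNorm₂ (A - B) ≤ spectralNorm₂ A + spectralNorm₂ B := by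
  unfold spectralNorm₂
  rw [map_sub]
  exact norm_sub_le _ _

lemma spectralNorm₂_smul (c : ℝ) (A : Matrix (Fin d) (Fin d) ℝ) :
    spectralNorm₂ (c • A) = |c| * spectralNorm₂ A := by
  unfold spectralNorm₂
  rw [map_smul, norm_smul, Real.norm_eq_abs]

lemma inner_toEuclideanCLM_eq_sum (A : Matrix (Fin d) (Fin d) ℝ) (x y : EuclideanSpace ℝ (Fin d)) :
    inner ℝ y (Matrix.toEuclideanCLM (n := Fin d) (𝕜 := ℝ) A x) =
      ∑ i, ∑ j, y i * A i j * x j := by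
  rw [Matrix.inner_toEuclideanCLM]
  simp only [dotProduct, Matrix.mulVec, Finset.mul_sum, mul_assoc]

lemma bilin_le_spectralNorm₂ (A : Matrix (Fin d) (Fin d) ℝ) (x y : EuclideanSpace ℝ (Fin d)) :
    ∑ i, ∑ j, y i * A i j * x j ≤ spectralNorm₂ A * (‖y‖ * ‖x‖) := by
  rw [← inner_toEuclideanCLM_eq_sum]
  calc _ ≤ ‖y‖ * ‖Matrix.toEuclideanCLM (n := Fin d) (𝕜 := ℝ) A x‖ := real_inner_le_norm _ _
    _ ≤ ‖y‖ * (spectralNorm₂ A * ‖x‖) := by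
        gcongr; exact (Matrix.toEuclideanCLM (n := Fin d) (𝕜 := ℝ) A).le_opNorm x
    _ = _ := by ring

lemma spectralNorm₂_le_of_bilin {A : Matrix (Fin d) (Fin d) ℝ} {C : ℝ} (hC : 0 ≤ C)
    (h : ∀ x y : EuclideanSpace ℝ (Fin d), ∑ i, ∑ j, y i * A i j * x j ≤ C * (‖y‖ * ‖x‖)) :
    spectralNorm₂ A ≤ C := by
  refine ContinuousLinearMap.opNorm_le_bound _ hC fun x => ?_
  set z := Matrix.toEuclideanCLM (n := Fin d) (𝕜 := ℝ) A x with hz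
  have h1 := h x z
  rw [← inner_toEuclideanCLM_eq_sum, ← hz, real_inner_self_eq_norm_sq] at h1
  rcases (norm_nonneg z).eq_or_lt with h0 | h0
  · rw [← h0]; positivity
  · have : ‖z‖ * ‖z‖ ≤ (C * ‖x‖) * ‖z‖ := by nlinarith
    exact le_of_mul_le_mul_right this h0

lemma spectralNorm₂_le_frobenius (A : Matrix (Fin d) (Fin d) ℝ) :
    spectralNorm₂ A ≤ √(∑ i, ∑ j, A i j ^ 2) := by
  refine spectralNorm₂_le_of_bilin (Real.sqrt_nonneg _) fun x y => ?_
  have h1 : ∑ i, ∑ j, y i * A i j * x j =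
      ∑ p : Fin d × Fin d, A p.1 p.2 * (y p.1 * x p.2) := by
    rw [Fintype.sum_prod_type]
    exact Finset.sum_congr rfl fun i _ => Finset.sum_congr rfl fun j _ => by ring
  have h2 := Real.sum_mul_le_sqrt_mul_sqrt (Finset.univ : Finset (Fin d × Fin d))
    (fun p => A p.1 p.2) (fun p => y p.1 * x p.2)
  have h3 : ∑ p : Fin d × Fin d, (y p.1 * x p.2) ^ 2 = (‖y‖ * ‖x‖) ^ 2 := by
    rw [mul_pow, EuclideanSpace.real_norm_sq_eq, EuclideanSpace.real_norm_sq_eq,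
      Fintype.sum_prod_type, Finset.sum_mul_sum]
    simp_rw [mul_pow]
  rw [h3, Real.sqrt_sq (by positivity),
    Fintype.sum_prod_type (f := fun p : Fin d × Fin d => A p.1 p.2 ^ 2)] at h2
  rw [h1]
  exact h2

/-- Schur's bound: a positive semidefinite matrix `M` with diagonal at most `1` is a contractive
Hadamard multiplier. With `M = Bᵀ B` the bilinear form of the Hadamard product is the sum of the
forms of `A` at the vectors multiplied entrywise by the rows of `B`. -/
lemma spectralNorm₂_hadamard_le {M : Matrix (Fin d) (Fin d) ℝ} (hM : M.PosSemidef)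
    (hdiag : ∀ j, M j j ≤ 1) (A : Matrix (Fin d) (Fin d) ℝ) :
    spectralNorm₂ (M.hadamard A) ≤ spectralNorm₂ A := by
  obtain ⟨N, B, rfl⟩ := Matrix.posSemidef_iff_eq_sum_vecMulVec.1 hM
  have hB : ∀ i j, (∑ m, Matrix.vecMulVec (B m) (star (B m))) i j = ∑ m, B m i * B m j :=
    fun i j => by simp [Matrix.sum_apply, Matrix.vecMulVec_apply]
  refine spectralNorm₂_le_of_bilin (spectralNorm₂_nonneg _) fun x y => ?_
  let z : EuclideanSpace ℝ (Fin d) → Fin N → EuclideanSpace ℝ (Fin d) := fun x m =>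
    WithLp.toLp 2 fun i => B m i * x i
  have hz : ∀ x, ∑ m, ‖z x m‖ ^ 2 ≤ ‖x‖ ^ 2 := fun x => by
    have : ∀ m, ‖z x m‖ ^ 2 = ∑ i, B m i * B m i * x i ^ 2 := fun m => by
      rw [EuclideanSpace.real_norm_sq_eq]
      exact Finset.sum_congr rfl fun i _ => by simp only [z]; ring
    simp_rw [this]
    rw [Finset.sum_comm, EuclideanSpace.real_norm_sq_eq]
    refine Finset.sum_le_sum fun i _ => ?_
    rw [← Finset.sum_mul, ← hB]
    exact mul_le_of_le_one_left (sq_nonneg _) (hdiag i)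
  have e : ∑ i, ∑ j, y i * (∑ m, Matrix.vecMulVec (B m) (star (B m))).hadamard A i j * x j =
      ∑ m, ∑ i, ∑ j, z y m i * A i j * z x m j := by
    rw [Finset.sum_comm (s := (Finset.univ : Finset (Fin N)))]
    refine Finset.sum_congr rfl fun i _ => ?_
    rw [Finset.sum_comm (s := (Finset.univ : Finset (Fin N)))]
    refine Finset.sum_congr rfl fun j _ => ?_
    rw [Matrix.hadamard_apply, hB, Finset.sum_mul, Finset.mul_sum, Finset.sum_mul]
    exact Finset.sum_congr rfl fun m _ => by simp only [z]; ring
  rw [e]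
  calc _ ≤ ∑ m, spectralNorm₂ A * (‖z y m‖ * ‖z x m‖) :=
        Finset.sum_le_sum fun m _ => bilin_le_spectralNorm₂ A _ _
    _ = spectralNorm₂ A * ∑ m, ‖z y m‖ * ‖z x m‖ := by rw [Finset.mul_sum]
    _ ≤ spectralNorm₂ A * (‖y‖ * ‖x‖) := by
        refine mul_le_mul_of_nonneg_left ?_ (spectralNorm₂_nonneg _)
        refine (Real.sum_mul_le_sqrt_mul_sqrt _ _ _).trans ?_
        refine mul_le_mul ?_ ?_ (Real.sqrt_nonneg _) (norm_nonneg _)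
        · exact Real.sqrt_le_iff.2 ⟨norm_nonneg _, hz y⟩
        · exact Real.sqrt_le_iff.2 ⟨norm_nonneg _, hz x⟩

end SpectralNorm

/-! ### The entrywise sine near the entrywise arcsine -/

section CosArcsin

/-- Iterates converging to `1 - √(1 - x ^ 2)`, each a polynomial in `x` with nonnegative
coefficients. -/
noncomputable def sqrtIter : ℕ → ℝ → ℝ
  | 0, _ => 0
  | n + 1, x => (x ^ 2 + sqrtIter n x ^ 2) / 2

lemma sqrtIter_mem (n : ℕ) {x : ℝ} (hx : |x| ≤ 1) :
    0 ≤ sqrtIter n x ∧ sqrtIter n x ≤ sqrtIter (n + 1) x ∧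
      sqrtIter (n + 1) x ≤ 1 - √(1 - x ^ 2) := by
  have hx2 : x ^ 2 ≤ 1 := (sq_le_one_iff_abs_le_one x).2 hx
  have hs := Real.sq_sqrt (by linarith : 0 ≤ 1 - x ^ 2)
  have hs0 := Real.sqrt_nonneg (1 - x ^ 2)
  induction n with
  | zero =>
    simp only [sqrtIter]
    refine ⟨le_rfl, by positivity, ?_⟩
    nlinarith
  | succ n ih =>
    obtain ⟨h0, h1, h2⟩ := ih
    refine ⟨h0.trans h1, ?_, ?_⟩
    · have : sqrtIter n x ^ 2 ≤ sqrtIter (n + 1) x ^ 2 := pow_le_pow_left₀ h0 h1 2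
      change (x ^ 2 + sqrtIter n x ^ 2) / 2 ≤ (x ^ 2 + sqrtIter (n + 1) x ^ 2) / 2
      linarith
    · have : sqrtIter (n + 1) x ^ 2 ≤ (1 - √(1 - x ^ 2)) ^ 2 :=
        pow_le_pow_left₀ (h0.trans h1) h2 2
      change (x ^ 2 + sqrtIter (n + 1) x ^ 2) / 2 ≤ _
      nlinarith

lemma tendsto_sqrtIter {x : ℝ} (hx : |x| ≤ 1) :
    Filter.Tendsto (fun n => sqrtIter n x) Filter.atTop (nhds (1 - √(1 - x ^ 2))) := by
  have hx2 : x ^ 2 ≤ 1 := (sq_le_one_iff_abs_le_one x).2 hx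
  have hs := Real.sq_sqrt (by linarith : 0 ≤ 1 - x ^ 2)
  have hs0 := Real.sqrt_nonneg (1 - x ^ 2)
  have hmono : Monotone fun n => sqrtIter n x := monotone_nat_of_le_succ fun n =>
    (sqrtIter_mem n hx).2.1
  have hbdd : ∀ n, sqrtIter n x ≤ 1 - √(1 - x ^ 2) := fun n =>
    (sqrtIter_mem n hx).2.1.trans (sqrtIter_mem n hx).2.2
  have hlim := tendsto_atTop_ciSup hmono ⟨_, Set.forall_mem_range.2 hbdd⟩
  set ℓ := ⨆ n, sqrtIter n x
  have h1 : Filter.Tendsto (fun n => sqrtIter (n + 1) x) Filter.atTop (nhds ℓ) :=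
    hlim.comp (Filter.tendsto_add_atTop_nat 1)
  have h2 : Filter.Tendsto (fun n => sqrtIter (n + 1) x) Filter.atTop
      (nhds ((x ^ 2 + ℓ ^ 2) / 2)) := ((hlim.pow 2).const_add _).div_const 2
  have hfix := tendsto_nhds_unique h1 h2
  have hle : ℓ ≤ 1 - √(1 - x ^ 2) := le_of_tendsto' hlim hbdd
  -- `ℓ` is a fixed point, so `(1 - ℓ) ^ 2 = 1 - x ^ 2`
  have : (1 - ℓ - √(1 - x ^ 2)) * (1 - ℓ + √(1 - x ^ 2)) = 0 := by nlinarith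
  have hℓ : ℓ = 1 - √(1 - x ^ 2) := by
    rcases mul_eq_zero.1 this with h | h
    · linarith
    · have : √(1 - x ^ 2) = 0 := by linarith
      linarith
  rwa [hℓ] at hlim

variable {d : ℕ} {S : Matrix (Fin d) (Fin d) ℝ}

lemma posSemidef_abs_apply_le_one (hS : S.PosSemidef) (hdiag : ∀ j, S j j = 1) (i j : Fin d) :
    |S i j| ≤ 1 := by
  have hsym : S j i = S i j := by simpa using hS.isHermitian.apply i j
  have key : ∀ s : ℝ, 0 ≤ 1 + 2 * s * S i j + s ^ 2 := fun s => by
    have h := hS.dotProduct_mulVec_nonneg (Pi.single i 1 + Pi.single j s)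
    simp only [star_trivial, Matrix.mulVec_add, add_dotProduct, dotProduct_add,
      Matrix.mulVec_single, single_dotProduct] at h
    simp [hdiag, hsym] at h
    linarith
  rw [abs_le]
  constructor <;> linarith [key 1, key (-1)]

lemma posSemidef_map_sqrtIter (hS : S.PosSemidef) (n : ℕ) :
    (S.map (sqrtIter n)).PosSemidef := by
  induction n with
  | zero =>
    have : S.map (sqrtIter 0) = 0 := by ext; simp [sqrtIter]
    rw [this]; exact Matrix.PosSemidef.zero
  | succ n ih =>
    have : S.map (sqrtIter (n + 1)) = (1 / 2 : ℝ) • (S.hadamard S +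
        (S.map (sqrtIter n)).hadamard (S.map (sqrtIter n))) := by
      ext i j; simp [sqrtIter]; ring
    rw [this]
    exact ((hS.hadamard hS).add (ih.hadamard ih)).smul (by norm_num)

/-- `1 - √(1 - x ^ 2)` preserves positive semidefiniteness entrywise. -/
lemma posSemidef_map_one_sub_sqrt (hS : S.PosSemidef) (hle : ∀ i j, |S i j| ≤ 1) :
    (S.map fun x => 1 - √(1 - x ^ 2)).PosSemidef := by
  refine Matrix.PosSemidef.of_dotProduct_mulVec_nonneg ?_ fun x => ?_
  · ext i j
    have : S j i = S i j := by simpa using hS.isHermitian.apply i j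
    simp [this]
  · have hn : ∀ n, 0 ≤ star x ⬝ᵥ (S.map (sqrtIter n)).mulVec x := fun n =>
      (posSemidef_map_sqrtIter hS n).dotProduct_mulVec_nonneg x
    refine ge_of_tendsto' (x := Filter.atTop) (f := fun n => star x ⬝ᵥ (S.map (sqrtIter n)).mulVec x) ?_ hn
    simp only [dotProduct, Matrix.mulVec, Matrix.map_apply]
    exact tendsto_finsetSum _ fun i _ => Filter.Tendsto.const_mul _ <|
      tendsto_finsetSum _ fun j _ => (tendsto_sqrtIter (hle i j)).mul_const _

lemma abs_sin_add_sub_le (θ e : ℝ) :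
    |Real.sin (θ + e) - Real.sin θ - Real.cos θ * e| ≤ e ^ 2 := by
  have h := abs_le_mul_of_hasDerivAt
    (g := fun t => Real.sin (θ + t) - Real.sin θ - Real.cos θ * t)
    (g' := fun t => Real.cos (θ + t) - Real.cos θ) (by simp)
    (fun t => by
      have h1 := ((Real.hasDerivAt_sin (θ + t)).comp_const_add θ t).sub_const (Real.sin θ)
      exact (h1.sub ((hasDerivAt_id t).const_mul (Real.cos θ))).congr_deriv (by simp))
    (K := |e|) (h := e) (fun t ht => ?_)
  · simpa [← sq] using h
  · refine le_trans ?_ ht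
    exact abs_le_mul_of_hasDerivAt (g := fun t => Real.cos (θ + t) - Real.cos θ)
      (g' := fun t => -Real.sin (θ + t)) (K := 1) (by simp)
      (fun t => ((Real.hasDerivAt_cos (θ + t)).comp_const_add θ t).sub_const _)
      (fun t _ => by rw [abs_neg]; exact Real.abs_sin_le_one _) |>.trans (by simp)

/-- Perturbation of the entrywise sine around the entrywise arcsine of a correlation matrix: the
linear term is the Hadamard multiplier `cos (arcsin S) = 1 - (1 - √(1 - S ^ 2))`, a difference of two
contractive ones, and the quadratic remainder is bounded in Frobenius norm. -/
lemma spectralNorm₂_sin_arcsin_add_sub_le (hS : S.PosSemidef)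
    (hle : ∀ i j, |S i j| ≤ 1) (e : Matrix (Fin d) (Fin d) ℝ) :
    spectralNorm₂ (Matrix.of fun i j => Real.sin (Real.arcsin (S i j) + e i j) - S i j) ≤
      2 * spectralNorm₂ e + √(∑ i, ∑ j, e i j ^ 4) := by
  set M := S.map fun x => 1 - √(1 - x ^ 2) with hM
  set R : Matrix (Fin d) (Fin d) ℝ := Matrix.of fun i j =>
    Real.sin (Real.arcsin (S i j) + e i j) - S i j - √(1 - S i j ^ 2) * e i j with hR
  have hdec : (Matrix.of fun i j => Real.sin (Real.arcsin (S i j) + e i j) - S i j)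
      = e - M.hadamard e + R := by
    ext i j
    simp [hM, hR]
    ring
  have hMn : spectralNorm₂ (M.hadamard e) ≤ spectralNorm₂ e :=
    spectralNorm₂_hadamard_le (posSemidef_map_one_sub_sqrt hS hle)
      (fun j => by simp) e
  have hRn : spectralNorm₂ R ≤ √(∑ i, ∑ j, e i j ^ 4) := by
    refine (spectralNorm₂_le_frobenius R).trans (Real.sqrt_le_sqrt ?_)
    refine Finset.sum_le_sum fun i _ => Finset.sum_le_sum fun j _ => ?_
    have h := abs_sin_add_sub_le (Real.arcsin (S i j)) (e i j)
    have hij := abs_le.1 (hle i j)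
    rw [Real.sin_arcsin hij.1 hij.2, Real.cos_arcsin] at h
    have := pow_le_pow_left₀ (abs_nonneg _) h 2
    rw [sq_abs, ← pow_mul] at this
    simpa [hR] using this
  rw [hdec]
  have h1 := spectralNorm₂_add_le (e - M.hadamard e) R
  have h2 := spectralNorm₂_sub_le e (M.hadamard e)
  linarith

end CosArcsin

/-! ### Sheppard's formula -/

section Sheppard

lemma Real.sign_mul_of_pos {c : ℝ} (hc : 0 < c) (x : ℝ) : Real.sign (c * x) = Real.sign x := by
  rcases lt_trichotomy x 0 with h | rfl | h
  · rw [Real.sign_of_neg h, Real.sign_of_neg (mul_neg_of_pos_of_neg hc h)]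
  · simp
  · rw [Real.sign_of_pos h, Real.sign_of_pos (mul_pos hc h)]

/-- The planar Gaussian integral of a function that is constant on rays is its angular average. -/
lemma integral_gaussian_prod_of_angular {H : ℝ × ℝ → ℝ} {h : ℝ → ℝ}
    (hH : ∀ ρ θ, 0 < ρ → H (ρ * Real.cos θ, ρ * Real.sin θ) = h θ) :
    ∫ p, H p ∂((gaussianReal 0 1).prod (gaussianReal 0 1)) =
      (2 * Real.pi)⁻¹ * ∫ θ in Set.Ioo (-Real.pi) Real.pi, h θ := by
  set K : ℝ → ℝ := fun ρ => ρ * ((2 * Real.pi)⁻¹ * Real.exp (-ρ ^ 2 / 2)) with hK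
  have key : ∀ (H : ℝ × ℝ → ℝ) (h : ℝ → ℝ),
      (∀ ρ θ, 0 < ρ → H (ρ * Real.cos θ, ρ * Real.sin θ) = h θ) →
      ∫ p, H p ∂((gaussianReal 0 1).prod (gaussianReal 0 1)) =
        (∫ ρ in Set.Ioi (0 : ℝ), K ρ) * ∫ θ in Set.Ioo (-Real.pi) Real.pi, h θ := by
    intro H h hH
    rw [gaussianReal_of_var_ne_zero _ one_ne_zero,
      prod_withDensity (measurable_gaussianPDF _ _) (measurable_gaussianPDF _ _),
      integral_withDensity_eq_integral_toReal_smul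
        (f := fun z : ℝ × ℝ => gaussianPDF 0 1 z.1 * gaussianPDF 0 1 z.2)
        (((measurable_gaussianPDF _ _).comp measurable_fst).mul
          ((measurable_gaussianPDF _ _).comp measurable_snd))
        (Filter.Eventually.of_forall fun p => ENNReal.mul_lt_top gaussianPDF_lt_top
          gaussianPDF_lt_top)]
    rw [← Measure.volume_eq_prod, ← integral_comp_polarCoord_symm, polarCoord_target,
      ← setIntegral_prod_mul, ← Measure.volume_eq_prod]
    refine setIntegral_congr_fun (measurableSet_Ioi.prod measurableSet_Ioo) fun p hp => ?_
    have hp1 : 0 < p.1 := hp.1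
    simp only [polarCoord_symm_apply, hH _ _ hp1, ENNReal.toReal_mul, toReal_gaussianPDF,
      gaussianPDFReal, smul_eq_mul, hK]
    have e1 : (√(2 * Real.pi * ((1 : NNReal) : ℝ)))⁻¹ * Real.exp (-(p.1 * Real.cos p.2 - 0) ^ 2 / (2 * ((1 : NNReal) : ℝ))) *
        ((√(2 * Real.pi * ((1 : NNReal) : ℝ)))⁻¹ * Real.exp (-(p.1 * Real.sin p.2 - 0) ^ 2 / (2 * ((1 : NNReal) : ℝ)))) =
        (2 * Real.pi)⁻¹ * Real.exp (-p.1 ^ 2 / 2) := by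
      rw [mul_mul_mul_comm, ← Real.exp_add, ← mul_inv, Real.mul_self_sqrt (by positivity)]
      congr 2
      · simp
      · have := Real.cos_sq_add_sin_sq p.2
        simp only [NNReal.coe_one, mul_one, sub_zero]
        linear_combination -(p.1 ^ 2) / 2 * this
    rw [e1]
    ring
  have h1 := key (fun _ => 1) (fun _ => 1) fun _ _ _ => rfl
  have hpi := Real.pi_pos
  have hK : ∫ ρ in Set.Ioi (0 : ℝ), K ρ = (2 * Real.pi)⁻¹ := by
    simp at h1
    rw [max_eq_left (by positivity)] at h1
    refine eq_inv_of_mul_eq_one_left ?_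
    rw [h1]; ring
  rw [key H h hH, hK]

/-- The signs of `cos θ` and `cos (θ - α)` disagree on two arcs of length `α`. -/
lemma integral_sign_cos_mul_sign_cos_sub {α : ℝ} (h0 : 0 ≤ α) (hπ : α ≤ Real.pi) :
    ∫ θ in Set.Ioo (-Real.pi) Real.pi, Real.sign (Real.cos θ) * Real.sign (Real.cos (θ - α)) =
      2 * (Real.pi - 2 * α) := by
  have hpi := Real.pi_pos
  set h : ℝ → ℝ := fun θ => Real.sign (Real.cos θ) * Real.sign (Real.cos (θ - α)) with hh
  have hm : Measurable h := by
    refine (Real.measurable_sign.comp (by fun_prop)).mul (Real.measurable_sign.comp (by fun_prop))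
  have hb : ∀ θ, |h θ| ≤ 1 := fun θ => by
    simp only [hh, abs_mul]
    exact mul_le_one₀ (Real.abs_sign_le_one _) (abs_nonneg _) (Real.abs_sign_le_one _)
  have hint : ∀ a b, IntervalIntegrable h volume a b := fun a b =>
    (intervalIntegrable_const (c := (1 : ℝ))).mono_fun hm.aestronglyMeasurable
      (Filter.Eventually.of_forall fun θ => by simpa using hb θ)
  have hper : Function.Periodic h Real.pi := fun θ => by
    simp only [hh]
    rw [Real.cos_add_pi, show θ + Real.pi - α = (θ - α) + Real.pi by ring, Real.cos_add_pi,
      Real.sign_neg, Real.sign_neg, neg_mul_neg]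
  have hshift := fun s => hper.intervalIntegral_add_eq s (-(Real.pi / 2))
  have hhalf : ∫ θ in (-(Real.pi / 2))..(-(Real.pi / 2) + Real.pi), h θ = Real.pi - 2 * α := by
    have e1 : ∫ θ in (-(Real.pi / 2))..(α - Real.pi / 2), h θ = -α := by
      have : ∫ θ in (-(Real.pi / 2))..(α - Real.pi / 2), h θ =
          ∫ θ in (-(Real.pi / 2))..(α - Real.pi / 2), (-1 : ℝ) := by
        refine intervalIntegral.integral_congr_Ioo_of_le (by linarith) fun θ hθ => ?_
        have c1 : 0 < Real.cos θ := Real.cos_pos_of_mem_Ioo ⟨hθ.1, by linarith [hθ.2]⟩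
        have c2 : Real.cos (θ - α) < 0 := by
          rw [← Real.cos_neg]
          exact Real.cos_neg_of_pi_div_two_lt_of_lt (by linarith [hθ.2]) (by linarith [hθ.1])
        simp [hh, Real.sign_of_pos c1, Real.sign_of_neg c2]
      rw [this]; simp
    have e2 : ∫ θ in (α - Real.pi / 2)..(-(Real.pi / 2) + Real.pi), h θ = Real.pi - α := by
      have : ∫ θ in (α - Real.pi / 2)..(-(Real.pi / 2) + Real.pi), h θ =
          ∫ θ in (α - Real.pi / 2)..(-(Real.pi / 2) + Real.pi), (1 : ℝ) := by
        refine intervalIntegral.integral_congr_Ioo_of_le (by linarith) fun θ hθ => ?_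
        have c1 : 0 < Real.cos θ :=
          Real.cos_pos_of_mem_Ioo ⟨by linarith [hθ.1], by linarith [hθ.2]⟩
        have c2 : 0 < Real.cos (θ - α) :=
          Real.cos_pos_of_mem_Ioo ⟨by linarith [hθ.1], by linarith [hθ.2]⟩
        simp [hh, Real.sign_of_pos c1, Real.sign_of_pos c2]
      rw [this]; simp; ring
    rw [← intervalIntegral.integral_add_adjacent_intervals (hint _ (α - Real.pi / 2)) (hint _ _),
      e1, e2]
    ring
  rw [← integral_Ioc_eq_integral_Ioo, ← intervalIntegral.integral_of_le (by linarith),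
    ← intervalIntegral.integral_add_adjacent_intervals (hint _ 0) (hint _ _)]
  have s1 := hshift (-Real.pi)
  have s2 := hshift 0
  rw [neg_add_cancel] at s1
  rw [zero_add] at s2
  rw [s1, s2, hhalf]
  ring

/-- Sheppard's formula in a standard form. Writing `r = cos α`, the second argument is
`ρ * cos (θ - α)` in polar coordinates. -/
lemma integral_sign_mul_sign_stdGaussian {r : ℝ} (hr : |r| ≤ 1) :
    ∫ p, Real.sign p.1 * Real.sign (r * p.1 + √(1 - r ^ 2) * p.2)
      ∂((gaussianReal 0 1).prod (gaussianReal 0 1)) = 2 / Real.pi * Real.arcsin r := by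
  have hr' := abs_le.1 hr
  have hpi := Real.pi_pos
  rw [integral_gaussian_prod_of_angular (h := fun θ =>
    Real.sign (Real.cos θ) * Real.sign (Real.cos (θ - Real.arccos r)))]
  · rw [integral_sign_cos_mul_sign_cos_sub (Real.arccos_nonneg r) (Real.arccos_le_pi r),
      Real.arccos]
    field_simp
    ring
  · intro ρ θ hρ
    have e : r * (ρ * Real.cos θ) + √(1 - r ^ 2) * (ρ * Real.sin θ) =
        ρ * Real.cos (θ - Real.arccos r) := by
      rw [Real.cos_sub, Real.cos_arccos hr'.1 hr'.2, Real.sin_arccos]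
      ring
    simp only [e, Real.sign_mul_of_pos hρ]

variable {E F : Type*} [NormedAddCommGroup E] [NormedSpace ℝ E] [MeasurableSpace E] [BorelSpace E]
  [NormedAddCommGroup F] [NormedSpace ℝ F] [MeasurableSpace F] [BorelSpace F]

/-- The joint characteristic function of two centred linear functionals of a Gaussian measure depends
only on their second moments. -/
lemma charFunDual_map_prod_of_isGaussian {μ : Measure E} [IsGaussian μ] (L₁ L₂ : StrongDual ℝ E)
    (h1 : ∫ x, L₁ x ∂μ = 0) (h2 : ∫ x, L₂ x ∂μ = 0) (M : StrongDual ℝ (ℝ × ℝ)) :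
    charFunDual (μ.map (L₁.prod L₂)) M =
      Complex.exp (-(M (1, 0) ^ 2 * (∫ x, L₁ x * L₁ x ∂μ) +
        2 * (M (1, 0) * M (0, 1)) * (∫ x, L₁ x * L₂ x ∂μ) +
        M (0, 1) ^ 2 * (∫ x, L₂ x * L₂ x ∂μ) : ℝ) / 2) := by
  set a := M (1, 0)
  set b := M (0, 1)
  have hM : ∀ x, (M ∘L L₁.prod L₂) x = a * L₁ x + b * L₂ x := fun x => by
    have : (L₁ x, L₂ x) = L₁ x • ((1 : ℝ), (0 : ℝ)) + L₂ x • ((0 : ℝ), (1 : ℝ)) := by simp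
    rw [ContinuousLinearMap.comp_apply, ContinuousLinearMap.prod_apply, this, map_add, map_smul,
      map_smul, smul_eq_mul, smul_eq_mul]
    ring
  have i1 := IsGaussian.memLp_dual μ L₁ 2 (by simp)
  have i2 := IsGaussian.memLp_dual μ L₂ 2 (by simp)
  have j1 : Integrable (fun x => a * L₁ x) μ := (i1.integrable (by norm_num)).const_mul a
  have j2 : Integrable (fun x => b * L₂ x) μ := (i2.integrable (by norm_num)).const_mul b
  have hmean : ∫ x, (M ∘L L₁.prod L₂) x ∂μ = 0 := by
    simp_rw [hM]
    rw [integral_add j1 j2, integral_const_mul, integral_const_mul, h1, h2]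
    simp
  have k11 : Integrable (fun x => L₁ x * L₁ x) μ := i1.integrable_mul i1
  have k12 : Integrable (fun x => L₁ x * L₂ x) μ := i1.integrable_mul i2
  have k22 : Integrable (fun x => L₂ x * L₂ x) μ := i2.integrable_mul i2
  have hvar : Var[(M ∘L L₁.prod L₂ : StrongDual ℝ E); μ] = a ^ 2 * (∫ x, L₁ x * L₁ x ∂μ) +
        2 * (a * b) * (∫ x, L₁ x * L₂ x ∂μ) + b ^ 2 * (∫ x, L₂ x * L₂ x ∂μ) := by
    rw [variance_eq_integral (ContinuousLinearMap.continuous _).aemeasurable, hmean]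
    have : ∀ x, ((M ∘L L₁.prod L₂) x - 0) ^ 2 =
        a ^ 2 * (L₁ x * L₁ x) + 2 * (a * b) * (L₁ x * L₂ x) + b ^ 2 * (L₂ x * L₂ x) := fun x => by
      rw [hM]; ring
    simp_rw [this]
    have l1 : Integrable (fun x => a ^ 2 * (L₁ x * L₁ x) + 2 * (a * b) * (L₁ x * L₂ x)) μ :=
      (k11.const_mul _).add (k12.const_mul _)
    rw [integral_add l1 (k22.const_mul _), integral_add (k11.const_mul _) (k12.const_mul _),
      integral_const_mul, integral_const_mul, integral_const_mul]
  rw [charFunDual_map, IsGaussian.charFunDual_eq, hvar, integral_complex_ofReal, hmean]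
  congr 1
  push_cast
  ring

/-- Two pairs of centred linear functionals of Gaussian measures with the same second moments have the
same joint law. This transfers Sheppard's formula from the standard Gaussian plane. -/
lemma map_prod_eq_of_isGaussian {μ : Measure E} [IsGaussian μ] {ν : Measure F} [IsGaussian ν]
    {L₁ L₂ : StrongDual ℝ E} {K₁ K₂ : StrongDual ℝ F}
    (h1 : ∫ x, L₁ x ∂μ = 0) (h2 : ∫ x, L₂ x ∂μ = 0)
    (h1' : ∫ x, K₁ x ∂ν = 0) (h2' : ∫ x, K₂ x ∂ν = 0)
    (h11 : ∫ x, L₁ x * L₁ x ∂μ = ∫ x, K₁ x * K₁ x ∂ν)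
    (h12 : ∫ x, L₁ x * L₂ x ∂μ = ∫ x, K₁ x * K₂ x ∂ν)
    (h22 : ∫ x, L₂ x * L₂ x ∂μ = ∫ x, K₂ x * K₂ x ∂ν) :
    μ.map (L₁.prod L₂) = ν.map (K₁.prod K₂) := by
  have := Measure.isProbabilityMeasure_map (μ := μ)
    (L₁.prod L₂).continuous.aemeasurable
  have := Measure.isProbabilityMeasure_map (μ := ν)
    (K₁.prod K₂).continuous.aemeasurable
  apply Measure.ext_of_charFunDual
  ext M
  rw [charFunDual_map_prod_of_isGaussian L₁ L₂ h1 h2, charFunDual_map_prod_of_isGaussian K₁ K₂ h1' h2',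
    h11, h12, h22]

/-- **Sheppard's formula**: the correlation of the signs of two centred jointly Gaussian variables
with common variance `s` and correlation `r` is `2 / π * arcsin r`. -/
theorem integral_sign_mul_sign_of_isGaussian {μ : Measure E} [IsGaussian μ]
    {L₁ L₂ : StrongDual ℝ E} {s r : ℝ} (hs : 0 < s) (hr : |r| ≤ 1)
    (h1 : ∫ x, L₁ x ∂μ = 0) (h2 : ∫ x, L₂ x ∂μ = 0)
    (h11 : ∫ x, L₁ x * L₁ x ∂μ = s) (h22 : ∫ x, L₂ x * L₂ x ∂μ = s)
    (h12 : ∫ x, L₁ x * L₂ x ∂μ = s * r) :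
    ∫ x, Real.sign (L₁ x) * Real.sign (L₂ x) ∂μ = 2 / Real.pi * Real.arcsin r := by
  set ν := (gaussianReal 0 1).prod (gaussianReal 0 1) with hν
  set K₁ : StrongDual ℝ (ℝ × ℝ) := √s • ContinuousLinearMap.fst ℝ ℝ ℝ with hK₁
  set K₂ : StrongDual ℝ (ℝ × ℝ) := √s • (r • ContinuousLinearMap.fst ℝ ℝ ℝ +
    √(1 - r ^ 2) • ContinuousLinearMap.snd ℝ ℝ ℝ) with hK₂
  have hss : √s * √s = s := Real.mul_self_sqrt hs.le
  have hr2 : r ^ 2 ≤ 1 := (sq_le_one_iff_abs_le_one r).2 hr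
  have hrr : √(1 - r ^ 2) * √(1 - r ^ 2) = 1 - r ^ 2 := Real.mul_self_sqrt (by linarith)
  have m0 : ∫ z, z ∂gaussianReal 0 1 = 0 := by simp
  have m2 : ∫ z, z * z ∂gaussianReal 0 1 = 1 := by
    have := variance_fun_id_gaussianReal (μ := 0) (v := 1)
    rw [variance_eq_integral (by fun_prop)] at this
    simpa [← sq] using this
  have f1 : ∫ p : ℝ × ℝ, p.1 ∂ν = 0 := by
    rw [hν, integral_fun_fst (fun z : ℝ => z), m0]; simp
  have f2 : ∫ p : ℝ × ℝ, p.2 ∂ν = 0 := by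
    rw [hν, integral_fun_snd (fun z : ℝ => z), m0]; simp
  have f11 : ∫ p : ℝ × ℝ, p.1 * p.1 ∂ν = 1 := by
    rw [hν, integral_fun_fst (fun z : ℝ => z * z), m2]; simp
  have f22 : ∫ p : ℝ × ℝ, p.2 * p.2 ∂ν = 1 := by
    rw [hν, integral_fun_snd (fun z : ℝ => z * z), m2]; simp
  have f12 : ∫ p : ℝ × ℝ, p.1 * p.2 ∂ν = 0 := by
    rw [hν, integral_prod_mul (fun z : ℝ => z) (fun z : ℝ => z), m0, zero_mul]
  have i1 : MemLp (fun p : ℝ × ℝ => p.1) 2 ν :=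
    IsGaussian.memLp_dual ν (ContinuousLinearMap.fst ℝ ℝ ℝ) 2 (by simp)
  have i2 : MemLp (fun p : ℝ × ℝ => p.2) 2 ν :=
    IsGaussian.memLp_dual ν (ContinuousLinearMap.snd ℝ ℝ ℝ) 2 (by simp)
  have j1 := i1.integrable (by norm_num : (1 : ENNReal) ≤ 2)
  have j2 := i2.integrable (by norm_num : (1 : ENNReal) ≤ 2)
  have k11 : Integrable (fun p : ℝ × ℝ => p.1 * p.1) ν := i1.integrable_mul i1
  have k12 : Integrable (fun p : ℝ × ℝ => p.1 * p.2) ν := i1.integrable_mul i2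
  have k22 : Integrable (fun p : ℝ × ℝ => p.2 * p.2) ν := i2.integrable_mul i2
  have hq : ∀ a b c : ℝ, ∫ p : ℝ × ℝ, (a * (p.1 * p.1) + b * (p.1 * p.2) + c * (p.2 * p.2)) ∂ν
      = a + c := fun a b c => by
    have l1 : Integrable (fun p : ℝ × ℝ => a * (p.1 * p.1) + b * (p.1 * p.2)) ν :=
      (k11.const_mul _).add (k12.const_mul _)
    rw [integral_add l1 (k22.const_mul _), integral_add (k11.const_mul _) (k12.const_mul _),
      integral_const_mul, integral_const_mul, integral_const_mul, f11, f12, f22]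
    ring
  have hK1 : ∀ p, K₁ p = √s * p.1 := fun p => by simp [hK₁]
  have hK2 : ∀ p, K₂ p = √s * (r * p.1 + √(1 - r ^ 2) * p.2) := fun p => by simp [hK₂]; ring
  have hmap : μ.map (L₁.prod L₂) = ν.map (K₁.prod K₂) := by
    refine map_prod_eq_of_isGaussian h1 h2 ?_ ?_ ?_ ?_ ?_
    · simp_rw [hK1]; rw [integral_const_mul, f1, mul_zero]
    · simp_rw [hK2]
      rw [integral_const_mul, integral_add (j1.const_mul _) (j2.const_mul _), integral_const_mul,
        integral_const_mul, f1, f2]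
      simp
    · rw [h11]
      simp_rw [hK1]
      have : ∀ p : ℝ × ℝ, √s * p.1 * (√s * p.1) = s * (p.1 * p.1) + 0 * (p.1 * p.2)
          + 0 * (p.2 * p.2) := fun p => by linear_combination (p.1 * p.1) * hss
      simp_rw [this]
      rw [hq]; ring
    · rw [h12]
      simp_rw [hK1, hK2]
      have : ∀ p : ℝ × ℝ, √s * p.1 * (√s * (r * p.1 + √(1 - r ^ 2) * p.2)) =
          (s * r) * (p.1 * p.1) + (s * √(1 - r ^ 2)) * (p.1 * p.2) + 0 * (p.2 * p.2) := fun p => by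
        linear_combination (p.1 * (r * p.1 + √(1 - r ^ 2) * p.2)) * hss
      simp_rw [this]
      rw [hq]; ring
    · rw [h22]
      simp_rw [hK2]
      have : ∀ p : ℝ × ℝ, √s * (r * p.1 + √(1 - r ^ 2) * p.2) *
          (√s * (r * p.1 + √(1 - r ^ 2) * p.2)) =
          (s * r ^ 2) * (p.1 * p.1) + (2 * s * r * √(1 - r ^ 2)) * (p.1 * p.2) +
            (s * (1 - r ^ 2)) * (p.2 * p.2) := fun p => by
        linear_combination ((r * p.1 + √(1 - r ^ 2) * p.2) ^ 2) * hss + s * p.2 ^ 2 * hrr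
      simp_rw [this]
      rw [hq]; ring
  set G : ℝ × ℝ → ℝ := fun p => Real.sign p.1 * Real.sign p.2 with hG
  have hGm : Measurable G :=
    (Real.measurable_sign.comp measurable_fst).mul (Real.measurable_sign.comp measurable_snd)
  have e1 : ∫ x, Real.sign (L₁ x) * Real.sign (L₂ x) ∂μ = ∫ p, G p ∂(μ.map (L₁.prod L₂)) := by
    rw [integral_map (L₁.prod L₂).continuous.aemeasurable hGm.aestronglyMeasurable]
    rfl
  rw [e1, hmap, integral_map (K₁.prod K₂).continuous.aemeasurable hGm.aestronglyMeasurable,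
    ← integral_sign_mul_sign_stdGaussian hr]
  refine integral_congr_ae (Filter.Eventually.of_forall fun p => ?_)
  simp only [hG, ContinuousLinearMap.prod_apply, hK1, hK2,
    Real.sign_mul_of_pos (Real.sqrt_pos.2 hs)]

end Sheppard

/-! ### U-statistics and Hoeffding's decomposition -/

/-- The average of `F` over all injections `Fin r ↪ α`: the U-statistic of order `r` whose kernel
takes the value `F τ` at the ordered subsample `τ`. -/
noncomputable def embeddingAverage {α : Type*} [Fintype α] [DecidableEq α] {r : ℕ}
    (F : (Fin r ↪ α) → ℝ) : ℝ :=
  (∑ τ, F τ) / Fintype.card (Fin r ↪ α)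

/-- Because permutations act transitively on injections, the average over all injections is the
average over the permutations of any single one. -/
lemma embeddingAverage_eq_sum_perm {α : Type*} [Fintype α] [DecidableEq α] {r : ℕ}
    (F : (Fin r ↪ α) → ℝ) (τ : Fin r ↪ α) :
    embeddingAverage F =
      (∑ π : Equiv.Perm α, F (τ.trans π.toEmbedding)) / Fintype.card (Equiv.Perm α) := by
  have hconst : ∀ τ' : Fin r ↪ α, ∑ π : Equiv.Perm α, F (τ'.trans π.toEmbedding) =
      ∑ π : Equiv.Perm α, F (τ.trans π.toEmbedding) := by
    intro τ'
    obtain ⟨σ, hσ⟩ := Equiv.Perm.exists_extending_pair τ τ' τ.injective τ'.injective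
    refine Fintype.sum_equiv (Equiv.mulRight σ) _ _ fun π => ?_
    congr 1
    ext a
    simp [hσ]
  have hswap : ∑ τ' : Fin r ↪ α, ∑ π : Equiv.Perm α, F (τ'.trans π.toEmbedding) =
      Fintype.card (Equiv.Perm α) * ∑ τ', F τ' := by
    rw [Finset.sum_comm]
    have : ∀ π : Equiv.Perm α, ∑ τ' : Fin r ↪ α, F (τ'.trans π.toEmbedding) = ∑ τ', F τ' := by
      intro π
      refine Fintype.sum_equiv (Equiv.embeddingCongr (Equiv.refl _) π) _ _ fun τ' => ?_
      congr 1
    simp [this]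
  rw [Finset.sum_congr rfl fun τ' _ => hconst τ'] at hswap
  simp only [Finset.sum_const, Finset.card_univ, nsmul_eq_mul] at hswap
  have h1 : (Fintype.card (Equiv.Perm α) : ℝ) ≠ 0 := by
    exact_mod_cast Fintype.card_ne_zero
  have h2 : (Fintype.card (Fin r ↪ α) : ℝ) ≠ 0 := by
    have : Nonempty (Fin r ↪ α) := ⟨τ⟩
    exact_mod_cast Fintype.card_ne_zero
  rw [embeddingAverage, div_eq_div_iff h2 h1]
  linarith

lemma embeddingAverage_add {α : Type*} [Fintype α] [DecidableEq α] {r : ℕ}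
    (F G : (Fin r ↪ α) → ℝ) :
    embeddingAverage (fun τ => F τ + G τ) = embeddingAverage F + embeddingAverage G := by
  simp [embeddingAverage, Finset.sum_add_distrib, add_div]

lemma embeddingAverage_mul_left {α : Type*} [Fintype α] [DecidableEq α] {r : ℕ}
    (c : ℝ) (F : (Fin r ↪ α) → ℝ) :
    embeddingAverage (fun τ => c * F τ) = c * embeddingAverage F := by
  simp [embeddingAverage, ← Finset.mul_sum, mul_div_assoc]

lemma embeddingAverage_sum {α ι : Type*} [Fintype α] [DecidableEq α] {r : ℕ} (s : Finset ι)
    (F : ι → (Fin r ↪ α) → ℝ) :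
    embeddingAverage (fun τ => ∑ i ∈ s, F i τ) = ∑ i ∈ s, embeddingAverage (F i) := by
  simp only [embeddingAverage]
  rw [Finset.sum_comm, Finset.sum_div]

lemma embeddingAverage_const {α : Type*} [Fintype α] [DecidableEq α] {r : ℕ}
    [Nonempty (Fin r ↪ α)] (c : ℝ) :
    embeddingAverage (fun _ : Fin r ↪ α => c) = c := by
  have h2 : (Fintype.card (Fin r ↪ α) : ℝ) ≠ 0 := by
    exact_mod_cast Fintype.card_ne_zero
  rw [embeddingAverage, Finset.sum_const, Finset.card_univ, nsmul_eq_mul,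
    mul_div_cancel_left₀ _ h2]

lemma abs_embeddingAverage_le {α : Type*} [Fintype α] [DecidableEq α] {r : ℕ}
    {F : (Fin r ↪ α) → ℝ} {C : ℝ} (hC : 0 ≤ C) (hF : ∀ τ, |F τ| ≤ C) :
    |embeddingAverage F| ≤ C := by
  rw [embeddingAverage, abs_div, Nat.abs_cast]
  refine div_le_of_le_mul₀ (by positivity) hC ?_
  refine (Finset.abs_sum_le_sum_abs _ _).trans ?_
  refine (Finset.sum_le_sum fun τ _ => hF τ).trans ?_
  simp [mul_comm]

/-- Functions of disjoint blocks of an independent sample are independent, hence the expectation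
of their product factorizes. -/
lemma integral_prod_blocks {Ω V : Type*} [MeasurableSpace Ω] [MeasurableSpace V] {P : Measure Ω}
    {μ : Measure V} [IsProbabilityMeasure μ] {m r : ℕ} {X : Fin m × Fin r → Ω → V}
    (hlaw : ∀ p, HasLaw (X p) μ P) (hind : iIndepFun X P) {g : (Fin r → V) → ℝ}
    (hg : Measurable g) :
    ∫ ω, ∏ b : Fin m, g (fun j => X (b, j) ω) ∂P =
      (∫ x, g x ∂Measure.pi fun _ : Fin r => μ) ^ m := by
  have hP : P.map (fun ω p => X p ω) = Measure.pi fun _ : Fin m × Fin r => μ :=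
    (iIndepFun.hasLaw_pi (μ := fun _ : Fin m × Fin r => μ) hlaw hind).map_eq
  set Q : Measure (Fin m → Fin r → V) := Measure.pi fun _ : Fin m => Measure.pi fun _ : Fin r => μ
    with hQ
  have hQind : iIndepFun (fun (p : Fin m × Fin r) (y : Fin m → Fin r → V) => y p.1 p.2) Q := by
    have := iIndepFun_uncurry_infinitePi' (Ω := fun (_ : Fin m) (_ : Fin r) => V)
      (X := fun _ _ => id) (μ := fun (_ : Fin m) (_ : Fin r) => μ) (fun _ _ => measurable_id)
    simpa [Measure.infinitePi_eq_pi, hQ] using this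
  have hQlaw : ∀ p : Fin m × Fin r,
      HasLaw (fun y : Fin m → Fin r → V => y p.1 p.2) μ Q := by
    intro p
    refine ⟨((measurable_pi_apply p.2).comp (measurable_pi_apply p.1)).aemeasurable, ?_⟩
    have h1 := (measurePreserving_eval (fun _ : Fin m => Measure.pi fun _ : Fin r => μ) p.1).map_eq
    have h2 := (measurePreserving_eval (fun _ : Fin r => μ) p.2).map_eq
    rw [← h2]
    conv_rhs => rw [← h1]
    rw [Measure.map_map (measurable_pi_apply _) (measurable_pi_apply _)]
    rfl
  have hQmap : Q.map (fun y (p : Fin m × Fin r) => y p.1 p.2) =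
      Measure.pi fun _ : Fin m × Fin r => μ :=
    (iIndepFun.hasLaw_pi (μ := fun _ : Fin m × Fin r => μ) hQlaw hQind).map_eq
  have hG : Measurable fun z : Fin m × Fin r → V => ∏ b : Fin m, g (fun j => z (b, j)) := by
    refine Finset.measurable_prod _ fun b _ => hg.comp ?_
    fun_prop
  have e1 : ∫ ω, ∏ b : Fin m, g (fun j => X (b, j) ω) ∂P =
      ∫ z, ∏ b : Fin m, g (fun j => z (b, j)) ∂Measure.pi fun _ : Fin m × Fin r => μ := by
    rw [← hP, integral_map]
    · exact aemeasurable_pi_lambda _ fun p => (hlaw p).aemeasurable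
    · exact hG.aestronglyMeasurable
  have e2 : ∫ y, ∏ b : Fin m, g (y b) ∂Q =
      ∫ z, ∏ b : Fin m, g (fun j => z (b, j)) ∂Measure.pi fun _ : Fin m × Fin r => μ := by
    rw [← hQmap, integral_map]
    · exact aemeasurable_pi_lambda _ fun p =>
        ((measurable_pi_apply p.2).comp (measurable_pi_apply p.1)).aemeasurable
    · exact hG.aestronglyMeasurable
  rw [e1, ← e2, hQ, integral_fintype_prod_eq_prod (fun (_ : Fin m) (y : Fin r → V) => g y)]
  simp

/-- Hoeffding's decomposition: a U-statistic of order `r` is an average, over the permutations of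
the sample, of averages over `m` disjoint blocks of length `r`. By convexity its moment generating
function is at most that of an average of `m` independent copies of the kernel. -/
theorem integral_exp_embeddingAverage_le {Ω V : Type*} [MeasurableSpace Ω] [MeasurableSpace V]
    {P : Measure Ω} [IsProbabilityMeasure P] {μ : Measure V} [IsProbabilityMeasure μ] {n m r : ℕ}
    (hm : 0 < m) (hmr : m * r ≤ n) {X : Fin n → Ω → V}
    (hlaw : ∀ i, HasLaw (X i) μ P) (hind : iIndepFun X P) {h : (Fin r → V) → ℝ}
    (hh : Measurable h) {C : ℝ} (hC : ∀ x, |h x| ≤ C) (t : ℝ) :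
    ∫ ω, Real.exp (t * embeddingAverage fun τ : Fin r ↪ Fin n => h fun j => X (τ j) ω) ∂P ≤
      (∫ x, Real.exp (t / m * h x) ∂Measure.pi fun _ : Fin r => μ) ^ m := by
  classical
  have hm' : (m : ℝ) ≠ 0 := by exact_mod_cast hm.ne'
  let T : Fin m × Fin r ↪ Fin n := finProdFinEquiv.toEmbedding.trans (Fin.castLEEmb hmr)
  let T' : Fin m → (Fin r ↪ Fin n) := fun b =>
    ⟨fun j => T (b, j), fun i j hij => by simpa using T.injective hij⟩
  let N : ℝ := Fintype.card (Equiv.Perm (Fin n))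
  have hN : 0 < N := by
    exact Nat.cast_pos.2 Fintype.card_pos
  let B : Equiv.Perm (Fin n) → Ω → ℝ := fun π ω =>
    ∏ b : Fin m, Real.exp (t / m * h fun j => X (π (T (b, j))) ω)
  have hB : ∀ π, ∫ ω, B π ω ∂P =
      (∫ x, Real.exp (t / m * h x) ∂Measure.pi fun _ : Fin r => μ) ^ m := by
    intro π
    have hinj : Function.Injective fun p => π (T p) := π.injective.comp T.injective
    exact integral_prod_blocks (X := fun p => X (π (T p))) (fun p => hlaw _)
      (hind.precomp hinj) (g := fun x => Real.exp (t / m * h x)) (by fun_prop)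
  have hF : ∀ τ : Fin r ↪ Fin n, AEMeasurable (fun ω => h fun j => X (τ j) ω) P := fun τ =>
    hh.comp_aemeasurable (aemeasurable_pi_lambda _ fun j => (hlaw _).aemeasurable)
  have hBm : ∀ π, Integrable (B π) P := by
    intro π
    refine integrable_of_bounded_comp ?_ (∏ b : Fin m, Real.exp (|t / m| * C)) ?_
    · refine AEMeasurable.aestronglyMeasurable ?_
      refine Finset.aemeasurable_fun_prod _ fun b _ => ?_
      have := hF ((T' b).trans π.toEmbedding)
      exact Real.measurable_exp.comp_aemeasurable (this.const_mul _)
    · intro ω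
      rw [Finset.abs_prod]
      refine Finset.prod_le_prod (fun _ _ => abs_nonneg _) fun b _ => ?_
      rw [Real.abs_exp, Real.exp_le_exp]
      refine (le_abs_self _).trans ?_
      rw [abs_mul]
      exact mul_le_mul_of_nonneg_left (hC _) (abs_nonneg _)
  have hpt : ∀ ω, Real.exp (t * embeddingAverage fun τ : Fin r ↪ Fin n => h fun j => X (τ j) ω) ≤
      (∑ π, B π ω) / N := by
    intro ω
    set F : (Fin r ↪ Fin n) → ℝ := fun τ => h fun j => X (τ j) ω with hFdef
    have h1 : embeddingAverage F = ∑ π : Equiv.Perm (Fin n), (1 / N) *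
        ((∑ b : Fin m, F ((T' b).trans π.toEmbedding)) / m) := by
      have : ∑ b : Fin m, embeddingAverage F = m * embeddingAverage F := by simp
      have h2 : embeddingAverage F = (∑ b : Fin m, embeddingAverage F) / m := by
        rw [this]; field_simp
      rw [h2, Finset.sum_congr rfl fun b _ => embeddingAverage_eq_sum_perm F (T' b),
        ← Finset.sum_div, Finset.sum_comm, ← Finset.mul_sum, ← Finset.sum_div]
      change _ / N / _ = _
      ring
    have h3 := convexOn_exp.map_sum_le (t := Finset.univ) (w := fun _ : Equiv.Perm (Fin n) => 1 / N)
      (p := fun π => t * ((∑ b : Fin m, F ((T' b).trans π.toEmbedding)) / m))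
      (fun _ _ => by positivity)
      (by rw [Finset.sum_const, Finset.card_univ, nsmul_eq_mul]; exact mul_one_div_cancel hN.ne')
      (fun _ _ => Set.mem_univ _)
    simp only [smul_eq_mul] at h3
    have h4 : t * embeddingAverage F = ∑ π : Equiv.Perm (Fin n), (1 / N) *
        (t * ((∑ b : Fin m, F ((T' b).trans π.toEmbedding)) / m)) := by
      rw [h1, Finset.mul_sum]
      exact Finset.sum_congr rfl fun π _ => by ring
    rw [h4]
    refine h3.trans_eq ?_
    rw [← Finset.mul_sum, one_div_mul_eq_div]
    congr 1
    refine Finset.sum_congr rfl fun π _ => ?_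
    change _ = ∏ b : Fin m, Real.exp (t / m * F ((T' b).trans π.toEmbedding))
    rw [← Real.exp_sum, ← Finset.mul_sum]
    congr 1
    ring
  calc _ ≤ ∫ ω, (∑ π, B π ω) / N ∂P := by
        refine integral_mono_of_nonneg (.of_forall fun _ => (Real.exp_pos _).le) ?_
          (.of_forall hpt)
        exact (integrable_finsetSum _ fun π _ => hBm π).div_const _
    _ = _ := by
        rw [integral_div, integral_finsetSum _ fun π _ => hBm π, Finset.sum_congr rfl fun π _ => hB π,
          Finset.sum_const, Finset.card_univ, nsmul_eq_mul]
        exact mul_div_cancel_left₀ _ hN.ne'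

/-! ### Products of sub-Gaussian variables -/

lemma integrable_exp_sq_div_four_gaussianReal :
    Integrable (fun g : ℝ => Real.exp (g ^ 2 / 4)) (gaussianReal 0 1) ∧
      ∫ g, Real.exp (g ^ 2 / 4) ∂gaussianReal 0 1 ≤ 2 := by
  have hpdf : ∀ x : ℝ, gaussianPDFReal 0 1 x * Real.exp (x ^ 2 / 4) =
      (√(2 * Real.pi))⁻¹ * Real.exp (-(1 / 4) * x ^ 2) := by
    intro x
    rw [gaussianPDFReal, mul_assoc, ← Real.exp_add]
    congr 2
    · norm_num
    · simp; ring
  constructor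
  · rw [gaussianReal_of_var_ne_zero _ one_ne_zero,
      integrable_withDensity_iff (measurable_gaussianPDF 0 1)
        (.of_forall fun _ => gaussianPDF_lt_top)]
    simp only [toReal_gaussianPDF]
    refine ((integrable_exp_neg_mul_sq (b := 1 / 4) (by norm_num)).const_mul
      (√(2 * Real.pi))⁻¹).congr (.of_forall fun x => ?_)
    exact (hpdf x).symm.trans (mul_comm _ _)
  · rw [integral_gaussianReal_eq_integral_smul one_ne_zero]
    simp only [smul_eq_mul, hpdf]
    rw [integral_const_mul, integral_gaussian]
    rw [← Real.sqrt_inv, ← Real.sqrt_mul (by positivity)]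
    rw [Real.sqrt_le_left (by norm_num)]
    field_simp
    norm_num

/-- The square of a sub-Gaussian variable has an exponential moment. Averaging the moment
generating function over a Gaussian parameter turns it into the exponential of the square. -/
lemma integral_exp_sq_le_of_subgaussian {E : Type*} [MeasurableSpace E] {ν : Measure E}
    [IsProbabilityMeasure ν] {a : E → ℝ} (ha : Measurable a) {M : ℝ} (hM : ∀ x, |a x| ≤ M)
    {L : ℝ} (hL : 0 < L) (hsub : ∀ t, ∫ x, Real.exp (t * a x) ∂ν ≤ Real.exp (L * t ^ 2 / 2)) :
    ∫ x, Real.exp (a x ^ 2 / (4 * L)) ∂ν ≤ 2 := by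
  set s : ℝ := √(1 / (2 * L)) with hs
  have hs2 : s ^ 2 = 1 / (2 * L) := Real.sq_sqrt (by positivity)
  set γ := gaussianReal 0 1
  have e1 : ∀ x, Real.exp (a x ^ 2 / (4 * L)) = ∫ g, Real.exp (s * a x * g) ∂γ := by
    intro x
    have := mgf_gaussianReal (X := id) (p := γ) (μ := 0) (v := 1) (by simp [γ]) (s * a x)
    rw [mgf] at this
    simp only [id] at this
    rw [this]
    congr 1
    rw [mul_pow, hs2]
    simp
    field_simp
    norm_num
  have hint : Integrable (fun p : E × ℝ => Real.exp (s * a p.1 * p.2)) (ν.prod γ) := by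
    have h1 : Integrable (fun p : E × ℝ => Real.exp (s * M * p.2) + Real.exp (-(s * M) * p.2))
        (ν.prod γ) :=
      ((integrable_exp_mul_gaussianReal (μ := 0) (v := 1) (s * M)).add
        (integrable_exp_mul_gaussianReal (μ := 0) (v := 1) (-(s * M)))).comp_snd ν
    refine h1.mono' (by fun_prop) (.of_forall fun p => ?_)
    rw [Real.norm_eq_abs, Real.abs_exp]
    have hs0 : 0 ≤ s := Real.sqrt_nonneg _
    have hab := abs_le.1 (hM p.1)
    have h3 : s * a p.1 * p.2 ≤ |s * M * p.2| := by
      refine (le_abs_self _).trans ?_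
      rw [abs_mul, abs_mul, abs_mul, abs_mul]
      have := (hM p.1).trans (le_abs_self M)
      gcongr
    rcases le_or_gt 0 (s * M * p.2) with h | h
    · rw [abs_of_nonneg h] at h3
      have := Real.exp_le_exp.2 h3
      have := Real.exp_pos (-(s * M) * p.2)
      linarith
    · rw [abs_of_neg h] at h3
      have := Real.exp_le_exp.2 h3
      have := Real.exp_pos (s * M * p.2)
      have e : -(s * M) * p.2 = -(s * M * p.2) := by ring
      rw [e]
      linarith
  simp only [e1]
  rw [integral_integral_swap (f := fun x g => Real.exp (s * a x * g)) hint]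
  refine (integral_mono_of_nonneg (.of_forall fun g => integral_nonneg fun _ =>
    (Real.exp_pos _).le) integrable_exp_sq_div_four_gaussianReal.1
    (.of_forall fun g => ?_)).trans integrable_exp_sq_div_four_gaussianReal.2
  have := hsub (s * g)
  have e2 : L * (s * g) ^ 2 / 2 = g ^ 2 / 4 := by
    rw [mul_pow, hs2]; field_simp; ring
  rw [e2] at this
  refine le_trans (le_of_eq ?_) this
  refine integral_congr_ae (.of_forall fun x => ?_)
  change Real.exp (s * a x * g) = Real.exp (s * g * a x)
  ring_nf

/-- The second-order Taylor bound for the exponential that only involves `exp |w|`. -/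
lemma exp_mul_le_one_add {μ w : ℝ} (hμ : |μ| ≤ 1 / 2) :
    Real.exp (μ * w) ≤ 1 + μ * w + 8 * μ ^ 2 * Real.exp |w| := by
  have h1 : ∀ x : ℝ, Real.exp x ≤ 1 + x + x ^ 2 * Real.exp |x| := by
    intro x
    have h := Complex.norm_exp_sub_sum_le_norm_mul_exp (x : ℂ) 2
    have h2 : Complex.exp x - ∑ m ∈ Finset.range 2, (x : ℂ) ^ m / (m.factorial : ℂ)
        = ((Real.exp x - (1 + x) : ℝ) : ℂ) := by
      simp [Finset.sum_range_succ]
    rw [h2, Complex.norm_real, Complex.norm_real, Real.norm_eq_abs, Real.norm_eq_abs,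
      sq_abs] at h
    linarith [le_abs_self (Real.exp x - (1 + x))]
  have h2 : w ^ 2 / 8 ≤ Real.exp (|w| / 2) := by
    have := Real.quadratic_le_exp_of_nonneg (x := |w| / 2) (by positivity)
    have h3 := sq_abs w
    nlinarith [abs_nonneg w]
  have h3 : Real.exp |μ * w| ≤ Real.exp (|w| / 2) := by
    rw [Real.exp_le_exp, abs_mul]
    nlinarith [abs_nonneg w]
  have h4 : Real.exp |w| = Real.exp (|w| / 2) * Real.exp (|w| / 2) := by
    rw [← Real.exp_add]; ring_nf
  refine (h1 _).trans ?_
  rw [h4]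
  have h5 : (μ * w) ^ 2 * Real.exp |μ * w| ≤
      8 * μ ^ 2 * (Real.exp (|w| / 2) * Real.exp (|w| / 2)) := by
    have e : (μ * w) ^ 2 = 8 * μ ^ 2 * (w ^ 2 / 8) := by ring
    rw [e, mul_assoc (8 * μ ^ 2)]
    gcongr
  linarith

/-- A product of two sub-Gaussian variables is sub-exponential: the scaled product is dominated by
the sum of the two squares, which have exponential moments. -/
lemma integral_exp_mul_sub_le_of_subgaussian {E : Type*} [MeasurableSpace E] {ν : Measure E}
    [IsProbabilityMeasure ν] {a b : E → ℝ} (ha : Measurable a) (hb : Measurable b) {M : ℝ}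
    (hMa : ∀ x, |a x| ≤ M) (hMb : ∀ x, |b x| ≤ M) {L : ℝ} (hL : 0 < L)
    (hsuba : ∀ t, ∫ x, Real.exp (t * a x) ∂ν ≤ Real.exp (L * t ^ 2 / 2))
    (hsubb : ∀ t, ∫ x, Real.exp (t * b x) ∂ν ≤ Real.exp (L * t ^ 2 / 2))
    {t : ℝ} (ht : |t| ≤ 1 / (8 * L)) :
    ∫ x, Real.exp (t * (a x * b x - ∫ y, a y * b y ∂ν)) ∂ν ≤
      Real.exp (256 * L ^ 2 * t ^ 2) := by
  set w : E → ℝ := fun x => a x * b x / (4 * L) with hw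
  set μ := 4 * L * t with hμdef
  have hμ : |μ| ≤ 1 / 2 := by
    rw [hμdef, abs_mul, abs_of_pos (by positivity : 0 < 4 * L)]
    calc 4 * L * |t| ≤ 4 * L * (1 / (8 * L)) := by gcongr
      _ = 1 / 2 := by field_simp; norm_num
  have hexpand : ∀ x, t * (a x * b x) = μ * w x := by
    intro x; simp only [hw, hμdef]; field_simp
  have hM0 : 0 ≤ M := by
    obtain ⟨x⟩ := nonempty_of_isProbabilityMeasure ν
    exact (abs_nonneg _).trans (hMa x)
  have hwm : Measurable w := by fun_prop
  have hwb : ∀ x, |w x| ≤ M * M / (4 * L) := by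
    intro x
    simp only [hw]
    rw [abs_div, abs_mul, abs_of_pos (by positivity : 0 < 4 * L)]
    gcongr
    · exact hMa x
    · exact hMb x
  have hwi : Integrable w ν := integrable_of_bounded_comp hwm.aestronglyMeasurable _ hwb
  have hei : ∀ {f : E → ℝ} (_ : Measurable f) (K : ℝ) (_ : ∀ x, |f x| ≤ K),
      Integrable (fun x => Real.exp (f x)) ν := by
    intro f hf K hK
    refine integrable_of_bounded_comp (Real.measurable_exp.comp hf).aestronglyMeasurable
      (Real.exp K) fun x => ?_
    rw [Real.abs_exp, Real.exp_le_exp]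
    exact (le_abs_self _).trans (hK x)
  have hsq : ∀ {f : E → ℝ} (_ : Measurable f) (_ : ∀ x, |f x| ≤ M),
      Integrable (fun x => Real.exp (f x ^ 2 / (4 * L))) ν := by
    intro f hf hfM
    refine hei (by fun_prop) (M ^ 2 / (4 * L)) fun x => ?_
    rw [abs_div, abs_of_pos (by positivity : 0 < 4 * L), abs_pow]
    have := hfM x
    gcongr
  have hwabs : Integrable (fun x => Real.exp |w x|) ν :=
    hei (by fun_prop) (M * M / (4 * L)) fun x => by rw [abs_abs]; exact hwb x
  have hE : ∫ x, Real.exp |w x| ∂ν ≤ 2 := by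
    have h1 : ∀ x, Real.exp |w x| ≤
        1 / 2 * Real.exp (a x ^ 2 / (4 * L)) + 1 / 2 * Real.exp (b x ^ 2 / (4 * L)) := by
      intro x
      have h2 : |w x| ≤ a x ^ 2 / (4 * L) / 2 + b x ^ 2 / (4 * L) / 2 := by
        simp only [hw]
        rw [abs_div, abs_mul, abs_of_pos (by positivity : 0 < 4 * L), ← sq_abs (a x),
          ← sq_abs (b x)]
        have : |a x| * |b x| ≤ |a x| ^ 2 / 2 + |b x| ^ 2 / 2 := by
          nlinarith [sq_nonneg (|a x| - |b x|)]
        calc |a x| * |b x| / (4 * L) ≤ (|a x| ^ 2 / 2 + |b x| ^ 2 / 2) / (4 * L) := by gcongr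
          _ = _ := by ring
      have h3 := Real.exp_le_exp.2 h2
      have h4 : Real.exp (a x ^ 2 / (4 * L) / 2 + b x ^ 2 / (4 * L) / 2) =
          Real.exp (a x ^ 2 / (4 * L) / 2) * Real.exp (b x ^ 2 / (4 * L) / 2) := Real.exp_add _ _
      have h5 : ∀ y : ℝ, Real.exp y = Real.exp (y / 2) * Real.exp (y / 2) := by
        intro y; rw [← Real.exp_add]; ring_nf
      rw [h5 (a x ^ 2 / (4 * L)), h5 (b x ^ 2 / (4 * L))]
      nlinarith [sq_nonneg (Real.exp (a x ^ 2 / (4 * L) / 2) - Real.exp (b x ^ 2 / (4 * L) / 2))]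
    have h2 := integral_mono hwabs (((hsq ha hMa).const_mul (1 / 2)).add
      ((hsq hb hMb).const_mul (1 / 2))) h1
    rw [integral_add' ((hsq ha hMa).const_mul _) ((hsq hb hMb).const_mul _), integral_const_mul,
      integral_const_mul] at h2
    have h3 := integral_exp_sq_le_of_subgaussian ha hMa hL hsuba
    have h4 := integral_exp_sq_le_of_subgaussian hb hMb hL hsubb
    linarith
  have hmgf : ∫ x, Real.exp (μ * w x) ∂ν ≤ Real.exp (μ * ∫ x, w x ∂ν + 16 * μ ^ 2) := by
    have h1 : ∫ x, Real.exp (μ * w x) ∂ν ≤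
        ∫ x, (1 + μ * w x) + 8 * μ ^ 2 * Real.exp |w x| ∂ν := by
      refine integral_mono (hei (by fun_prop) (|μ| * (M * M / (4 * L))) fun x => ?_)
        (((integrable_const _).add (hwi.const_mul μ)).add (hwabs.const_mul _))
        fun x => exp_mul_le_one_add hμ
      rw [abs_mul]
      exact mul_le_mul_of_nonneg_left (hwb x) (abs_nonneg _)
    have i1 : Integrable (fun x => 1 + μ * w x) ν := (integrable_const _).add (hwi.const_mul μ)
    rw [integral_add i1 (hwabs.const_mul _), integral_add (integrable_const _) (hwi.const_mul μ),
      integral_const_mul, integral_const_mul] at h1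
    simp only [integral_const, probReal_univ, smul_eq_mul, one_mul] at h1
    have h2 := Real.add_one_le_exp (μ * ∫ x, w x ∂ν + 16 * μ ^ 2)
    nlinarith [sq_nonneg μ]
  have hmean : t * ∫ y, a y * b y ∂ν = μ * ∫ x, w x ∂ν := by
    rw [← integral_const_mul, ← integral_const_mul]
    simp only [hexpand]
  have e1 : ∀ x, Real.exp (t * (a x * b x - ∫ y, a y * b y ∂ν)) =
      Real.exp (-(μ * ∫ x, w x ∂ν)) * Real.exp (μ * w x) := by
    intro x
    rw [← Real.exp_add, mul_sub, hexpand, hmean]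
    ring_nf
  simp only [e1]
  rw [integral_const_mul]
  calc _ ≤ Real.exp (-(μ * ∫ x, w x ∂ν)) * Real.exp (μ * ∫ x, w x ∂ν + 16 * μ ^ 2) := by gcongr
    _ = _ := by
      rw [← Real.exp_add]
      congr 1
      rw [hμdef]
      ring

/-! ### Nets of the unit ball -/

/-- A `1/2`-net of the unit ball with at most `5 ^ d` points: a maximal `1/2`-separated subset. -/
lemma exists_half_net (d : ℕ) : ∃ N : Finset (EuclideanSpace ℝ (Fin d)),
    N.card ≤ 5 ^ d ∧ (∀ c ∈ N, ‖c‖ ≤ 1) ∧ ∀ x, ‖x‖ ≤ 1 → ∃ c ∈ N, ‖x - c‖ ≤ 1 / 2 := by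
  classical
  let IsSep : Finset (EuclideanSpace ℝ (Fin d)) → Prop := fun s =>
    (∀ c ∈ s, ‖c‖ ≤ 1) ∧ ∀ c ∈ s, ∀ e ∈ s, c ≠ e → 1 / 2 ≤ ‖c - e‖
  have hcard : ∀ s, IsSep s → s.card ≤ 5 ^ d := by
    intro s hs
    have hinj : Function.Injective fun c : EuclideanSpace ℝ (Fin d) => (2 : ℝ) • c :=
      smul_right_injective _ two_ne_zero
    have h := Besicovitch.card_le_of_separated (s.image fun c => (2 : ℝ) • c) ?_ ?_
    · rwa [Finset.card_image_of_injective _ hinj, finrank_euclideanSpace_fin] at h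
    · intro c hc
      obtain ⟨x, hx, rfl⟩ := Finset.mem_image.1 hc
      rw [norm_smul]
      have := hs.1 x hx
      norm_num
      linarith
    · intro c hc e he hne
      obtain ⟨x, hx, rfl⟩ := Finset.mem_image.1 hc
      obtain ⟨y, hy, rfl⟩ := Finset.mem_image.1 he
      have hxy : x ≠ y := fun h => hne (by rw [h])
      have := hs.2 x hx y hy hxy
      rw [← smul_sub, norm_smul]
      norm_num
      linarith
  obtain ⟨N, hN, hmax⟩ : ∃ N, IsSep N ∧ ∀ s, IsSep s → s.card ≤ N.card := by
    obtain ⟨N, hN, hmin⟩ := WellFounded.has_min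
      (measure fun s : Finset (EuclideanSpace ℝ (Fin d)) => 5 ^ d - s.card).wf {s | IsSep s}
      ⟨∅, by simp, by simp⟩
    refine ⟨N, hN, fun s hs => ?_⟩
    have h1 : ¬ (5 ^ d - s.card < 5 ^ d - N.card) := hmin s hs
    have h2 := hcard s hs
    have h3 := hcard N hN
    omega
  refine ⟨N, hcard N hN, hN.1, fun x hx => ?_⟩
  by_contra! hfar
  have hxN : x ∉ N := fun h => by
    have := hfar x h
    rw [sub_self, norm_zero] at this
    linarith
  have := hmax (insert x N) ⟨?_, ?_⟩
  · rw [Finset.card_insert_of_notMem hxN] at this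
    omega
  · intro c hc
    rcases Finset.mem_insert.1 hc with rfl | h
    exacts [hx, hN.1 c h]
  · intro c hc e he hne
    rcases Finset.mem_insert.1 hc with rfl | h <;> rcases Finset.mem_insert.1 he with rfl | h'
    · exact absurd rfl hne
    · exact (hfar e h').le
    · rw [norm_sub_rev]; exact (hfar c h).le
    · exact hN.2 c h e h' hne

/-- The spectral norm is controlled by the bilinear form on a `1/2`-net of the unit ball. -/
lemma spectralNorm₂_le_of_net {d : ℕ} {N : Finset (EuclideanSpace ℝ (Fin d))}
    (hN : ∀ x : EuclideanSpace ℝ (Fin d), ‖x‖ ≤ 1 → ∃ c ∈ N, ‖x - c‖ ≤ 1 / 2)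
    {A : Matrix (Fin d) (Fin d) ℝ} {B : ℝ}
    (hB : ∀ x ∈ N, ∀ y ∈ N, ∑ i, ∑ j, y i * A i j * x j ≤ B) :
    spectralNorm₂ A ≤ 4 * B := by
  set T := Matrix.toEuclideanCLM (n := Fin d) (𝕜 := ℝ) A with hT
  have h1 : ∀ x ∈ N, ‖T x‖ ≤ 2 * B := by
    intro x hx
    by_cases h0 : T x = 0
    · have h := hB x hx x hx
      rw [← inner_toEuclideanCLM_eq_sum, ← hT, h0, inner_zero_right] at h
      rw [h0, norm_zero]
      linarith
    have hpos : 0 < ‖T x‖ := norm_pos_iff.2 h0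
    set y := ‖T x‖⁻¹ • T x with hy
    have hy1 : ‖y‖ = 1 := by
      rw [hy, norm_smul, norm_inv, norm_norm, inv_mul_cancel₀ hpos.ne']
    obtain ⟨c, hc, hc'⟩ := hN y hy1.le
    have e1 : inner ℝ y (T x) = ‖T x‖ := by
      rw [hy, real_inner_smul_left, real_inner_self_eq_norm_sq]
      field_simp
    have e2 : inner ℝ y (T x) = inner ℝ c (T x) + inner ℝ (y - c) (T x) := by
      rw [← inner_add_left]; congr 1; abel
    have h3 : inner ℝ c (T x) ≤ B := by
      rw [hT, inner_toEuclideanCLM_eq_sum]; exact hB x hx c hc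
    have h4 : inner ℝ (y - c) (T x) ≤ 1 / 2 * ‖T x‖ :=
      (real_inner_le_norm _ _).trans (by gcongr)
    linarith
  have hB0 : 0 ≤ B := by
    obtain ⟨c, hc, -⟩ := hN 0 (by simp)
    linarith [h1 c hc, norm_nonneg (T c)]
  have h2 : ‖T‖ ≤ 2 * B + 1 / 2 * ‖T‖ := by
    refine T.opNorm_le_of_unit_norm (by positivity) fun x hx => ?_
    obtain ⟨c, hc, hc'⟩ := hN x hx.le
    have : T x = T c + T (x - c) := by rw [← map_add]; congr 1; abel
    rw [this]
    refine (norm_add_le _ _).trans (add_le_add (h1 c hc) ?_)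
    refine (T.le_opNorm _).trans ?_
    rw [mul_comm]
    gcongr
  change ‖T‖ ≤ _
  linarith

/-! ### Concentration of matrices of U-statistics -/

lemma aemeasurable_embeddingAverage {Ω V : Type*} [MeasurableSpace Ω] [MeasurableSpace V]
    {P : Measure Ω} {n r : ℕ} {X : Fin n → Ω → V} (hX : ∀ i, AEMeasurable (X i) P)
    {h : (Fin r → V) → ℝ} (hh : Measurable h) :
    AEMeasurable (fun ω => embeddingAverage fun τ : Fin r ↪ Fin n => h fun j => X (τ j) ω) P := by
  unfold embeddingAverage
  refine AEMeasurable.div_const (Finset.aemeasurable_fun_sum _ fun τ _ => ?_) _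
  exact hh.comp_aemeasurable (aemeasurable_pi_lambda _ fun j => hX _)

lemma integrable_exp_mul_embeddingAverage {Ω V : Type*} [MeasurableSpace Ω] [MeasurableSpace V]
    {P : Measure Ω} [IsProbabilityMeasure P] {n r : ℕ} {X : Fin n → Ω → V}
    (hX : ∀ i, AEMeasurable (X i) P)
    {h : (Fin r → V) → ℝ} (hh : Measurable h) {C : ℝ} (hC0 : 0 ≤ C) (hC : ∀ x, |h x| ≤ C) (t : ℝ) :
    Integrable (fun ω => Real.exp
      (t * embeddingAverage fun τ : Fin r ↪ Fin n => h fun j => X (τ j) ω)) P := by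
  refine integrable_of_bounded_comp ?_ (Real.exp (|t| * C)) fun ω => ?_
  · exact (Real.measurable_exp.comp_aemeasurable
      ((aemeasurable_embeddingAverage hX hh).const_mul t)).aestronglyMeasurable
  · rw [Real.abs_exp, Real.exp_le_exp]
    refine (le_abs_self _).trans ?_
    rw [abs_mul]
    exact mul_le_mul_of_nonneg_left (abs_embeddingAverage_le hC0 fun τ => hC _) (abs_nonneg _)

/-- Concentration in spectral norm of a matrix of U-statistics with product kernels `a j * b k`
whose factors are jointly sub-Gaussian. The norm is reduced to a net and the maximum over the net
is bounded through exponential moments; the bound is stated through an integrable majorant. -/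
theorem exists_majorant_spectralNorm₂ {Ω V : Type*} [MeasurableSpace Ω] [MeasurableSpace V]
    {P : Measure Ω} [IsProbabilityMeasure P] {μ : Measure V} [IsProbabilityMeasure μ]
    {n m r d : ℕ} (hm : 0 < m) (hmr : m * r ≤ n) (hd : 0 < d) (hdm : d ≤ m)
    {X : Fin n → Ω → V} (hlaw : ∀ i, HasLaw (X i) μ P) (hind : iIndepFun X P)
    {a b : Fin d → (Fin r → V) → ℝ} (ha : ∀ j, Measurable (a j)) (hb : ∀ j, Measurable (b j))
    (ha1 : ∀ j x, |a j x| ≤ 1) (hb1 : ∀ j x, |b j x| ≤ 1) {L : ℝ} (hL : 0 < L)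
    (hsuba : ∀ u : Fin d → ℝ, ∫ x, Real.exp (∑ j, u j * a j x) ∂Measure.pi (fun _ : Fin r => μ) ≤
      Real.exp (L * ∑ j, u j ^ 2 / 2))
    (hsubb : ∀ u : Fin d → ℝ, ∫ x, Real.exp (∑ j, u j * b j x) ∂Measure.pi (fun _ : Fin r => μ) ≤
      Real.exp (L * ∑ j, u j ^ 2 / 2)) :
    ∃ G : Ω → ℝ, Integrable G P ∧ ∫ ω, G ω ∂P ≤ 256 * L * √((d : ℝ) / m) ∧
      ∀ ω, spectralNorm₂ (Matrix.of fun j k => embeddingAverage fun τ : Fin r ↪ Fin n =>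
        a j (fun i => X (τ i) ω) * b k (fun i => X (τ i) ω) -
          ∫ x, a j x * b k x ∂Measure.pi (fun _ : Fin r => μ)) ≤ G ω := by
  set ν := Measure.pi (fun _ : Fin r => μ) with hν
  have hX : ∀ i, AEMeasurable (X i) P := fun i => (hlaw i).aemeasurable
  obtain ⟨N, hNcard, hN1, hN⟩ := exists_half_net d
  -- at the exponent `s` the logarithmic moment `256 * L ^ 2 * s ^ 2 / m = 4 * d` of one bilinear form
  -- is of the order `d` of the logarithm of the number of pairs in the net
  set s : ℝ := √((d : ℝ) * m) / (8 * L) with hs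
  have hm' : (0 : ℝ) < m := by exact_mod_cast hm
  have hd' : (0 : ℝ) < d := by exact_mod_cast hd
  have hs0 : 0 < s := by positivity
  let A : EuclideanSpace ℝ (Fin d) → (Fin r → V) → ℝ := fun y x => ∑ j, y j * a j x
  let B : EuclideanSpace ℝ (Fin d) → (Fin r → V) → ℝ := fun y x => ∑ j, y j * b j x
  have hAm : ∀ y, Measurable (A y) := fun y => by
    exact Finset.measurable_fun_sum _ fun j _ => (ha j).const_mul _
  have hBm : ∀ y, Measurable (B y) := fun y => by
    exact Finset.measurable_fun_sum _ fun j _ => (hb j).const_mul _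
  have hbound : ∀ (c : Fin d → (Fin r → V) → ℝ) (_ : ∀ j x, |c j x| ≤ 1)
      (y : EuclideanSpace ℝ (Fin d)) (_ : ‖y‖ ≤ 1) (x : Fin r → V), |∑ j, y j * c j x| ≤ d := by
    intro c hc y hy x
    refine (Finset.abs_sum_le_sum_abs _ _).trans ?_
    refine (Finset.sum_le_sum (g := fun _ => (1 : ℝ)) fun j _ => ?_).trans (by simp)
    rw [abs_mul]
    refine mul_le_one₀ ?_ (abs_nonneg _) (hc j x)
    exact (PiLp.norm_apply_le y j).trans hy
  have hsub1 : ∀ (c : Fin d → (Fin r → V) → ℝ)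
      (_ : ∀ u : Fin d → ℝ, ∫ x, Real.exp (∑ j, u j * c j x) ∂ν ≤
        Real.exp (L * ∑ j, u j ^ 2 / 2)) (y : EuclideanSpace ℝ (Fin d)) (_ : ‖y‖ ≤ 1) (t : ℝ),
      ∫ x, Real.exp (t * ∑ j, y j * c j x) ∂ν ≤ Real.exp (L * t ^ 2 / 2) := by
    intro c hc y hy t
    have h := hc fun j => t * y j
    have e : ∀ x, ∑ j, t * y j * c j x = t * ∑ j, y j * c j x := by
      intro x; rw [Finset.mul_sum]; exact Finset.sum_congr rfl fun j _ => by ring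
    simp only [e] at h
    refine h.trans (Real.exp_le_exp.2 ?_)
    have h2 : ∑ j, (t * y j) ^ 2 / 2 = t ^ 2 / 2 * ‖y‖ ^ 2 := by
      rw [EuclideanSpace.real_norm_sq_eq, Finset.mul_sum]
      exact Finset.sum_congr rfl fun j _ => by ring
    rw [h2]
    have h3 : ‖y‖ ^ 2 ≤ 1 := pow_le_one₀ (norm_nonneg _) hy
    calc L * (t ^ 2 / 2 * ‖y‖ ^ 2) ≤ L * (t ^ 2 / 2 * 1) := by gcongr
      _ = _ := by ring
  let h : EuclideanSpace ℝ (Fin d) → EuclideanSpace ℝ (Fin d) → (Fin r → V) → ℝ := fun x y z =>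
    A y z * B x z - ∫ w, A y w * B x w ∂ν
  have hhm : ∀ x y, Measurable (h x y) := fun x y => ((hAm y).mul (hBm x)).sub_const _
  have hABb : ∀ x ∈ N, ∀ y ∈ N, ∀ z, |A y z * B x z| ≤ d * d := by
    intro x hx y hy z
    rw [abs_mul]
    have h1 := hbound a ha1 y (hN1 y hy) z
    have h2 := hbound b hb1 x (hN1 x hx) z
    exact mul_le_mul h1 h2 (abs_nonneg _) (by positivity)
  have hhb : ∀ x ∈ N, ∀ y ∈ N, ∀ z, |h x y z| ≤ d * d + d * d := by
    intro x hx y hy z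
    refine (abs_sub _ _).trans (add_le_add (hABb x hx y hy z) ?_)
    have h1 := abs_integral_le_of_bounded (P := ν) (f := fun w => A y w * B x w)
      (hABb x hx y hy)
    exact h1
  let Z : EuclideanSpace ℝ (Fin d) → EuclideanSpace ℝ (Fin d) → Ω → ℝ := fun x y ω =>
    embeddingAverage fun τ : Fin r ↪ Fin n => h x y fun j => X (τ j) ω
  have hZi : ∀ x ∈ N, ∀ y ∈ N, Integrable (fun ω => Real.exp (s * Z x y ω)) P :=
    fun x hx y hy => integrable_exp_mul_embeddingAverage hX (hhm x y) (by positivity)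
      (hhb x hx y hy) s
  have hZ : ∀ x ∈ N, ∀ y ∈ N, ∫ ω, Real.exp (s * Z x y ω) ∂P ≤ Real.exp (4 * d) := by
    intro x hx y hy
    refine (integral_exp_embeddingAverage_le hm hmr hlaw hind (hhm x y) (hhb x hx y hy) s).trans ?_
    have hsm : |s / m| ≤ 1 / (8 * L) := by
      rw [abs_of_pos (by positivity), hs, div_div, div_le_div_iff₀ (by positivity) (by positivity)]
      have : √((d : ℝ) * m) ≤ m := by
        rw [Real.sqrt_le_left hm'.le, sq]
        gcongr
      nlinarith
    have h1 := integral_exp_mul_sub_le_of_subgaussian (hAm y) (hBm x)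
      (hbound a ha1 y (hN1 y hy)) (hbound b hb1 x (hN1 x hx)) hL
      (hsub1 a hsuba y (hN1 y hy)) (hsub1 b hsubb x (hN1 x hx)) hsm
    refine (pow_le_pow_left₀ (integral_nonneg fun _ => (Real.exp_pos _).le) h1 m).trans ?_
    rw [← Real.exp_nat_mul, Real.exp_le_exp]
    apply le_of_eq
    rw [hs, div_pow, div_pow, Real.sq_sqrt (by positivity)]
    field_simp
    norm_num
  -- the shift `8 * d` beats the `25 ^ d` pairs of net points: `25 ^ d * exp (4 * d) ≤ exp (8 * d)`
  let G : Ω → ℝ := fun ω =>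
    4 / s * (8 * d - 1 + ∑ x ∈ N, ∑ y ∈ N, Real.exp (-(8 * d)) * Real.exp (s * Z x y ω))
  have hsumi : Integrable
      (fun ω => ∑ x ∈ N, ∑ y ∈ N, Real.exp (-(8 * d)) * Real.exp (s * Z x y ω)) P :=
    integrable_finsetSum _ fun x hx => integrable_finsetSum _ fun y hy =>
      (hZi x hx y hy).const_mul _
  refine ⟨G, ((integrable_const _).add hsumi).const_mul _, ?_, fun ω => ?_⟩
  · have h1 : ∫ ω, ∑ x ∈ N, ∑ y ∈ N, Real.exp (-(8 * d)) * Real.exp (s * Z x y ω) ∂P ≤ 1 := by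
      rw [integral_finsetSum _ fun x hx => integrable_finsetSum _ fun y hy =>
        (hZi x hx y hy).const_mul _]
      have h2 : ∀ x ∈ N, ∫ ω, ∑ y ∈ N, Real.exp (-(8 * d)) * Real.exp (s * Z x y ω) ∂P ≤
          5 ^ d * Real.exp (-(4 * d)) := by
        intro x hx
        rw [integral_finsetSum _ fun y hy => (hZi x hx y hy).const_mul _]
        have h3 : ∀ y ∈ N, ∫ ω, Real.exp (-(8 * d)) * Real.exp (s * Z x y ω) ∂P ≤
            Real.exp (-(4 * d)) := by
          intro y hy
          rw [integral_const_mul]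
          calc _ ≤ Real.exp (-(8 * d)) * Real.exp (4 * d) := by gcongr; exact hZ x hx y hy
            _ = _ := by rw [← Real.exp_add]; ring_nf
        refine (Finset.sum_le_card_nsmul _ _ _ h3).trans ?_
        rw [nsmul_eq_mul]
        gcongr
        exact_mod_cast hNcard
      refine (Finset.sum_le_card_nsmul _ _ _ h2).trans ?_
      rw [nsmul_eq_mul]
      have h5 : (N.card : ℝ) ≤ 5 ^ d := by exact_mod_cast hNcard
      have h6 : (25 : ℝ) ≤ Real.exp 4 := by
        have h7 := Real.exp_one_gt_d9
        have h8 : Real.exp 4 = Real.exp 1 ^ 4 := by rw [← Real.exp_nat_mul]; norm_num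
        rw [h8]
        calc (25 : ℝ) ≤ 2.7 ^ 4 := by norm_num
          _ ≤ _ := by gcongr; linarith
      have h9 : Real.exp (-(4 * d)) = (Real.exp 4 ^ d)⁻¹ := by
        rw [Real.exp_neg, ← Real.exp_nat_mul]; ring_nf
      calc _ ≤ (5 : ℝ) ^ d * (5 ^ d * Real.exp (-(4 * d))) := by gcongr
        _ = 25 ^ d * (Real.exp 4 ^ d)⁻¹ := by
          rw [h9, ← mul_assoc, ← mul_pow]; norm_num
        _ ≤ Real.exp 4 ^ d * (Real.exp 4 ^ d)⁻¹ := by gcongr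
        _ = 1 := mul_inv_cancel₀ (by positivity)
    have h2 : ∫ ω, G ω ∂P = 4 / s * (8 * d - 1 +
        ∫ ω, ∑ x ∈ N, ∑ y ∈ N, Real.exp (-(8 * d)) * Real.exp (s * Z x y ω) ∂P) := by
      rw [integral_const_mul, integral_add (integrable_const _) hsumi]
      simp
    rw [h2]
    calc _ ≤ 4 / s * (8 * d - 1 + 1) := by gcongr
      _ = 256 * L * (d / √((d : ℝ) * m)) := by rw [hs]; field_simp; ring
      _ = 256 * L * √((d : ℝ) / m) := by
        congr 1
        rw [Real.sqrt_mul hd'.le, Real.sqrt_div hd'.le]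
        have := Real.sq_sqrt hd'.le
        have h3 : 0 < √(d : ℝ) := by positivity
        have h4 : 0 < √(m : ℝ) := by positivity
        field_simp
        linarith
  · have hlin : ∀ x y : EuclideanSpace ℝ (Fin d), ∑ j, ∑ k, y j *
        (Matrix.of fun j k => embeddingAverage fun τ : Fin r ↪ Fin n =>
          a j (fun i => X (τ i) ω) * b k (fun i => X (τ i) ω) - ∫ x, a j x * b k x ∂ν) j k * x k =
        Z x y ω := by
      intro x y
      have hint : ∀ j k, Integrable (fun z => a j z * b k z) ν := by
        intro j k
        refine integrable_of_bounded_comp ((ha j).mul (hb k)).aestronglyMeasurable 1 fun z => ?_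
        rw [abs_mul]
        exact mul_le_one₀ (ha1 j z) (abs_nonneg _) (hb1 k z)
      have hprod : ∀ z, A y z * B x z = ∑ j, ∑ k, y j * x k * (a j z * b k z) := by
        intro z
        simp only [A, B]
        rw [Finset.sum_mul_sum]
        exact Finset.sum_congr rfl fun j _ => Finset.sum_congr rfl fun k _ => by ring
      have hh : ∀ z, h x y z = ∑ j, ∑ k, y j * x k * (a j z * b k z - ∫ w, a j w * b k w ∂ν) := by
        intro z
        simp only [h, hprod]
        rw [integral_finsetSum _ fun j _ => integrable_finsetSum _ fun k _ =>
          (hint j k).const_mul _, ← Finset.sum_sub_distrib]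
        refine Finset.sum_congr rfl fun j _ => ?_
        rw [integral_finsetSum _ fun k _ => (hint j k).const_mul _, ← Finset.sum_sub_distrib]
        refine Finset.sum_congr rfl fun k _ => ?_
        rw [integral_const_mul]
        ring
      simp only [Z, hh]
      rw [embeddingAverage_sum]
      refine Finset.sum_congr rfl fun j _ => ?_
      rw [embeddingAverage_sum]
      refine Finset.sum_congr rfl fun k _ => ?_
      rw [embeddingAverage_mul_left, Matrix.of_apply]
      ring
    have hG : G ω = 4 * (1 / s * (8 * d - 1 +
        ∑ x ∈ N, ∑ y ∈ N, Real.exp (-(8 * d)) * Real.exp (s * Z x y ω))) := by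
      simp only [G]; ring
    rw [hG]
    refine spectralNorm₂_le_of_net hN fun x hx y hy => ?_
    rw [hlin, one_div_mul_eq_div, le_div_iff₀ hs0]
    -- `z ≤ c - 1 + exp (z - c)` replaces the logarithm of the sum of the exponentials
    have h1 := Real.add_one_le_exp (s * Z x y ω - 8 * d)
    have h2 : Real.exp (s * Z x y ω - 8 * d) = Real.exp (-(8 * d)) * Real.exp (s * Z x y ω) := by
      rw [← Real.exp_add]; ring_nf
    have h3 : Real.exp (-(8 * d)) * Real.exp (s * Z x y ω) ≤
        ∑ x ∈ N, ∑ y ∈ N, Real.exp (-(8 * d)) * Real.exp (s * Z x y ω) := by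
      refine (Finset.single_le_sum (f := fun y => Real.exp (-(8 * d)) * Real.exp (s * Z x y ω))
        (fun y _ => by positivity) hy).trans ?_
      exact Finset.single_le_sum
        (f := fun x => ∑ y ∈ N, Real.exp (-(8 * d)) * Real.exp (s * Z x y ω))
        (fun x _ => by positivity) hx
    linarith

/-- The entries of a matrix of U-statistics with kernels bounded by one fluctuate on the scale
`m ^ (-1/2)`, so that the root of the sum of their fourth powers is of order `d / m`. -/
theorem exists_majorant_sqrt_sum_pow_four {Ω V : Type*} [MeasurableSpace Ω] [MeasurableSpace V]
    {P : Measure Ω} [IsProbabilityMeasure P] {μ : Measure V} [IsProbabilityMeasure μ]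
    {n m r d : ℕ} (hm : 0 < m) (hmr : m * r ≤ n) (hd : 0 < d)
    {X : Fin n → Ω → V} (hlaw : ∀ i, HasLaw (X i) μ P) (hind : iIndepFun X P)
    {h : Fin d → Fin d → (Fin r → V) → ℝ} (hh : ∀ j k, Measurable (h j k))
    (hh1 : ∀ j k x, |h j k x| ≤ 1) :
    ∃ G : Ω → ℝ, Integrable G P ∧ ∫ ω, G ω ∂P ≤ 10 * ((d : ℝ) / m) ∧
      ∀ ω, √(∑ j, ∑ k, (embeddingAverage fun τ : Fin r ↪ Fin n =>
        h j k (fun i => X (τ i) ω) - ∫ x, h j k x ∂Measure.pi (fun _ : Fin r => μ)) ^ 4) ≤ G ω := by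
  set ν := Measure.pi (fun _ : Fin r => μ) with hν
  have hX : ∀ i, AEMeasurable (X i) P := fun i => (hlaw i).aemeasurable
  have hm' : (0 : ℝ) < m := by exact_mod_cast hm
  have hd' : (0 : ℝ) < d := by exact_mod_cast hd
  let g : Fin d → Fin d → (Fin r → V) → ℝ := fun j k x => h j k x - ∫ x, h j k x ∂ν
  have hgm : ∀ j k, Measurable (g j k) := fun j k => (hh j k).sub_const _
  have hg2 : ∀ j k x, |g j k x| ≤ 2 := by
    intro j k x
    have h1 := abs_integral_le_of_bounded (P := ν) (f := h j k) (hh1 j k)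
    have h2 := abs_sub (h j k x) (∫ x, h j k x ∂ν)
    linarith [hh1 j k x]
  let D : Fin d → Fin d → Ω → ℝ := fun j k ω =>
    embeddingAverage fun τ : Fin r ↪ Fin n => g j k fun i => X (τ i) ω
  have hD2 : ∀ j k ω, |D j k ω| ≤ 2 := fun j k ω =>
    abs_embeddingAverage_le zero_le_two fun τ => hg2 j k _
  have hDi : ∀ j k, Integrable (fun ω => D j k ω ^ 4) P := by
    intro j k
    refine integrable_of_bounded_comp
      ((aemeasurable_embeddingAverage hX (hgm j k)).pow_const 4).aestronglyMeasurable (2 ^ 4)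
      fun ω => ?_
    rw [abs_pow]
    exact pow_le_pow_left₀ (abs_nonneg _) (hD2 j k ω) 4
  have hmgf : ∀ j k t, ∫ ω, Real.exp (t * D j k ω) ∂P ≤ Real.exp (t ^ 2 / (2 * m)) := by
    intro j k t
    refine (integral_exp_embeddingAverage_le hm hmr hlaw hind (hgm j k) (hg2 j k) t).trans ?_
    have h1 := (hasSubgaussianMGF_of_mem_Icc (μ := ν) (X := h j k) (a := -1) (b := 1)
      (hh j k).aemeasurable (.of_forall fun x => abs_le.1 (hh1 j k x))).mgf_le (t / m)
    refine (pow_le_pow_left₀ (integral_nonneg fun _ => (Real.exp_pos _).le) h1 m).trans ?_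
    rw [← Real.exp_nat_mul, Real.exp_le_exp]
    apply le_of_eq
    have h2 : (((‖(1 : ℝ) - -1‖₊ / 2) ^ 2 : NNReal) : ℝ) = 1 := by
      push_cast
      rw [Real.norm_eq_abs]
      norm_num
    rw [h2]
    field_simp
  have h4 : ∀ j k, ∫ ω, D j k ω ^ 4 ∂P ≤ 96 / m ^ 2 := by
    intro j k
    have hs : √(m : ℝ) ^ 2 = m := Real.sq_sqrt hm'.le
    have hpt : ∀ ω, D j k ω ^ 4 ≤ 24 / (m : ℝ) ^ 2 *
        (Real.exp (√m * D j k ω) + Real.exp (-√m * D j k ω)) := by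
      intro ω
      set x := √m * D j k ω with hx
      have h1 : x ^ 4 ≤ 24 * (Real.exp x + Real.exp (-x)) := by
        have h2 := Real.sum_le_exp_of_nonneg (abs_nonneg x) 5
        have h3 : Real.exp |x| ≤ Real.exp x + Real.exp (-x) := by
          rcases abs_choice x with h | h <;> rw [h]
          · linarith [Real.exp_pos (-x)]
          · linarith [Real.exp_pos x]
        simp only [Finset.sum_range_succ, Finset.sum_range_zero, Nat.factorial] at h2
        norm_num at h2
        have h5 : |x| ^ 4 = x ^ 4 := by rw [show (4 : ℕ) = 2 * 2 from rfl, pow_mul, sq_abs, pow_mul]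
        have h6 := sq_nonneg x
        have h7 : 0 ≤ |x| ^ 3 := by positivity
        have h8 := abs_nonneg x
        linarith
      have h2 : x ^ 4 = m ^ 2 * D j k ω ^ 4 := by
        rw [hx, mul_pow, show (4 : ℕ) = 2 * 2 from rfl, pow_mul, hs]
      rw [h2] at h1
      have h3 : -√m * D j k ω = -x := by rw [hx]; ring
      rw [h3, div_mul_eq_mul_div, le_div_iff₀ (by positivity)]
      linarith
    have hi : ∀ t, Integrable (fun ω => Real.exp (t * D j k ω)) P := fun t =>
      integrable_exp_mul_embeddingAverage hX (hgm j k) zero_le_two (hg2 j k) t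
    refine (integral_mono (hDi j k) (((hi _).add (hi _)).const_mul _) hpt).trans ?_
    have e : ∫ ω, (24 / (m : ℝ) ^ 2 *
        (Real.exp (√m * D j k ω) + Real.exp (-√m * D j k ω))) ∂P =
        24 / (m : ℝ) ^ 2 * (∫ ω, Real.exp (√m * D j k ω) ∂P +
          ∫ ω, Real.exp (-√m * D j k ω) ∂P) := by
      rw [integral_const_mul, integral_add (hi _) (hi _)]
    refine e.trans_le ?_
    have hh2 : Real.exp (1 / 2) ≤ 2 := by
      have := Real.exp_one_lt_d9
      have h5 : Real.exp 1 = Real.exp (1 / 2) * Real.exp (1 / 2) := by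
        rw [← Real.exp_add]; norm_num
      nlinarith [Real.exp_pos (1 / 2)]
    have k1 := hmgf j k √m
    have k2 := hmgf j k (-√m)
    rw [neg_sq, hs] at k2
    rw [hs] at k1
    have e2 : (m : ℝ) / (2 * m) = 1 / 2 := by field_simp
    rw [e2] at k1 k2
    calc _ ≤ 24 / (m : ℝ) ^ 2 * (2 + 2) := by
          gcongr
          exacts [k1.trans hh2, k2.trans hh2]
      _ = _ := by ring
  set c : ℝ := 10 * ((d : ℝ) / m) with hc
  have hc0 : 0 < c := by positivity
  have hVi : Integrable (fun ω => ∑ j, ∑ k, D j k ω ^ 4) P :=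
    integrable_finsetSum _ fun j _ => integrable_finsetSum _ fun k _ => hDi j k
  refine ⟨fun ω => ((∑ j, ∑ k, D j k ω ^ 4) / c + c) / 2,
    ((hVi.div_const c).add (integrable_const c)).div_const 2, ?_, fun ω => ?_⟩
  · have h1 : ∫ ω, ∑ j, ∑ k, D j k ω ^ 4 ∂P ≤ (d : ℝ) ^ 2 * (96 / (m : ℝ) ^ 2) := by
      rw [integral_finsetSum _ fun j _ => integrable_finsetSum _ fun k _ => hDi j k]
      calc _ ≤ ∑ _j : Fin d, ∑ _k : Fin d, (96 / (m : ℝ) ^ 2) := by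
            refine Finset.sum_le_sum fun j _ => ?_
            rw [integral_finsetSum _ fun k _ => hDi j k]
            exact Finset.sum_le_sum fun k _ => h4 j k
        _ = _ := by simp; ring
    rw [integral_div, integral_add (hVi.div_const c) (integrable_const c), integral_div]
    simp only [integral_const, probReal_univ, smul_eq_mul, one_mul]
    have h2 : (∫ ω, ∑ j, ∑ k, D j k ω ^ 4 ∂P) / c ≤ c := by
      rw [div_le_iff₀ hc0]
      refine h1.trans ?_
      rw [hc]
      have : (0 : ℝ) ≤ (d : ℝ) ^ 2 / m ^ 2 := by positivity
      calc (d : ℝ) ^ 2 * (96 / (m : ℝ) ^ 2) = 96 * ((d : ℝ) ^ 2 / (m : ℝ) ^ 2) := by ring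
        _ ≤ 100 * ((d : ℝ) ^ 2 / (m : ℝ) ^ 2) := by gcongr; norm_num
        _ = _ := by ring
    linarith
  · change √(∑ j, ∑ k, D j k ω ^ 4) ≤ _
    set v := ∑ j, ∑ k, D j k ω ^ 4 with hv
    have hv0 : 0 ≤ v := Finset.sum_nonneg fun j _ => Finset.sum_nonneg fun k _ => by positivity
    have h1 := Real.sq_sqrt hv0
    have h2 : v / c + c - 2 * √v = (√v - c) ^ 2 / c := by
      rw [sub_sq, h1]; field_simp; ring
    have h3 : 0 ≤ (√v - c) ^ 2 / c := by positivity
    linarith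

/-! ### Kendall's tau and Spearman's rho as U-statistics -/

lemma sum_embedding_fin_two {α : Type*} [Fintype α] [DecidableEq α] (F : α → α → ℝ) :
    ∑ τ : Fin 2 ↪ α, F (τ 0) (τ 1) = ∑ i, ∑ j, if i ≠ j then F i j else 0 := by
  rw [← Fintype.sum_prod_type' (f := fun i j => if i ≠ j then F i j else 0), ← Finset.sum_filter]
  refine Finset.sum_bij' (fun τ _ => (τ 0, τ 1))
    (fun p hp => ⟨![p.1, p.2], ?_⟩) ?_ ?_ ?_ ?_ ?_
  · have h := (Finset.mem_filter.1 hp).2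
    intro a b hab
    fin_cases a <;> fin_cases b <;> simp_all
  · intro τ _
    simp
  · simp
  · intro τ _
    ext a
    fin_cases a <;> rfl
  · intro p _
    rfl
  · intro τ _
    rfl

lemma sum_embedding_fin_three {α : Type*} [Fintype α] [DecidableEq α] (F : α → α → α → ℝ) :
    ∑ τ : Fin 3 ↪ α, F (τ 0) (τ 1) (τ 2) =
      ∑ i, ∑ j, ∑ k, if i ≠ j ∧ i ≠ k ∧ j ≠ k then F i j k else 0 := by
  have : ∑ i, ∑ j, ∑ k, (if i ≠ j ∧ i ≠ k ∧ j ≠ k then F i j k else 0) =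
      ∑ p : α × α × α, if p.1 ≠ p.2.1 ∧ p.1 ≠ p.2.2 ∧ p.2.1 ≠ p.2.2 then
        F p.1 p.2.1 p.2.2 else 0 := by
    rw [Fintype.sum_prod_type]
    refine Finset.sum_congr rfl fun i _ => ?_
    rw [Fintype.sum_prod_type]
  rw [this, ← Finset.sum_filter]
  refine Finset.sum_bij' (fun τ _ => (τ 0, τ 1, τ 2))
    (fun p hp => ⟨![p.1, p.2.1, p.2.2], ?_⟩) ?_ ?_ ?_ ?_ ?_
  · have h := (Finset.mem_filter.1 hp).2
    intro a b hab
    fin_cases a <;> fin_cases b <;> simp_all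
  · intro τ _
    simp
  · simp
  · intro τ _
    ext a
    fin_cases a <;> rfl
  · intro p _
    rfl
  · intro τ _
    rfl

lemma card_embedding_fin_two (n : ℕ) :
    (Fintype.card (Fin 2 ↪ Fin n) : ℝ) = n * (n - 1) := by
  rw [Fintype.card_embedding_eq, Fintype.card_fin, Fintype.card_fin]
  rcases n with _ | n
  · simp
  · simp [Nat.descFactorial]
    ring

lemma card_embedding_fin_three (n : ℕ) :
    (Fintype.card (Fin 3 ↪ Fin n) : ℝ) = n * (n - 1) * (n - 2) := by
  rw [Fintype.card_embedding_eq, Fintype.card_fin, Fintype.card_fin]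
  rcases n with _ | _ | n
  · simp
  · simp
  · simp [Nat.descFactorial]
    ring

/-- The kernel of Kendall's tau is symmetric, so that the sum over pairs `i₁ < i₂` is half the sum
over ordered pairs. -/
lemma kendallTau_eq_embeddingAverage {n d : ℕ} (y : Fin n → Fin d → ℝ) (j k : Fin d) :
    kendallTau y j k = embeddingAverage fun τ : Fin 2 ↪ Fin n =>
      Real.sign (y (τ 0) j - y (τ 1) j) * Real.sign (y (τ 0) k - y (τ 1) k) := by
  set F : Fin n → Fin n → ℝ := fun i₁ i₂ =>
    Real.sign (y i₁ j - y i₂ j) * Real.sign (y i₁ k - y i₂ k) with hF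
  have hsymm : ∀ i₁ i₂, F i₁ i₂ = F i₂ i₁ := by
    intro i₁ i₂
    simp only [hF]
    rw [← neg_sub (y i₂ j), ← neg_sub (y i₂ k), Real.sign_neg, Real.sign_neg, neg_mul_neg]
  rw [embeddingAverage, sum_embedding_fin_two F, card_embedding_fin_two, kendallTau]
  have h1 : ∑ i₁ : Fin n, ∑ i₂ ∈ Finset.Ioi i₁, F i₁ i₂ =
      ∑ i₁ : Fin n, ∑ i₂, if i₁ < i₂ then F i₁ i₂ else 0 := by
    refine Finset.sum_congr rfl fun i _ => ?_
    rw [← Finset.sum_filter]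
    congr 1
    ext i'
    simp
  have h2 : ∑ i₁ : Fin n, ∑ i₂, (if i₂ < i₁ then F i₁ i₂ else 0) =
      ∑ i₁ : Fin n, ∑ i₂, if i₁ < i₂ then F i₁ i₂ else 0 := by
    rw [Finset.sum_comm]
    refine Finset.sum_congr rfl fun i _ => Finset.sum_congr rfl fun i' _ => ?_
    rw [hsymm]
  have h3 : ∑ i₁ : Fin n, ∑ i₂, (if i₁ ≠ i₂ then F i₁ i₂ else 0) =
      ∑ i₁ : Fin n, ∑ i₂, (if i₁ < i₂ then F i₁ i₂ else 0) +
        ∑ i₁ : Fin n, ∑ i₂, (if i₂ < i₁ then F i₁ i₂ else 0) := by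
    rw [← Finset.sum_add_distrib]
    refine Finset.sum_congr rfl fun i _ => ?_
    rw [← Finset.sum_add_distrib]
    refine Finset.sum_congr rfl fun i' _ => ?_
    rcases lt_trichotomy i i' with h | h | h
    · simp [h, h.ne, h.not_gt]
    · simp [h]
    · simp [h, h.ne', h.not_gt]
  rw [h3, h2, h1]
  ring

/-- Without ties, the centred rank is half the sum of the signs of the differences. -/
lemma dataRank_sub_eq_sum_sign {n d : ℕ} {y : Fin n → Fin d → ℝ} {j : Fin d}
    (hinj : Function.Injective fun i => y i j) (i : Fin n) :
    dataRank y i j - ((n : ℝ) + 1) / 2 = 1 / 2 * ∑ i', Real.sign (y i j - y i' j) := by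
  have h1 : dataRank y i j = ∑ i', if y i' j ≤ y i j then (1 : ℝ) else 0 := by
    rw [dataRank, Finset.sum_boole]
  have h2 : ∀ i', (if y i' j ≤ y i j then (1 : ℝ) else 0) =
      1 / 2 + 1 / 2 * Real.sign (y i j - y i' j) + if i' = i then 1 / 2 else 0 := by
    intro i'
    rcases lt_trichotomy (y i' j) (y i j) with h | h | h
    · have hne : i' ≠ i := by rintro rfl; exact lt_irrefl _ h
      rw [Real.sign_of_pos (sub_pos.2 h)]
      simp [h.le, hne]
      norm_num
    · have : i' = i := hinj h
      subst this
      simp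
      norm_num
    · have hne : i' ≠ i := by rintro rfl; exact lt_irrefl _ h
      rw [Real.sign_of_neg (sub_neg.2 h)]
      simp [h, hne]
  rw [h1, Finset.sum_congr rfl fun i' _ => h2 i', Finset.sum_add_distrib, Finset.sum_add_distrib,
    ← Finset.mul_sum]
  simp
  ring

lemma sum_range_succ_sub_sq (n : ℕ) (c : ℝ) :
    ∑ r ∈ Finset.range n, (((r + 1 : ℕ) : ℝ) - c) ^ 2 =
      n * (n + 1) * (2 * n + 1) / 6 - c * (n * (n + 1)) + n * c ^ 2 := by
  induction n with
  | zero => simp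
  | succ n ih =>
    rw [Finset.sum_range_succ, ih]
    push_cast
    ring

/-- Without ties the ranks are a permutation of `1, …, n`. -/
lemma sum_dataRank_sub_sq {n d : ℕ} {y : Fin n → Fin d → ℝ} {j : Fin d}
    (hinj : Function.Injective fun i => y i j) :
    ∑ i, (dataRank y i j - ((n : ℝ) + 1) / 2) ^ 2 =
      (n : ℝ) * (n - 1) * (n + 1) / 12 := by
  let ρ : Fin n → ℕ := fun i => (Finset.univ.filter fun i' : Fin n => y i' j ≤ y i j).card
  have hmono : ∀ i i', y i j < y i' j → ρ i < ρ i' := by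
    intro i i' h
    refine Finset.card_lt_card ⟨fun a ha => ?_, fun hsub => ?_⟩
    · simp only [Finset.mem_filter, Finset.mem_univ, true_and] at ha ⊢
      exact ha.trans h.le
    · have := @hsub i' (by simp)
      simp only [Finset.mem_filter, Finset.mem_univ, true_and] at this
      exact absurd h this.not_gt
  have hρinj : Function.Injective ρ := by
    intro i i' h
    by_contra hne
    rcases lt_or_gt_of_ne (fun e => hne (hinj e) : y i j ≠ y i' j) with h1 | h1
    · exact (hmono _ _ h1).ne h
    · exact (hmono _ _ h1).ne' h
  have hpos : ∀ i, 0 < ρ i := fun i => Finset.card_pos.2 ⟨i, by simp⟩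
  have hle : ∀ i, ρ i ≤ n := fun i => (Finset.card_le_univ _).trans_eq (Fintype.card_fin n)
  have himage : Finset.univ.image (fun i => ρ i - 1) = Finset.range n := by
    refine Finset.eq_of_subset_of_card_le (fun r hr => ?_) ?_
    · obtain ⟨i, -, rfl⟩ := Finset.mem_image.1 hr
      have := hpos i
      have := hle i
      exact Finset.mem_range.2 (by omega)
    · rw [Finset.card_image_of_injective, Finset.card_univ, Fintype.card_fin, Finset.card_range]
      intro i i' h
      apply hρinj
      have := hpos i
      have := hpos i'
      simp only at h
      omega
  have h1 : ∑ i, (dataRank y i j - ((n : ℝ) + 1) / 2) ^ 2 =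
      ∑ r ∈ Finset.univ.image (fun i => ρ i - 1), (((r + 1 : ℕ) : ℝ) - ((n : ℝ) + 1) / 2) ^ 2 := by
    rw [Finset.sum_image]
    · refine Finset.sum_congr rfl fun i _ => ?_
      rw [Nat.sub_add_cancel (hpos i)]
      rfl
    · intro i _ i' _ h
      apply hρinj
      have := hpos i
      have := hpos i'
      simp only at h
      omega
  rw [h1, himage, sum_range_succ_sub_sq]
  ring

/-- Without ties, Spearman's rho is a combination of a U-statistic of order three and of Kendall's
tau; the latter collects the triples in which two of the indices compared with `i` coincide. -/
lemma spearmanRho_eq {n d : ℕ} (hn : 3 ≤ n) {y : Fin n → Fin d → ℝ} {j k : Fin d}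
    (hj : Function.Injective fun i => y i j) (hk : Function.Injective fun i => y i k) :
    spearmanRho y j k = 3 * (n - 2) / (n + 1) * (embeddingAverage fun τ : Fin 3 ↪ Fin n =>
      Real.sign (y (τ 0) j - y (τ 1) j) * Real.sign (y (τ 0) k - y (τ 2) k)) +
        3 / (n + 1) * kendallTau y j k := by
  have hn' : (3 : ℝ) ≤ n := by exact_mod_cast hn
  set F : Fin n → Fin n → Fin n → ℝ := fun i i' i'' =>
    Real.sign (y i j - y i' j) * Real.sign (y i k - y i'' k) with hF
  have hnum : ∑ i : Fin n, (dataRank y i j - ((n : ℝ) + 1) / 2) *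
      (dataRank y i k - ((n : ℝ) + 1) / 2) = 1 / 4 * ∑ i, ∑ i', ∑ i'', F i i' i'' := by
    rw [Finset.mul_sum]
    refine Finset.sum_congr rfl fun i _ => ?_
    rw [dataRank_sub_eq_sum_sign hj, dataRank_sub_eq_sum_sign hk, mul_mul_mul_comm,
      Finset.sum_mul_sum]
    norm_num [hF]
  have hsplit : ∑ i, ∑ i', ∑ i'', F i i' i'' =
      (∑ i, ∑ i', ∑ i'', if i ≠ i' ∧ i ≠ i'' ∧ i' ≠ i'' then F i i' i'' else 0) +
        ∑ i, ∑ i', if i ≠ i' then F i i' i' else 0 := by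
    rw [← Finset.sum_add_distrib]
    refine Finset.sum_congr rfl fun i _ => ?_
    rw [← Finset.sum_add_distrib]
    refine Finset.sum_congr rfl fun i' _ => ?_
    have h1 : (if i ≠ i' then F i i' i' else 0) =
        ∑ i'', if i'' = i' then (if i ≠ i' then F i i' i'' else 0) else 0 := by
      simp
    rw [h1, ← Finset.sum_add_distrib]
    refine Finset.sum_congr rfl fun i'' _ => ?_
    by_cases h2 : i = i'
    · subst h2; simp [hF]
    by_cases h3 : i = i''
    · subst h3; simp [hF]
    by_cases h4 : i' = i''
    · subst h4; simp [h2]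
    · simp [h2, h3, h4, Ne.symm h4]
  rw [spearmanRho, hnum, hsplit, sum_dataRank_sub_sq hj, sum_dataRank_sub_sq hk,
    Real.sqrt_mul_self (by
      have : (0 : ℝ) ≤ n - 1 := by linarith
      positivity),
    ← sum_embedding_fin_three F, ← sum_embedding_fin_two fun i i' => F i i' i',
    kendallTau_eq_embeddingAverage, embeddingAverage, embeddingAverage, card_embedding_fin_two,
    card_embedding_fin_three]
  have h1 : (n : ℝ) ≠ 0 := by linarith
  have h2 : (n : ℝ) - 1 ≠ 0 := by linarith
  have h3 : (n : ℝ) - 2 ≠ 0 := by linarith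
  have h4 : (n : ℝ) + 1 ≠ 0 := by linarith
  simp only [hF]
  field_simp
  ring

/-- Spearman's rho differs from its U-statistic of order three by a term of order `1 / n`. -/
lemma abs_spearmanRho_sub_le {n d : ℕ} (hn : 3 ≤ n) {y : Fin n → Fin d → ℝ} {j k : Fin d}
    (hj : Function.Injective fun i => y i j) (hk : Function.Injective fun i => y i k) :
    |spearmanRho y j k - 3 * embeddingAverage fun τ : Fin 3 ↪ Fin n =>
      Real.sign (y (τ 0) j - y (τ 1) j) * Real.sign (y (τ 0) k - y (τ 2) k)| ≤ 12 / n := by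
  have hn' : (3 : ℝ) ≤ n := by exact_mod_cast hn
  have hs : ∀ a b : ℝ, |Real.sign a * Real.sign b| ≤ 1 := by
    intro a b
    rw [abs_mul]
    exact mul_le_one₀ (Real.abs_sign_le_one a) (abs_nonneg _) (Real.abs_sign_le_one b)
  have h1 : |kendallTau y j k| ≤ 1 := by
    rw [kendallTau_eq_embeddingAverage]
    exact abs_embeddingAverage_le zero_le_one fun τ => hs _ _
  rw [spearmanRho_eq hn hj hk]
  set U := embeddingAverage fun τ : Fin 3 ↪ Fin n =>
      Real.sign (y (τ 0) j - y (τ 1) j) * Real.sign (y (τ 0) k - y (τ 2) k) with hU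
  have h2 : |U| ≤ 1 := abs_embeddingAverage_le zero_le_one fun τ => hs _ _
  have e : 3 * ((n : ℝ) - 2) / (n + 1) * U + 3 / (n + 1) * kendallTau y j k - 3 * U =
      (3 * kendallTau y j k - 9 * U) / (n + 1) := by
    field_simp
    ring
  rw [e, abs_div, abs_of_pos (by linarith : (0 : ℝ) < n + 1)]
  have h3 : |3 * kendallTau y j k - 9 * U| ≤ 12 := by
    rw [abs_le] at h1 h2 ⊢
    constructor <;> linarith
  exact div_le_div₀ (by norm_num) h3 (by linarith) (by linarith)

/-! ### Sign kernels of Gaussian samples -/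

section GaussianSample

variable {d : ℕ} {S : Matrix (Fin d) (Fin d) ℝ}

/-- The difference of two members of a centred Gaussian sample is `√2` times a member. -/
lemma hasLaw_sub_of_indepFun {Ω : Type*} [MeasurableSpace Ω] {P : Measure Ω}
    [IsProbabilityMeasure P] (hS : S.PosSemidef) {X Y : Ω → EuclideanSpace ℝ (Fin d)}
    (hX : HasLaw X (multivariateGaussian 0 S) P) (hY : HasLaw Y (multivariateGaussian 0 S) P)
    (h : IndepFun X Y P) :
    HasLaw (fun ω => X ω - Y ω) ((multivariateGaussian 0 S).map fun z => √2 • z) P := by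
  have h1 : HasLaw (fun ω => (X ω, Y ω))
    ((multivariateGaussian 0 S).prod (multivariateGaussian 0 S)) P := h.hasLaw_prod hX hY
  refine ⟨hX.aemeasurable.sub hY.aemeasurable, ?_⟩
  rw [← map_add_smul_multivariateGaussian hS (c₁ := 1) (c₂ := -1) (c := √2)
    (by rw [Real.sq_sqrt zero_le_two]; norm_num), ← h1.map_eq,
    AEMeasurable.map_map_of_aemeasurable (by fun_prop) h1.aemeasurable]
  congr 1
  ext ω
  simp [sub_eq_add_neg]

lemma iIndepFun_eval_pi {ι V : Type*} [Fintype ι] [MeasurableSpace V] (μ : Measure V)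
    [IsProbabilityMeasure μ] :
    iIndepFun (fun (i : ι) (x : ι → V) => x i) (Measure.pi fun _ : ι => μ) :=
  iIndepFun_pi (X := fun _ => id) fun _ => aemeasurable_id

lemma hasLaw_eval_pi {ι V : Type*} [Fintype ι] [MeasurableSpace V] (μ : Measure V)
    [IsProbabilityMeasure μ] (i : ι) :
    HasLaw (fun x : ι → V => x i) μ (Measure.pi fun _ : ι => μ) :=
  (measurePreserving_eval (fun _ : ι => μ) i).hasLaw

/-- The sign vector of the difference of two sample members is sub-Gaussian. -/
lemma integral_exp_sum_sign_sub_le (hS : S.PosSemidef) (hdiag : ∀ j, S j j = 1) {L : ℝ}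
    (hL : 1 ≤ L)
    (hLS : ∀ v : Fin d → ℝ, ∑ i, ∑ j, v i * v j * S i j ≤ L * ∑ i, v i ^ 2) {r : ℕ} {p q : Fin r}
    (hpq : p ≠ q) (t : Fin d → ℝ) :
    ∫ x : Fin r → EuclideanSpace ℝ (Fin d), Real.exp (∑ j, t j * Real.sign (x p j - x q j))
      ∂Measure.pi (fun _ : Fin r => multivariateGaussian 0 S) ≤
        Real.exp (L * ∑ j, t j ^ 2 / 2) := by
  have hlaw := hasLaw_sub_of_indepFun hS (hasLaw_eval_pi (multivariateGaussian 0 S) p)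
    (hasLaw_eval_pi (multivariateGaussian 0 S) q)
    ((iIndepFun_eval_pi (ι := Fin r) (multivariateGaussian 0 S)).indepFun hpq)
  have hm : Measurable fun z : EuclideanSpace ℝ (Fin d) =>
      Real.exp (∑ j, t j * Real.sign (z j)) := by
    refine Real.measurable_exp.comp (Finset.measurable_fun_sum _ fun j _ => ?_)
    exact (Real.measurable_sign.comp (by fun_prop)).const_mul _
  have h1 := hlaw.integral_comp (f := fun z => Real.exp (∑ j, t j * Real.sign (z j)))
    hm.aestronglyMeasurable
  refine le_trans (le_of_eq ?_) (integral_exp_sum_sign_le hS hdiag hL hLS t)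
  refine h1.trans ?_
  rw [integral_map (by fun_prop) hm.aestronglyMeasurable]
  refine integral_congr_ae (.of_forall fun z => ?_)
  simp only [PiLp.smul_apply, smul_eq_mul]
  simp only [Real.sign_mul_of_pos (Real.sqrt_pos.2 zero_lt_two)]

/-- The coordinates of two independent members of the sample are almost surely different. -/
lemma ae_ne_of_indepFun {Ω : Type*} [MeasurableSpace Ω] {P : Measure Ω}
    [IsProbabilityMeasure P] (hS : S.PosSemidef) (hdiag : ∀ j, S j j = 1)
    {X Y : Ω → EuclideanSpace ℝ (Fin d)}
    (hX : HasLaw X (multivariateGaussian 0 S) P) (hY : HasLaw Y (multivariateGaussian 0 S) P)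
    (h : IndepFun X Y P) (j : Fin d) : ∀ᵐ ω ∂P, X ω j ≠ Y ω j := by
  have hlaw := hasLaw_sub_of_indepFun hS hX hY h
  have h0 : ∀ᵐ x ∂gaussianReal 0 1, x ≠ 0 := by
    have := nullSingletonClass_gaussianReal (μ := 0) (v := 1) one_ne_zero
    exact Measure.ae_ne _ 0
  have h1 : ∀ᵐ z ∂multivariateGaussian (0 : EuclideanSpace ℝ (Fin d)) S, z j ≠ 0 := by
    have hmp := measurePreserving_eval_multivariateGaussian
      (μ := (0 : EuclideanSpace ℝ (Fin d))) hS (i := j)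
    have e : gaussianReal ((0 : EuclideanSpace ℝ (Fin d)) j) (S j j).toNNReal =
        gaussianReal 0 1 := by simp [hdiag]
    rw [e] at hmp
    exact hmp.quasiMeasurePreserving.ae h0
  have hmeas : MeasurableSet {z : EuclideanSpace ℝ (Fin d) | z j ≠ 0} :=
    (measurableSet_singleton (0 : ℝ)).compl.preimage (by fun_prop : Measurable
      fun z : EuclideanSpace ℝ (Fin d) => z j)
  have h2 : ∀ᵐ z ∂(multivariateGaussian (0 : EuclideanSpace ℝ (Fin d)) S).map (fun z => √2 • z),
      z j ≠ 0 := by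
    rw [ae_map_iff (by fun_prop) hmeas]
    filter_upwards [h1] with z hz
    simpa using hz
  rw [← hlaw.map_eq] at h2
  filter_upwards [ae_of_ae_map hlaw.aemeasurable h2] with ω hω heq
  exact hω (by simp [heq])

/-- The joint law of an independent sample is Gaussian, so that Sheppard's formula applies to
differences of its members. -/
lemma isGaussian_pi_multivariateGaussian (r : ℕ) :
    IsGaussian (Measure.pi fun _ : Fin r =>
      multivariateGaussian (0 : EuclideanSpace ℝ (Fin d)) S) := by
  have h := iIndepFun.hasGaussianLaw
    (fun i : Fin r => (⟨by
      rw [(hasLaw_eval_pi (multivariateGaussian (0 : EuclideanSpace ℝ (Fin d)) S) i).map_eq]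
      infer_instance⟩ : HasGaussianLaw _ _))
    (iIndepFun_eval_pi (ι := Fin r) (multivariateGaussian (0 : EuclideanSpace ℝ (Fin d)) S))
  have := h.isGaussian_map
  rwa [show (fun (ω : Fin r → EuclideanSpace ℝ (Fin d)) (x : Fin r) => ω x) = id from rfl,
    Measure.map_id] at this

lemma integral_eval_mul_eval_pi (hS : S.PosSemidef) {r : ℕ} (p q : Fin r) (j k : Fin d) :
    ∫ x : Fin r → EuclideanSpace ℝ (Fin d), x p j * x q k
      ∂Measure.pi (fun _ : Fin r => multivariateGaussian 0 S) = if p = q then S j k else 0 := by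
  set μ := multivariateGaussian (0 : EuclideanSpace ℝ (Fin d)) S with hμ
  split_ifs with h
  · subst h
    have := (hasLaw_eval_pi μ p).integral_comp (f := fun z => z j * z k)
      (by fun_prop : Measurable fun z : EuclideanSpace ℝ (Fin d) =>
        z j * z k).aestronglyMeasurable
    exact this.trans (integral_eval_mul_eval_multivariateGaussian hS j k)
  · have hind := (iIndepFun_eval_pi (ι := Fin r) μ).indepFun h
    have hj : ∀ (i : Fin r) (j : Fin d), Measurable
        fun x : Fin r → EuclideanSpace ℝ (Fin d) => x i j := fun i j =>
      (by fun_prop : Measurable fun z : EuclideanSpace ℝ (Fin d) => z j).comp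
        (measurable_pi_apply i)
    have hind' : IndepFun (fun x : Fin r → EuclideanSpace ℝ (Fin d) => x p j)
        (fun x : Fin r → EuclideanSpace ℝ (Fin d) => x q k) (Measure.pi fun _ : Fin r => μ) :=
      hind.comp (φ := fun z : EuclideanSpace ℝ (Fin d) => z j)
        (ψ := fun z : EuclideanSpace ℝ (Fin d) => z k) (by fun_prop) (by fun_prop)
    have h1 := hind'.integral_mul_eq_mul_integral (hj p j).aestronglyMeasurable
        (hj q k).aestronglyMeasurable
    have h2 := (hasLaw_eval_pi μ p).integral_comp (f := fun z => z j)
      (by fun_prop : Measurable fun z : EuclideanSpace ℝ (Fin d) => z j).aestronglyMeasurable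
    have h3 : ∫ x : Fin r → EuclideanSpace ℝ (Fin d), x p j ∂Measure.pi (fun _ : Fin r => μ) = 0 :=
      h2.trans (integral_eval_multivariateGaussian j)
    refine h1.trans ?_
    refine (congrArg (· * _) h3).trans (zero_mul _)

/-- The population value of the sign kernels: comparing with the same index gives Kendall's tau,
comparing with two different indices halves the correlation and gives Spearman's rho. -/
lemma integral_sign_sub_mul_sign_sub (hS : S.PosSemidef) (hdiag : ∀ j, S j j = 1) {r : ℕ}
    {o p q : Fin r} (hp : o ≠ p) (hq : o ≠ q) {c : ℝ} (hc : c = if p = q then 1 else 1 / 2)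
    (j k : Fin d) :
    ∫ x : Fin r → EuclideanSpace ℝ (Fin d),
        Real.sign (x o j - x p j) * Real.sign (x o k - x q k)
      ∂Measure.pi (fun _ : Fin r => multivariateGaussian 0 S) =
        2 / Real.pi * Real.arcsin (c * S j k) := by
  set ν := Measure.pi (fun _ : Fin r => multivariateGaussian (0 : EuclideanSpace ℝ (Fin d)) S)
    with hν
  have hgauss : IsGaussian ν := isGaussian_pi_multivariateGaussian r
  let E : Fin r → Fin d → StrongDual ℝ (Fin r → EuclideanSpace ℝ (Fin d)) := fun i j =>
    (EuclideanSpace.proj j : EuclideanSpace ℝ (Fin d) →L[ℝ] ℝ).comp (ContinuousLinearMap.proj i)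
  have hE : ∀ i j x, E i j x = x i j := fun _ _ _ => rfl
  have hmem : ∀ i j, MemLp (fun x => E i j x) 2 ν := fun i j =>
    (memLp_eval_multivariateGaussian j).comp_measurePreserving
      (measurePreserving_eval (fun _ : Fin r => multivariateGaussian 0 S) i)
  have hi1 : ∀ i j, Integrable (fun x => E i j x) ν := fun i j =>
    (hmem i j).integrable (by norm_num)
  have hi2 : ∀ i j i' j', Integrable (fun x => E i j x * E i' j' x) ν := fun i j i' j' =>
    (hmem i j).integrable_mul (hmem i' j')
  have hm0 : ∀ i j, ∫ x, E i j x ∂ν = 0 := by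
    intro i j
    have h2 := (hasLaw_eval_pi (multivariateGaussian (0 : EuclideanSpace ℝ (Fin d)) S)
      i).integral_comp (f := fun z => z j)
      (by fun_prop : Measurable fun z : EuclideanSpace ℝ (Fin d) => z j).aestronglyMeasurable
    exact h2.trans (integral_eval_multivariateGaussian j)
  have hm1 : ∀ i i' j, ∫ x, (E i j - E i' j) x ∂ν = 0 := by
    intro i i' j
    have := integral_sub (hi1 i j) (hi1 i' j)
    rw [hm0, hm0, sub_zero] at this
    exact this
  have hm2 : ∀ i i' j l l' k, ∫ x, (E i j - E i' j) x * (E l k - E l' k) x ∂ν =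
      (if i = l then S j k else 0) - (if i = l' then S j k else 0) -
        ((if i' = l then S j k else 0) - (if i' = l' then S j k else 0)) := by
    intro i i' j l l' k
    have e : ∀ x, (E i j - E i' j) x * (E l k - E l' k) x =
        (E i j x * E l k x - E i j x * E l' k x) - (E i' j x * E l k x - E i' j x * E l' k x) := by
      intro x
      change (E i j x - E i' j x) * (E l k x - E l' k x) = _
      ring
    have i1 : ∀ i, Integrable (fun x => E i j x * E l k x - E i j x * E l' k x) ν := fun i =>
      (hi2 i j l k).sub (hi2 i j l' k)
    simp only [e]
    rw [integral_sub (i1 i) (i1 i'), integral_sub (hi2 _ _ _ _) (hi2 _ _ _ _),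
      integral_sub (hi2 _ _ _ _) (hi2 _ _ _ _)]
    simp only [hE]
    rw [integral_eval_mul_eval_pi hS, integral_eval_mul_eval_pi hS, integral_eval_mul_eval_pi hS,
      integral_eval_mul_eval_pi hS]
  have habs := abs_le.1 (posSemidef_abs_apply_le_one hS hdiag j k)
  refine integral_sign_mul_sign_of_isGaussian (L₁ := E o j - E p j) (L₂ := E o k - E q k)
    (s := 2) two_pos ?_ (hm1 _ _ _) (hm1 _ _ _) ?_ ?_ ?_
  · rw [hc, abs_le]
    split_ifs <;> constructor <;> linarith
  · rw [hm2]
    simp [hp, hp.symm, hdiag]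
    norm_num
  · rw [hm2]
    simp [hq, hq.symm, hdiag]
    norm_num
  · rw [hm2, hc]
    simp only [hp.symm, hq, if_true, if_false]
    split_ifs <;> ring

end GaussianSample

lemma spectralNorm₂_le_of_abs_le {d : ℕ} {A : Matrix (Fin d) (Fin d) ℝ} {B : ℝ} (hB : 0 ≤ B)
    (h : ∀ i j, |A i j| ≤ B) : spectralNorm₂ A ≤ d * B := by
  refine (spectralNorm₂_le_frobenius A).trans ?_
  rw [Real.sqrt_le_left (by positivity)]
  calc ∑ i, ∑ j, A i j ^ 2 ≤ ∑ _i : Fin d, ∑ _j : Fin d, B ^ 2 := by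
        refine Finset.sum_le_sum fun i _ => Finset.sum_le_sum fun j _ => ?_
        rw [← sq_abs]
        exact pow_le_pow_left₀ (abs_nonneg _) (h i j) 2
    _ = (d * B) ^ 2 := by simp; ring

/-! ### The sine transform of a matrix of U-statistics -/

section SineTransform

variable {d : ℕ} {S : Matrix (Fin d) (Fin d) ℝ}

lemma sum_mul_le_spectralNorm₂ (S : Matrix (Fin d) (Fin d) ℝ) (v : Fin d → ℝ) :
    ∑ i, ∑ j, v i * v j * S i j ≤ spectralNorm₂ S * ∑ i, v i ^ 2 := by
  have h := bilin_le_spectralNorm₂ S (WithLp.toLp 2 v) (WithLp.toLp 2 v)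
  rw [← sq, EuclideanSpace.real_norm_sq_eq] at h
  refine le_trans (le_of_eq ?_) h
  refine Finset.sum_congr rfl fun i _ => Finset.sum_congr rfl fun j _ => ?_
  change _ = v i * S i j * v j
  ring

lemma one_le_spectralNorm₂ (hd : 0 < d) (hdiag : ∀ j, S j j = 1) : 1 ≤ spectralNorm₂ S := by
  have h := sum_mul_le_spectralNorm₂ S (Pi.single ⟨0, hd⟩ 1)
  simpa [Pi.single_apply, hdiag, ite_and] using h

/-- Estimation error, in expected spectral norm, of the sine transform of a matrix of U-statistics
with sign kernels. With `p = q` this is the estimator based on Kendall's tau, with `p ≠ q` it is,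
up to a factor `2` and a term of order `d / n`, the one based on Spearman's rho. -/
theorem exists_majorant_sin_embeddingAverage {Ω : Type*} [MeasurableSpace Ω] {P : Measure Ω}
    [IsProbabilityMeasure P] {n m r : ℕ} (hm : 0 < m) (hmr : m * r ≤ n) (hd : 0 < d) (hdm : d ≤ m)
    (hS : S.PosSemidef) (hdiag : ∀ j, S j j = 1) {X : Fin n → Ω → EuclideanSpace ℝ (Fin d)}
    (hlaw : ∀ i, HasLaw (X i) (multivariateGaussian 0 S) P) (hind : iIndepFun X P)
    {o p q : Fin r} (hp : o ≠ p) (hq : o ≠ q) {c : ℝ} (hc : c = if p = q then 1 else 1 / 2) :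
    ∃ G : Ω → ℝ, Integrable G P ∧
      ∫ ω, G ω ∂P ≤ 1024 * spectralNorm₂ S * √((d : ℝ) / m) + 40 * ((d : ℝ) / m) ∧
      ∀ ω, spectralNorm₂ (Matrix.of fun j k => Real.sin (Real.pi / 2 *
        embeddingAverage fun τ : Fin r ↪ Fin n =>
          Real.sign (X (τ o) ω j - X (τ p) ω j) * Real.sign (X (τ o) ω k - X (τ q) ω k)) -
            c * S j k) ≤ G ω := by
  set ν := Measure.pi (fun _ : Fin r => multivariateGaussian (0 : EuclideanSpace ℝ (Fin d)) S)
    with hν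
  have hL := one_le_spectralNorm₂ hd hdiag
  let a : Fin r → Fin d → (Fin r → EuclideanSpace ℝ (Fin d)) → ℝ := fun p j x =>
    Real.sign (x o j - x p j)
  have ham : ∀ p j, Measurable (a p j) := by
    intro p j
    have hev : ∀ i : Fin r, Measurable fun x : Fin r → EuclideanSpace ℝ (Fin d) => x i j :=
      fun i => (by fun_prop : Measurable fun z : EuclideanSpace ℝ (Fin d) => z j).comp
        (measurable_pi_apply i)
    exact Real.measurable_sign.comp ((hev o).sub (hev p))
  have ha1 : ∀ p j x, |a p j x| ≤ 1 := fun p j x => Real.abs_sign_le_one _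
  have hsub : ∀ p, o ≠ p → ∀ u : Fin d → ℝ, ∫ x, Real.exp (∑ j, u j * a p j x) ∂ν ≤
      Real.exp (spectralNorm₂ S * ∑ j, u j ^ 2 / 2) := fun p hp u =>
    integral_exp_sum_sign_sub_le hS hdiag hL (sum_mul_le_spectralNorm₂ S) hp u
  have hab1 : ∀ j k x, |a p j x * a q k x| ≤ 1 := by
    intro j k x
    rw [abs_mul]
    exact mul_le_one₀ (ha1 p j x) (abs_nonneg _) (ha1 q k x)
  obtain ⟨G₁, hG₁i, hG₁, hG₁'⟩ := exists_majorant_spectralNorm₂ hm hmr hd hdm hlaw hind (ham p)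
    (ham q) (ha1 p) (ha1 q) (by linarith) (hsub p hp) (hsub q hq)
  obtain ⟨G₂, hG₂i, hG₂, hG₂'⟩ := exists_majorant_sqrt_sum_pow_four hm hmr hd hlaw hind
    (h := fun j k x => a p j x * a q k x) (fun j k => (ham p j).mul (ham q k)) hab1
  refine ⟨fun ω => 4 * G₁ ω + 4 * G₂ ω, (hG₁i.const_mul 4).add (hG₂i.const_mul 4), ?_,
    fun ω => ?_⟩
  · rw [integral_add (hG₁i.const_mul 4) (hG₂i.const_mul 4), integral_const_mul,
      integral_const_mul]
    linarith
  have hpi := Real.pi_pos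
  have hpi4 := Real.pi_le_four
  have : Nonempty (Fin r ↪ Fin n) := by
    have : r ≤ n := (Nat.le_mul_of_pos_left r hm).trans hmr
    exact ⟨Fin.castLEEmb this⟩
  set U : Fin d → Fin d → ℝ := fun j k => embeddingAverage fun τ : Fin r ↪ Fin n =>
    a p j (fun i => X (τ i) ω) * a q k (fun i => X (τ i) ω) with hU
  set D : Matrix (Fin d) (Fin d) ℝ := Matrix.of fun j k => embeddingAverage
    fun τ : Fin r ↪ Fin n => a p j (fun i => X (τ i) ω) * a q k (fun i => X (τ i) ω) -
      ∫ x, a p j x * a q k x ∂ν with hD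
  have hDU : ∀ j k, D j k = U j k - 2 / Real.pi * Real.arcsin (c * S j k) := by
    intro j k
    have h1 : ∫ x, a p j x * a q k x ∂ν = 2 / Real.pi * Real.arcsin (c * S j k) :=
      integral_sign_sub_mul_sign_sub hS hdiag hp hq hc j k
    rw [hD, Matrix.of_apply, h1]
    have h2 := embeddingAverage_add
      (fun τ : Fin r ↪ Fin n => a p j (fun i => X (τ i) ω) * a q k (fun i => X (τ i) ω))
      (fun _ => -(2 / Real.pi * Real.arcsin (c * S j k)))
    rw [embeddingAverage_const] at h2
    simpa only [sub_eq_add_neg] using h2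
  have hc01 : 0 ≤ c ∧ c ≤ 1 := by
    rw [hc]; split_ifs <;> norm_num
  have hsin := spectralNorm₂_sin_arcsin_add_sub_le (S := c • S) (hS.smul hc01.1) (fun i j => by
    rw [Matrix.smul_apply, smul_eq_mul, abs_mul, abs_of_nonneg hc01.1]
    exact mul_le_one₀ hc01.2 (abs_nonneg _) (posSemidef_abs_apply_le_one hS hdiag i j))
    ((Real.pi / 2) • D)
  have e1 : (Matrix.of fun j k => Real.sin (Real.pi / 2 * U j k) - c * S j k) =
      Matrix.of fun i j => Real.sin (Real.arcsin ((c • S) i j) + ((Real.pi / 2) • D) i j) -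
        (c • S) i j := by
    ext j k
    simp only [Matrix.of_apply, Matrix.smul_apply, smul_eq_mul, hDU]
    congr 2
    field_simp
    ring
  change spectralNorm₂ (Matrix.of fun j k => Real.sin (Real.pi / 2 * U j k) - c * S j k) ≤ _
  rw [e1]
  refine hsin.trans (add_le_add ?_ ?_)
  · rw [spectralNorm₂_smul, abs_of_pos (by positivity)]
    have h1 : spectralNorm₂ D ≤ G₁ ω := hG₁' ω
    have h2 := spectralNorm₂_nonneg D
    nlinarith
  · have h1 : √(∑ i, ∑ j, D i j ^ 4) ≤ G₂ ω := hG₂' ω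
    have h2 : ∑ i, ∑ j, ((Real.pi / 2) • D) i j ^ 4 =
        ((Real.pi / 2) ^ 2) ^ 2 * ∑ i, ∑ j, D i j ^ 4 := by
      rw [Finset.mul_sum]
      refine Finset.sum_congr rfl fun i _ => ?_
      rw [Finset.mul_sum]
      refine Finset.sum_congr rfl fun j _ => ?_
      rw [Matrix.smul_apply, smul_eq_mul]
      ring
    rw [h2, Real.sqrt_mul (by positivity), Real.sqrt_sq (by positivity)]
    have h3 : (Real.pi / 2) ^ 2 ≤ 4 := by nlinarith
    have h4 : 0 ≤ √(∑ i, ∑ j, D i j ^ 4) := Real.sqrt_nonneg _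
    nlinarith

end SineTransform

/-! ### The estimators and their leading eigenprojections -/

section Estimators

variable {Ω : Type*} [MeasurableSpace Ω] {P : Measure Ω} {n d : ℕ}
  {S : Matrix (Fin d) (Fin d) ℝ} {f : Fin d → ℝ → ℝ} {X : Fin n → Ω → EuclideanSpace ℝ (Fin d)}
  {Y : Fin n → Fin d → Ω → ℝ}

lemma StrictMono.sign_sub {g : ℝ → ℝ} (hg : StrictMono g) (a b : ℝ) :
    Real.sign (g a - g b) = Real.sign (a - b) := by
  rcases lt_trichotomy a b with h | h | h
  · rw [Real.sign_of_neg (sub_neg.2 h), Real.sign_of_neg (sub_neg.2 (hg h))]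
  · rw [h, sub_self, sub_self]
  · rw [Real.sign_of_pos (sub_pos.2 h), Real.sign_of_pos (sub_pos.2 (hg h))]

lemma IsGaussianCopulaSample.sign_sub (h : IsGaussianCopulaSample P S f X Y) (i i' : Fin n)
    (j : Fin d) (ω : Ω) : Real.sign (Y i j ω - Y i' j ω) = Real.sign (X i ω j - X i' ω j) := by
  rw [h.obs, h.obs, (h.strictMono j).sign_sub]

lemma IsGaussianCopulaSample.ae_injective [IsProbabilityMeasure P]
    (h : IsGaussianCopulaSample P S f X Y)
    (hS : S.PosSemidef) : ∀ᵐ ω ∂P, ∀ j, Function.Injective fun i => Y i j ω := by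
  have h1 : ∀ᵐ ω ∂P, ∀ (j : Fin d) (i i' : Fin n), i ≠ i' → X i ω j ≠ X i' ω j := by
    rw [ae_all_iff]; intro j
    rw [ae_all_iff]; intro i
    rw [ae_all_iff]; intro i'
    rw [Filter.eventually_imp_distrib_left]
    intro hne
    exact ae_ne_of_indepFun hS h.unit_diag (h.law i) (h.law i') (h.indep.indepFun hne) j
  filter_upwards [h1] with ω hω j i i' heq
  by_contra hne
  refine hω j i i' hne ((h.strictMono j).injective ?_)
  simpa only [h.obs] using heq

/-- Kendall's estimator compares both coordinates with the same second observation. Blocks of two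
would allow `n / 2` of them; `n / 3` is used to match Spearman's estimator. -/
lemma IsGaussianCopulaSample.exists_majorant_kendallEstimator [IsProbabilityMeasure P]
    (h : IsGaussianCopulaSample P S f X Y) (hS : S.PosSemidef) (hn : 3 ≤ n) (hd : 0 < d)
    (hdm : d ≤ n / 3) :
    ∃ G : Ω → ℝ, Integrable G P ∧
      ∫ ω, G ω ∂P ≤ 1024 * spectralNorm₂ S * √((d : ℝ) / (n / 3 : ℕ)) +
        40 * ((d : ℝ) / (n / 3 : ℕ)) ∧
      ∀ ω, spectralNorm₂ ((kendallEstimator fun i j => Y i j ω) - S) ≤ G ω := by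
  obtain ⟨G, hGi, hG, hG'⟩ := exists_majorant_sin_embeddingAverage (r := 2) (m := n / 3)
    (by omega) (by omega) hd hdm hS h.unit_diag h.law h.indep (o := 0) (p := 1) (q := 1)
    (by decide) (by decide) (c := 1) (by simp)
  refine ⟨G, hGi, hG, fun ω => le_trans (le_of_eq ?_) (hG' ω)⟩
  congr 1
  ext j k
  rw [Matrix.sub_apply, kendallEstimator, Matrix.of_apply, Matrix.of_apply,
    kendallTau_eq_embeddingAverage, one_mul]
  simp only [h.sign_sub]

/-- Spearman's estimator compares the two coordinates with different observations, which halves the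
population correlation. The bound holds almost surely, in the absence of ties. -/
lemma IsGaussianCopulaSample.exists_majorant_spearmanEstimator [IsProbabilityMeasure P]
    (h : IsGaussianCopulaSample P S f X Y) (hS : S.PosSemidef) (hn : 3 ≤ n) (hd : 0 < d)
    (hdm : d ≤ n / 3) :
    ∃ G : Ω → ℝ, Integrable G P ∧
      ∫ ω, G ω ∂P ≤ 2048 * spectralNorm₂ S * √((d : ℝ) / (n / 3 : ℕ)) +
        80 * ((d : ℝ) / (n / 3 : ℕ)) + 16 * ((d : ℝ) / n) ∧
      ∀ᵐ ω ∂P, spectralNorm₂ ((spearmanEstimator fun i j => Y i j ω) - S) ≤ G ω := by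
  obtain ⟨G, hGi, hG, hG'⟩ := exists_majorant_sin_embeddingAverage (r := 3) (m := n / 3)
    (by omega) (by omega) hd hdm hS h.unit_diag h.law h.indep (o := 0) (p := 1) (q := 2)
    (by decide) (by decide) (c := 1 / 2) (by simp)
  refine ⟨fun ω => 2 * G ω + 16 * ((d : ℝ) / n), (hGi.const_mul 2).add (integrable_const _), ?_, ?_⟩
  · rw [integral_add (hGi.const_mul 2) (integrable_const _), integral_const_mul]
    simp only [integral_const, probReal_univ, smul_eq_mul, one_mul]
    linarith
  filter_upwards [h.ae_injective hS] with ω hω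
  have hn' : (0 : ℝ) < n := by exact_mod_cast (by omega : 0 < n)
  set U : Fin d → Fin d → ℝ := fun j k => embeddingAverage fun τ : Fin 3 ↪ Fin n =>
    Real.sign (X (τ 0) ω j - X (τ 1) ω j) * Real.sign (X (τ 0) ω k - X (τ 2) ω k) with hU
  set A : Matrix (Fin d) (Fin d) ℝ :=
    Matrix.of fun j k => Real.sin (Real.pi / 2 * U j k) - 1 / 2 * S j k with hA
  set B : Matrix (Fin d) (Fin d) ℝ := Matrix.of fun j k =>
    2 * Real.sin (Real.pi / 6 * spearmanRho (fun i j => Y i j ω) j k) -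
      2 * Real.sin (Real.pi / 2 * U j k) with hB
  have hsum : (spearmanEstimator fun i j => Y i j ω) - S = (2 : ℝ) • A + B := by
    ext j k
    simp only [Matrix.sub_apply, Matrix.add_apply, Matrix.smul_apply, smul_eq_mul,
      spearmanEstimator, Matrix.of_apply, hA, hB]
    ring
  have hAle : spectralNorm₂ A ≤ G ω := hG' ω
  have hBle : spectralNorm₂ B ≤ d * (16 / n) := by
    refine spectralNorm₂_le_of_abs_le (by positivity) fun j k => ?_
    rw [hB, Matrix.of_apply, ← mul_sub, abs_mul, abs_two]
    have h1 := abs_spearmanRho_sub_le hn (y := fun i j => Y i j ω) (hω j) (hω k)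
    simp only [h.sign_sub] at h1
    have h2 := Real.abs_sin_sub_sin_le (Real.pi / 6 * spearmanRho (fun i j => Y i j ω) j k)
      (Real.pi / 2 * U j k)
    have e : Real.pi / 6 * spearmanRho (fun i j => Y i j ω) j k - Real.pi / 2 * U j k =
        Real.pi / 6 * (spearmanRho (fun i j => Y i j ω) j k - 3 * U j k) := by ring
    rw [e, abs_mul, abs_of_pos (by positivity : 0 < Real.pi / 6)] at h2
    have h3 : Real.pi / 6 ≤ 2 / 3 := by linarith [Real.pi_le_four]
    calc _ ≤ 2 * (Real.pi / 6 * |spearmanRho (fun i j => Y i j ω) j k - 3 * U j k|) := by gcongr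
      _ ≤ 2 * (2 / 3 * (12 / n)) := by gcongr
      _ = 16 / n := by ring
  rw [hsum]
  refine (spectralNorm₂_add_le _ _).trans ?_
  rw [spectralNorm₂_smul, abs_two]
  have : (d : ℝ) * (16 / n) = 16 * (d / n) := by ring
  linarith

/-- Expected error of a projection-valued estimator, from a majorant of the error of the matrix
estimator. -/
lemma integral_norm_sub_le_of_majorant {k : ℕ} (hk : k < d) (hk1 : 1 ≤ k) (hS : S.PosSemidef)
    (hgap : orderedEigenvalue hS.isHermitian ⟨k, hk⟩ <
      orderedEigenvalue hS.isHermitian ⟨k - 1, lt_of_le_of_lt (Nat.sub_le k 1) hk⟩)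
    {Pk : EuclideanSpace ℝ (Fin d) →L[ℝ] EuclideanSpace ℝ (Fin d)}
    (hPk : IsLeadingEigenprojection S k Pk)
    {A : Ω → Matrix (Fin d) (Fin d) ℝ}
    {Q : Ω → EuclideanSpace ℝ (Fin d) →L[ℝ] EuclideanSpace ℝ (Fin d)}
    (hQ : ∀ᵐ ω ∂P, IsLeadingEigenprojection (A ω) k (Q ω))
    {G : Ω → ℝ} (hGi : Integrable G P) (hG : ∀ᵐ ω ∂P, spectralNorm₂ (A ω - S) ≤ G ω) :
    ∫ ω, ‖Q ω - Pk‖ ∂P ≤ 4 * (∫ ω, G ω ∂P) /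
      (orderedEigenvalue hS.isHermitian ⟨k - 1, lt_of_le_of_lt (Nat.sub_le k 1) hk⟩ -
        orderedEigenvalue hS.isHermitian ⟨k, hk⟩) := by
  set δ := orderedEigenvalue hS.isHermitian ⟨k - 1, lt_of_le_of_lt (Nat.sub_le k 1) hk⟩ -
        orderedEigenvalue hS.isHermitian ⟨k, hk⟩ with hδ
  have hδ0 : 0 < δ := sub_pos.2 hgap
  rw [← integral_const_mul, ← integral_div]
  refine integral_mono_of_nonneg (.of_forall fun _ => norm_nonneg _)
    ((hGi.const_mul 4).div_const δ) ?_
  filter_upwards [hQ, hG] with ω h1 h2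
  rw [le_div_iff₀ hδ0, mul_comm]
  exact (hPk.gap_mul_norm_sub_le hS hk hk1 h1).trans (by linarith)

lemma integrable_norm_sub_of_isLeadingEigenprojection [IsProbabilityMeasure P] {k : ℕ}
    {Pk : EuclideanSpace ℝ (Fin d) →L[ℝ] EuclideanSpace ℝ (Fin d)}
    (hPk : IsLeadingEigenprojection S k Pk) {A : Ω → Matrix (Fin d) (Fin d) ℝ}
    {Q : Ω → EuclideanSpace ℝ (Fin d) →L[ℝ] EuclideanSpace ℝ (Fin d)}
    (hQm : AEStronglyMeasurable Q P)
    (hQ : ∀ᵐ ω ∂P, IsLeadingEigenprojection (A ω) k (Q ω)) :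
    Integrable (fun ω => ‖Q ω - Pk‖) P := by
  refine Integrable.of_bound (hQm.sub aestronglyMeasurable_const).norm 2 ?_
  filter_upwards [hQ] with ω h1
  rw [norm_norm]
  exact hPk.norm_sub_le_two h1

end Estimators

theorem mainTheorem7 :
    ∃ C : ℝ, 0 < C ∧
      ∀ (n d k : ℕ) (_ : 2 ≤ n) (_ : 1 ≤ k) (hk : k < d)
        (Ω : Type*) [MeasurableSpace Ω] (P : Measure Ω) [IsProbabilityMeasure P]
        (S : Matrix (Fin d) (Fin d) ℝ) (hS : S.PosSemidef)
        (f : Fin d → ℝ → ℝ)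
        (X : Fin n → Ω → EuclideanSpace ℝ (Fin d)) (Y : Fin n → Fin d → Ω → ℝ)
        (_ : IsGaussianCopulaSample P S f X Y)
        (_ : orderedEigenvalue hS.isHermitian ⟨k, hk⟩ <
          orderedEigenvalue hS.isHermitian ⟨k - 1, lt_of_le_of_lt (Nat.sub_le k 1) hk⟩)
        (Pk : EuclideanSpace ℝ (Fin d) →L[ℝ] EuclideanSpace ℝ (Fin d))
        (_ : IsLeadingEigenprojection S k Pk)
        (Pτ Pρ : Ω → EuclideanSpace ℝ (Fin d) →L[ℝ] EuclideanSpace ℝ (Fin d))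
        (_ : AEStronglyMeasurable Pτ P) (_ : AEStronglyMeasurable Pρ P)
        (_ : ∀ᵐ ω ∂P, IsLeadingEigenprojection (kendallEstimator fun i j => Y i j ω) k (Pτ ω))
        (_ : ∀ᵐ ω ∂P, IsLeadingEigenprojection (spearmanEstimator fun i j => Y i j ω) k (Pρ ω)),
        Integrable (fun ω => ‖Pτ ω - Pk‖) P ∧ Integrable (fun ω => ‖Pρ ω - Pk‖) P ∧
        max (∫ ω, ‖Pτ ω - Pk‖ ∂P) (∫ ω, ‖Pρ ω - Pk‖ ∂P) ≤
          C * spectralNorm₂ S * (√((d : ℝ) / n) + (d : ℝ) / n) /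
            (orderedEigenvalue hS.isHermitian ⟨k - 1, lt_of_le_of_lt (Nat.sub_le k 1) hk⟩ -
              orderedEigenvalue hS.isHermitian ⟨k, hk⟩) := by
  -- `24576 = 4 * 2048 * 3`: Davis–Kahan, Spearman's estimator, and `√(d / (n / 3)) ≤ 3 * √(d / n)`
  refine ⟨24576, by norm_num, ?_⟩
  intro n d k hn hk1 hk Ω _ P _ S hS f X Y hXY hgap Pk hPk Pτ Pρ hPτm hPρm hPτ hPρ
  have hτi := integrable_norm_sub_of_isLeadingEigenprojection hPk hPτm hPτ
  have hρi := integrable_norm_sub_of_isLeadingEigenprojection hPk hPρm hPρ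
  refine ⟨hτi, hρi, ?_⟩
  have hd : 0 < d := by omega
  have hL := one_le_spectralNorm₂ hd hXY.unit_diag
  have hn' : (0 : ℝ) < n := by exact_mod_cast (by omega : 0 < n)
  have hsq : 0 ≤ √((d : ℝ) / n) := Real.sqrt_nonneg _
  have hdn : 0 ≤ (d : ℝ) / n := by positivity
  have hδ0 := sub_pos.2 hgap
  by_cases hdm : d ≤ n / 3
  · have hn3 : 3 ≤ n := by omega
    have hm : 0 < n / 3 := by omega
    -- rounding down in `n / 3` costs the most at `n = 5`
    have hm5 : (n : ℝ) / 5 ≤ (n / 3 : ℕ) := by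
      have : n ≤ 5 * (n / 3) := by omega
      have : (n : ℝ) ≤ 5 * (n / 3 : ℕ) := by exact_mod_cast this
      linarith
    have h1 : (d : ℝ) / (n / 3 : ℕ) ≤ 5 * (d / n) := by
      calc (d : ℝ) / (n / 3 : ℕ) ≤ d / (n / 5) := by gcongr
        _ = _ := by field_simp
    have h2 : √((d : ℝ) / (n / 3 : ℕ)) ≤ 3 * √((d : ℝ) / n) := by
      calc _ ≤ √(3 ^ 2 * ((d : ℝ) / n)) := Real.sqrt_le_sqrt (by linarith)
        _ = _ := by rw [Real.sqrt_mul (by norm_num), Real.sqrt_sq (by norm_num)]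
    have h3 : spectralNorm₂ S * √((d : ℝ) / (n / 3 : ℕ)) ≤
        3 * (spectralNorm₂ S * √((d : ℝ) / n)) := by
      calc _ ≤ spectralNorm₂ S * (3 * √((d : ℝ) / n)) := by gcongr
        _ = _ := by ring
    have h4 : (d : ℝ) / n ≤ spectralNorm₂ S * (d / n) := le_mul_of_one_le_left hdn hL
    have h5 : 0 ≤ spectralNorm₂ S * √((d : ℝ) / n) := by positivity
    obtain ⟨G, hGi, hG, hG'⟩ := hXY.exists_majorant_kendallEstimator hS hn3 hd hdm
    obtain ⟨H, hHi, hH, hH'⟩ := hXY.exists_majorant_spearmanEstimator hS hn3 hd hdm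
    refine max_le ?_ ?_
    · refine (integral_norm_sub_le_of_majorant hk hk1 hS hgap hPk hPτ hGi
        (.of_forall hG')).trans ?_
      exact div_le_div_of_nonneg_right (by linarith) hδ0.le
    · refine (integral_norm_sub_le_of_majorant hk hk1 hS hgap hPk hPρ hHi hH').trans ?_
      exact div_le_div_of_nonneg_right (by linarith) hδ0.le
  · -- few observations: the right-hand side exceeds the trivial bound `2`
    have h1 : (1 : ℝ) / 3 ≤ d / n := by
      rw [div_le_div_iff₀ (by norm_num) hn']
      have : n ≤ d * 3 := by omega
      have : (n : ℝ) ≤ d * 3 := by exact_mod_cast this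
      linarith
    have h2 : ∀ Q : Ω → EuclideanSpace ℝ (Fin d) →L[ℝ] EuclideanSpace ℝ (Fin d),
        Integrable (fun ω => ‖Q ω - Pk‖) P → (∀ᵐ ω ∂P, ‖Q ω - Pk‖ ≤ 2) →
        ∫ ω, ‖Q ω - Pk‖ ∂P ≤ 2 := by
      intro Q hQi hQ2
      refine (integral_mono_ae hQi (integrable_const 2) hQ2).trans_eq ?_
      simp
    have h3 : 2 ≤ 24576 * spectralNorm₂ S * (√((d : ℝ) / n) + (d : ℝ) / n) /
        (orderedEigenvalue hS.isHermitian ⟨k - 1, lt_of_le_of_lt (Nat.sub_le k 1) hk⟩ -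
          orderedEigenvalue hS.isHermitian ⟨k, hk⟩) := by
      rw [le_div_iff₀ hδ0]
      have h4 := orderedEigenvalue_le_spectralNorm hS.isHermitian
        ⟨k - 1, lt_of_le_of_lt (Nat.sub_le k 1) hk⟩
      have h5 := orderedEigenvalue_nonneg hS ⟨k, hk⟩
      nlinarith
    refine max_le ?_ ?_
    · refine (h2 Pτ hτi ?_).trans h3
      filter_upwards [hPτ] with ω hω using hPk.norm_sub_le_two hω
    · refine (h2 Pρ hρi ?_).trans h3
      filter_upwards [hPρ] with ω hω using hPk.norm_sub_le_two hω
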